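/- Let $p>0$ be a prime number and let $k$ be an algebraically closed field of characteristic $p$. Then there are a normal variety $X$ over $k$ of dimension $4$, an effective Weil $\mathbb{Q}$-divisor $\Delta$ on $X$ and a reduced effective Cartier divisor $S\subset X$ such that the pair $(X, S+\Delta)$ is log canonical, but the scheme $S$ is not weakly normal. Here $(X,B)$ is log canonical if $K_X+B$ is $\mathbb{Q}$-Cartier and the discrepancy satisfies $a(E,X,B)\geq -1$ for every prime divisor $E$ over $X$, that is, for every prime divisor $E$ on a normal variety $Y$ with a birational morphism $f\colon Y\to X$, where $a(E,X,B)$ is the coefficient of $E$ in $K_Y-f^*(K_X+B)$. A reduced scheme $S$ is weakly normal if every finite, birational universal homeomorphism $T\to S$ with $T$ reduced is an isomorphism. -/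

import Mathlib

open CategoryTheory AlgebraicGeometry

universe u

namespace LCPairs

noncomputable section

/-! ### Morphisms: birational morphisms, universal homeomorphisms, weak normality -/

/-- A morphism of schemes is birational if it restricts to an isomorphism over a dense open
subset of the target whose preimage is dense in the source. -/
def IsBirationalMorphism {Y X : Scheme.{u}} (f : Y ⟶ X) : Prop :=
  ∃ U : X.Opens, Dense (U : Set X) ∧ Dense ((f ⁻¹ᵁ U : Y.Opens) : Set Y) ∧ IsIso (f ∣_ U)

/-- A morphism of schemes is a universal homeomorphism if each of its base changes is a
homeomorphism of the underlying topological spaces. -/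
def IsUniversalHomeomorphism {Y X : Scheme.{u}} (f : Y ⟶ X) : Prop :=
  MorphismProperty.universally (topologically fun g => IsHomeomorph g) f

/-- A scheme `S` is weakly normal if it is reduced and every finite, birational universal
homeomorphism from a reduced scheme to `S` is an isomorphism. -/
def IsWeaklyNormal (S : Scheme.{u}) : Prop :=
  IsReduced S ∧ ∀ (T : Scheme.{u}) (g : T ⟶ S), IsReduced T → IsFinite g →
    IsBirationalMorphism g → IsUniversalHomeomorphism g → IsIso g

/-! ### Varieties and divisors -/

/-- A normal variety over `k`: an integral scheme, separated and of finite type over `k`,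
all of whose local rings are integrally closed. -/
structure IsNormalVariety {k : Type u} [Field k] (X : Scheme.{u})
    (s : X ⟶ Spec (CommRingCat.of k)) : Prop where
  isIntegral : IsIntegral X
  isSeparated : IsSeparated s
  locallyOfFiniteType : LocallyOfFiniteType s
  quasiCompact : QuasiCompact s
  normal : ∀ x : X, IsIntegrallyClosed (X.presheaf.stalk x)

/-- The prime divisors of `X`, given by their generic points: the points of codimension one. -/
abbrev PrimeDivisor (X : Scheme.{u}) : Type u := {x : X // Order.coheight x = 1}

/-- Weil `ℚ`-divisors on a Noetherian scheme. -/
abbrev QDivisor (X : Scheme.{u}) : Type u := PrimeDivisor X →₀ ℚ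

/-- The closed subscheme defined by the ideal sheaf `I` is an effective Cartier divisor:
locally, `I` is generated by one section that is not a zero divisor. -/
def IsEffectiveCartier {X : Scheme.{u}} (I : X.IdealSheafData) : Prop :=
  ∀ x : X, ∃ (U : X.affineOpens) (f : Γ(X, U.1)),
    x ∈ U.1 ∧ f ∈ nonZeroDivisors Γ(X, U.1) ∧ I.ideal U = Ideal.span {f}

/-- `D` is the Weil divisor of the effective Cartier divisor with ideal sheaf `I`: its coefficient
along a prime divisor is the order of vanishing of a local equation. -/
def IsWeilDivisorOf {X : Scheme.{u}} [IsIntegral X] [IsLocallyNoetherian X]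
    (I : X.IdealSheafData) (D : QDivisor X) : Prop :=
  ∀ (z : PrimeDivisor X) (U : X.affineOpens) (hz : z.1 ∈ U.1) (f : Γ(X, U.1)),
    I.ideal U = Ideal.span {f} →
      D z = (Scheme.ord (algebraMap (X.presheaf.stalk z.1) X.functionField
        (X.presheaf.germ U.1 z.1 hz f)) z.1 : ℚ)

/-! ### Rational differential forms of top degree and their orders of vanishing -/

/-- The structure homomorphism from `k` to the local ring at a point of a `k`-scheme. At the generic
point of an integral scheme this is the inclusion of `k` in the function field. -/
def stalkStructureHom {k : Type u} [Field k] {X : Scheme.{u}}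
    (s : X ⟶ Spec (CommRingCat.of k)) (x : X) : k →+* X.presheaf.stalk x :=
  (X.presheaf.germ ⊤ x trivial).hom.comp
    (s.appTop.hom.comp (Scheme.ΓSpecIso (CommRingCat.of k)).inv.hom)

/-- The rational differential form `da₁ ∧ ⋯ ∧ daₙ` in the `n`-th exterior power of the
`K`-vector space `Ω_{K/k}`. -/
def wedge (k : Type*) {K : Type*} [Field k] [Field K] [Algebra k K] {n : ℕ} (a : Fin n → K) :
    ⋀[K]^n (Ω[K⁄k]) :=
  exteriorPower.ιMulti K n fun i => KaehlerDifferential.D k K (a i)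

/-- The form `da₁ ∧ ⋯ ∧ daₙ` on a variety `X`, for rational functions `aᵢ`, is not zero. -/
def FormNeZero {k : Type u} [Field k] {X : Scheme.{u}} [IsIntegral X]
    (s : X ⟶ Spec (CommRingCat.of k)) {n : ℕ} (a : Fin n → X.functionField) : Prop :=
  letI : Algebra k X.functionField := (stalkStructureHom s (genericPoint X)).toAlgebra
  wedge k a ≠ 0

/-- `b₁, …, bₙ` are local coordinates at the point `x` of an `n`-dimensional `k`-variety: their
differentials generate `Ω_{X/k}` at `x`. (If `k` is perfect and `x` is a regular point, they exist
and their differentials are a basis, so that `db₁ ∧ ⋯ ∧ dbₙ` is a local generator of `ω_X`.) -/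
def IsLocalCoordinates {k : Type u} [Field k] {X : Scheme.{u}}
    (s : X ⟶ Spec (CommRingCat.of k)) (x : X) {n : ℕ} (b : Fin n → X.presheaf.stalk x) : Prop :=
  letI : Algebra k (X.presheaf.stalk x) := (stalkStructureHom s x).toAlgebra
  Submodule.span (X.presheaf.stalk x)
    (Set.range fun i => KaehlerDifferential.D k (X.presheaf.stalk x) (b i)) = ⊤

/-- The rational form `da₁ ∧ ⋯ ∧ daₙ` has order `c` along the prime divisor with generic point `x`:
it is `u · db₁ ∧ ⋯ ∧ dbₙ` with local coordinates `bᵢ` at `x` and a rational function `u ≠ 0` of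
order `c` along that divisor. -/
def HasFormOrder {k : Type u} [Field k] {X : Scheme.{u}} [IsIntegral X] [IsLocallyNoetherian X]
    (s : X ⟶ Spec (CommRingCat.of k)) {n : ℕ} (a : Fin n → X.functionField) (x : X) (c : ℤ) :
    Prop :=
  letI : Algebra k X.functionField := (stalkStructureHom s (genericPoint X)).toAlgebra
  ∃ (b : Fin n → X.presheaf.stalk x) (u : X.functionField), IsLocalCoordinates s x b ∧ u ≠ 0 ∧
    wedge k a = u • wedge k (fun i => algebraMap (X.presheaf.stalk x) X.functionField (b i)) ∧
    Scheme.ord u x = c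

/-! ### Log canonical pairs -/

/-- A dominant morphism of integral schemes maps the generic point to the generic point. -/
theorem map_genericPoint {Y X : Scheme.{u}} [IsIntegral Y] [IsIntegral X] (f : Y ⟶ X)
    [IsDominant f] : f (genericPoint Y) = genericPoint X := by
  have h := (genericPoint_spec Y).image f.continuous
  rw [Set.image_univ, f.denseRange.closure_range] at h
  exact h.eq (genericPoint_spec X)

/-- The pull-back of rational functions under a dominant morphism of integral schemes. -/
def pullbackRat {Y X : Scheme.{u}} [IsIntegral Y] [IsIntegral X] (f : Y ⟶ X) [IsDominant f] :
    X.functionField →+* Y.functionField :=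
  (f.stalkMap (genericPoint Y)).hom.comp
    (X.presheaf.stalkSpecializes (specializes_of_eq (map_genericPoint f))).hom

/-- With `K_X` the divisor of the rational form `da₁ ∧ ⋯ ∧ daₙ`: the divisor `m (K_X + B)`
is the divisor of the rational function `φ` on the open set `U`. -/
def IsLocalEquation {k : Type u} [Field k] {X : Scheme.{u}} [IsIntegral X] [IsLocallyNoetherian X]
    (s : X ⟶ Spec (CommRingCat.of k)) (B : QDivisor X) {n : ℕ} (a : Fin n → X.functionField)
    (m : ℕ) (U : X.Opens) (φ : X.functionField) : Prop :=
  φ ≠ 0 ∧ ∀ z : PrimeDivisor X, z.1 ∈ U →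
    ∃ c : ℤ, HasFormOrder s a z.1 c ∧ (Scheme.ord φ z.1 : ℚ) = m * (c + B z)

/-- The pair `(X, B)`, where `X` is an `n`-dimensional normal variety over a perfect field, is
log canonical: `K_X + B` is `ℚ`-Cartier, and every prime divisor `E` over `X` has discrepancy
`a(E, X, B) ≥ -1`. Here `K_X` is the divisor of a nonzero rational form `da₁ ∧ ⋯ ∧ daₙ`; a divisor
`E` over `X` is a prime divisor, with generic point `y`, on a normal variety `Y` with a birational
morphism `f : Y ⟶ X`; and if `m (K_X + B)` has the local equation `φ` near `f y`, then
`a(E, X, B)` is the coefficient `c - ord_E (f^* φ) / m` of `E` in `K_Y - f^* (K_X + B)`, where `c`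
is the order along `E` of the pulled back form. -/
def IsLogCanonical {k : Type u} [Field k] {X : Scheme.{u}} [IsIntegral X] [IsLocallyNoetherian X]
    (s : X ⟶ Spec (CommRingCat.of k)) (n : ℕ) (B : QDivisor X) : Prop :=
  ∃ (a : Fin n → X.functionField) (m : ℕ), FormNeZero s a ∧ 0 < m ∧
    ∀ x : X, ∃ (U : X.Opens) (φ : X.functionField), x ∈ U ∧ IsLocalEquation s B a m U φ ∧
      ∀ (Y : Scheme.{u}) [IsIntegral Y] [IsLocallyNoetherian Y] (f : Y ⟶ X) [IsDominant f],
        IsNormalVariety Y (f ≫ s) → IsBirationalMorphism f →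
        ∀ y : PrimeDivisor Y, f y.1 ∈ U →
        ∀ c : ℤ, HasFormOrder (f ≫ s) (fun i => pullbackRat f (a i)) y.1 c →
          (-1 : ℚ) ≤ c - (Scheme.ord (pullbackRat f φ) y.1 : ℚ) / m

end

end LCPairs

/-! A domain `Q` of characteristic `p` has a spectrum that is not weakly normal as soon as it has a
strictly larger finite birational extension `T` with `T ^ p ⊆ Q`: a point of `Spec T` in a field is
determined by the values of `p`-th powers, so `Spec T → Spec Q` is a universal homeomorphism
(`not_isWeaklyNormal_of_iso`). Log canonicity is tested without a resolution. On `X = Spec R` there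
is a rational top form `ω = (da₁ ∧ ⋯ ∧ da₄) / φ` with divisor `-(S + Δ)`, and along every discrete
valuation ring over `R` it is a regular multiple of a wedge of one-forms that are regular or
logarithmic. Such a wedge has at most a simple pole (`exists_smul_ιMulti_eq`), so every discrepancy
is at least `-1` (`exists_logCanonical_pair`).

For `p = 2`, `X` is affine space, `S` is the pinch point family `x² = t y²` and `Δ = 0`. The
normalization adjoins `s = x / y` with `s² = t`, which is purely inseparable. A log pole appears in
each of the cases `y ∣ x` and `x ∣ y` of a valuation (`Pinch.hasLogPoles`).

For `p = 2m + 1`, take the Legendre family over the affine curve `u ^ (2m) = H(l)`, with `H` the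
Hasse polynomial. The roots of `H` are simple, by its differential equation
(`eval_derivative_hasse_ne_zero`), so near a supersingular point the curve is smooth and `u` is a
parameter. Let `B` be the ring of `Y² = x (x - z²)(x - l z²)` over this curve, with weights 2, 1, 3
for `x, z, Y`, with invariant vector field `δ` and Euler field `ε`. The Hasse invariant gives `δ ^ p
= t ^ (p - 1) δ` with `t = u z` (`ellipticDer_iterate_char`). Extend `δ` and `ε` to `B[y]` by `δ y =
-t y` and `ε y = 0`; `R` is the ring of common constants, and `B[y]` is purely inseparable over it.
Take `S` as `u = 0` and `Δ` as `(1/p) div (y ^ p)`.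

Modulo `u` the eigenvalue `t` vanishes, so `y` becomes constant. It lies in the fraction field of `R
/ u` but does not lift to `R`, since a lift would yield an eigenvector congruent to `1` modulo `u`
(`IsEllipticCone.not_isWeaklyNormal`).

Let `h` be an eigenvector in `B` for the eigenvalue `t`, of weight zero modulo `p`, and put `F = h
y`. The form is `du ∧ dF ∧ d(x ^ p) ∧ d(z ^ p) / (u F Y ^ p)`. Up to logarithmic factors it is the
invariant differential of a Legendre curve with parameter `l ^ p`. Since `d(l ^ p) = 0` and `l`, `1
- l` are units, this differential is regular at all valuations (`hasLogPoles_of_sq_eq`). To compute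
its divisor, at each prime of height one another eigenvector `q` is chosen with `q ^ p` a unit there
(`IsEllipticCone.exists_eigenvector`). Then `f = q y` is a coordinate, and `f ^ p = q ^ p y ^ p`
explains the coefficient `1/p`. -/

namespace LCPairs

noncomputable section

/-! ### Regular functions, function fields and birational morphisms -/

section Evaluation

variable {R : Type u} [CommRing R]

/-- The value in the stalk at `z` of a regular function on the target of `g : Z ⟶ Spec R`. -/
def evalAt {Z : Scheme.{u}} (g : Z ⟶ Spec (CommRingCat.of R)) (z : Z) :
    R →+* Z.presheaf.stalk z :=
  (Z.presheaf.germ ⊤ z trivial).hom.comp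
    (g.appTop.hom.comp (Scheme.ΓSpecIso (CommRingCat.of R)).inv.hom)

/-- The structure morphism of the spectrum of a `k`-algebra. -/
abbrev specMap (k R : Type u) [CommRing R] [CommRing k] [Algebra k R] :
    Spec (CommRingCat.of R) ⟶ Spec (CommRingCat.of k) :=
  Spec.map (CommRingCat.ofHom (algebraMap k R))

theorem stalkStructureHom_comp_specMap {k : Type u} [Field k] [Algebra k R] {Z : Scheme.{u}}
    (g : Z ⟶ Spec (CommRingCat.of R)) (z : Z) :
    stalkStructureHom (g ≫ specMap k R) z = (evalAt g z).comp (algebraMap k R) := by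
  have h : (Scheme.ΓSpecIso (CommRingCat.of k)).inv ≫ (specMap k R).appTop =
      CommRingCat.ofHom (algebraMap k R) ≫ (Scheme.ΓSpecIso (CommRingCat.of R)).inv :=
    (Scheme.ΓSpecIso_inv_naturality _).symm
  ext x
  have hx := congrArg (fun t => t.hom x) h
  simp only [CommRingCat.hom_comp, RingHom.comp_apply, CommRingCat.hom_ofHom] at hx
  simp only [stalkStructureHom, evalAt, RingHom.comp_apply, Scheme.Hom.comp_appTop,
    CommRingCat.hom_comp]
  rw [hx]

theorem algebraMap_evalAt {Z : Scheme.{u}} [IsIntegral Z] (g : Z ⟶ Spec (CommRingCat.of R)) (z : Z)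
    (r : R) : algebraMap (Z.presheaf.stalk z) Z.functionField (evalAt g z r) =
      evalAt g (genericPoint Z) r := by
  have : Nonempty (⊤ : Z.Opens) := ⟨⟨z, trivial⟩⟩
  simp only [evalAt, RingHom.comp_apply]
  exact Scheme.algebraMap_germ_eq_germToFunctionField (X := Z) (U := ⊤) trivial _

theorem pullbackRat_evalAt [IsDomain R] {Z : Scheme.{u}} [IsIntegral Z]
    (g : Z ⟶ Spec (CommRingCat.of R)) [IsDominant g] (r : R) :
    pullbackRat g (evalAt (𝟙 _) (genericPoint _) r) = evalAt g (genericPoint Z) r := by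
  simp only [pullbackRat, evalAt, RingHom.comp_apply]
  have h1 := ConcreteCategory.congr_hom (Scheme.Hom.germ_stalkMap g ⊤ (genericPoint Z) trivial)
    ((Scheme.ΓSpecIso (CommRingCat.of R)).inv.hom r)
  have h2 := ConcreteCategory.congr_hom
    ((Spec (CommRingCat.of R)).presheaf.germ_stalkSpecializes (U := ⊤)
      (y := genericPoint _) trivial (specializes_of_eq (map_genericPoint g)))
    ((Scheme.ΓSpecIso (CommRingCat.of R)).inv.hom r)
  simp only [ConcreteCategory.comp_apply] at h1 h2
  erw [h2]
  exact h1

end Evaluation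

/-- The generic point lies in the open set over which `f` is an isomorphism, so the stalk map there
is invertible. -/
theorem pullbackRat_bijective {Y X : Scheme.{u}} [IsIntegral Y] [IsIntegral X] (f : Y ⟶ X)
    [IsDominant f] (hf : IsBirationalMorphism f) : Function.Bijective (pullbackRat f) := by
  refine ⟨(pullbackRat f).injective, ?_⟩
  obtain ⟨U, hU, hU', hiso⟩ := hf
  have hmem : genericPoint Y ∈ f ⁻¹ᵁ U := by
    obtain ⟨y, hy⟩ := hU'.nonempty
    exact ((genericPoint_spec Y).mem_open_set_iff (f ⁻¹ᵁ U).isOpen).mpr ⟨y, trivial, hy⟩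
  have : IsOpenImmersion (f ∣_ U) := inferInstance
  have h1 : IsIso ((f ∣_ U).stalkMap ⟨genericPoint Y, hmem⟩) :=
    IsOpenImmersion.instIsIsoCommRingCatStalkMap (f ∣_ U) _
  have h2 : IsIso (f.stalkMap (genericPoint Y)) := by
    have e := morphismRestrictStalkMap f U ⟨genericPoint Y, hmem⟩
    have := (MorphismProperty.arrow_mk_iso_iff (MorphismProperty.isomorphisms _) e).mp h1
    exact this
  have h3 : IsIso (X.presheaf.stalkSpecializes (specializes_of_eq (map_genericPoint f))) := by
    have e : X.presheaf.stalkSpecializes (specializes_of_eq (map_genericPoint f)) =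
      (X.presheaf.stalkCongr (.of_eq (map_genericPoint f).symm)).hom := rfl
    rw [e]; infer_instance
  intro b
  obtain ⟨b', hb'⟩ := (ConcreteCategory.bijective_of_isIso (f.stalkMap (genericPoint Y))).2 b
  obtain ⟨c, hc⟩ := (ConcreteCategory.bijective_of_isIso
    (X.presheaf.stalkSpecializes (specializes_of_eq (map_genericPoint f)))).2 b'
  exact ⟨c, by rw [← hb', ← hc]; rfl⟩

/-! ### Orders of vanishing -/

section Order
variable {X : Scheme.{u}} [IsIntegral X] [IsLocallyNoetherian X]

theorem isDiscreteValuationRing_stalk {x : X} (hx : Order.coheight x = 1)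
    [IsIntegrallyClosed (X.presheaf.stalk x)] :
    IsDiscreteValuationRing (X.presheaf.stalk x) := by
  have hd : ringKrullDim (X.presheaf.stalk x) = 1 := by
    rw [ringKrullDim_stalk_eq_coheight, hx]; rfl
  have h1 : Ring.KrullDimLE 1 (X.presheaf.stalk x) := krullDimLE_of_coheight_le hx.le
  have hf : ¬ IsField (X.presheaf.stalk x) := fun h => by
    let := h.toField
    rw [ringKrullDim_eq_zero_of_isField h] at hd
    exact absurd hd (by decide)
  have : Ring.DimensionLEOne (X.presheaf.stalk x) :=
    ⟨fun {p} hp hp' => Ring.krullDimLE_one_iff_of_isPrime_bot.mp h1 p hp hp'⟩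
  have : IsDedekindDomain (X.presheaf.stalk x) := { }
  exact ((IsDiscreteValuationRing.TFAE _ hf).out 0 2).mpr this

theorem ord_algebraMap_of_isUnit {x : X} {r : X.presheaf.stalk x} (hr : IsUnit r) :
    Scheme.ord (algebraMap _ X.functionField r) x = 0 := by
  by_cases hx : Order.coheight x = 1
  · have h1 : Ring.KrullDimLE 1 (X.presheaf.stalk x) := krullDimLE_of_coheight_le hx.le
    rw [Scheme.ord_eq_iff hx (by simpa using hr.ne_zero)]
    exact Ring.ordFrac_of_isUnit hr
  · exact Scheme.ord_eq_zero_of_coheight_neq_one hx _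

theorem ord_algebraMap_nonneg {x : X} {r : X.presheaf.stalk x} (hr : r ≠ 0) :
    0 ≤ Scheme.ord (algebraMap _ X.functionField r) x := by
  by_cases hx : Order.coheight x = 1
  · have h1 : Ring.KrullDimLE 1 (X.presheaf.stalk x) := krullDimLE_of_coheight_le hx.le
    rw [Scheme.le_ord_iff hx (by simpa using hr)]
    exact Ring.ordFrac_ge_one_of_ne_zero hr
  · exact (Scheme.ord_eq_zero_of_coheight_neq_one hx _).ge

theorem ord_algebraMap_irreducible {x : X} (hx : Order.coheight x = 1)
    [IsDiscreteValuationRing (X.presheaf.stalk x)] {r : X.presheaf.stalk x} (hr : Irreducible r) :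
    Scheme.ord (algebraMap _ X.functionField r) x = 1 := by
  have h1 : Ring.KrullDimLE 1 (X.presheaf.stalk x) := krullDimLE_of_coheight_le hx.le
  rw [Scheme.ord_eq_iff hx (by simpa using hr.ne_zero)]
  exact Ring.ordFrac_irreducible hr

theorem ord_one (x : X) : Scheme.ord (1 : X.functionField) x = 0 := by
  simpa using ord_algebraMap_of_isUnit (x := x) isUnit_one

theorem ord_pow (x : X) {f : X.functionField} (hf : f ≠ 0) (n : ℕ) :
    Scheme.ord (f ^ n) x = n * Scheme.ord f x := by
  induction n with
  | zero => simp [ord_one]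
  | succ n ih => rw [pow_succ, Scheme.ord_mul (pow_ne_zero _ hf) hf, ih]; push_cast; ring

end Order

/-! ### Local coordinates, logarithmic poles and discrepancies -/

/-- In a localization `O` of `R` at a prime, elements of `R` whose differentials generate the
differentials of `R` up to denominators outside the prime are local coordinates. -/
theorem span_D_eq_top_of_isLocalization {k R O : Type*} [Field k] [CommRing R] [CommRing O]
    [Algebra k R] [Algebra k O] [Algebra R O] [IsScalarTower k R O] (P : Ideal R) [P.IsPrime]
    [IsLocalization.AtPrime O P] {n : ℕ} (b : Fin n → R)
    (h : ∀ r : R, ∃ c ∉ P, c • KaehlerDifferential.D k R r ∈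
      Submodule.span R (Set.range fun i => KaehlerDifferential.D k R (b i))) :
    Submodule.span O (Set.range fun i => KaehlerDifferential.D k O (algebraMap R O (b i))) = ⊤ := by
  set N := Submodule.span O (Set.range fun i => KaehlerDifferential.D k O (algebraMap R O (b i)))
  have hu : ∀ c ∉ P, IsUnit (algebraMap R O c) := fun c hc =>
    (IsLocalization.AtPrime.isUnit_to_map_iff O P c).mpr hc
  have hcancel : ∀ c ∉ P, ∀ v : Ω[O⁄k], algebraMap R O c • v ∈ N → v ∈ N := fun c hc v hv => by
    obtain ⟨w, hw⟩ := hu c hc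
    have := N.smul_mem (↑w⁻¹ : O) hv
    rwa [← hw, smul_smul, Units.inv_mul, one_smul] at this
  have hmap : ∀ v ∈ Submodule.span R (Set.range fun i => KaehlerDifferential.D k R (b i)),
      KaehlerDifferential.map k k R O v ∈ N := by
    intro v hv
    induction hv using Submodule.span_induction with
    | mem v hv =>
      obtain ⟨i, rfl⟩ := hv
      rw [KaehlerDifferential.map_D]
      exact Submodule.subset_span ⟨i, rfl⟩
    | zero => simp
    | add v w _ _ hv hw => rw [map_add]; exact N.add_mem hv hw
    | smul r v _ hv => rw [map_smul, ← algebraMap_smul O]; exact N.smul_mem _ hv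
  have hR : ∀ r : R, KaehlerDifferential.D k O (algebraMap R O r) ∈ N := fun r => by
    obtain ⟨c, hc, hr⟩ := h r
    have := hmap _ hr
    rw [map_smul, KaehlerDifferential.map_D, ← algebraMap_smul O] at this
    exact hcancel c hc _ this
  rw [eq_top_iff, ← KaehlerDifferential.span_range_derivation, Submodule.span_le]
  rintro _ ⟨o, rfl⟩
  obtain ⟨⟨r, t⟩, hrt⟩ := IsLocalization.surj P.primeCompl o
  have hd := congrArg (KaehlerDifferential.D k O) hrt
  rw [Derivation.leibniz] at hd
  refine hcancel t.1 t.2 _ ?_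
  have : algebraMap R O t.1 • KaehlerDifferential.D k O o =
    KaehlerDifferential.D k O (algebraMap R O r) - o • KaehlerDifferential.D k O (algebraMap R O t.1) := by
    rw [← hd]; abel
  rw [this]
  exact N.sub_mem (hR _) (N.smul_mem _ (hR _))

/-- The form `da₁ ∧ ⋯ ∧ daₙ` is nonzero over the fraction field of `R`. -/
def IsNonzeroForm (k R : Type u) [Field k] [CommRing R] [Algebra k R] {n : ℕ}
    (a : Fin n → R) : Prop :=
  ∀ (L : Type u) [Field L] [Algebra k L] [Algebra R L] [IsScalarTower k R L] [IsFractionRing R L],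
    wedge k (fun i => algebraMap R L (a i)) ≠ 0

/-- The form `φ⁻¹ da₁ ∧ ⋯ ∧ daₙ` has at most a simple pole along every discrete valuation ring
over `R` which has local coordinates. -/
def HasLogPoles (k R : Type u) [Field k] [CommRing R] [Algebra k R] {n : ℕ}
    (a : Fin n → R) (φ : R) : Prop :=
  ∀ (O L : Type u) [CommRing O] [IsDomain O] [IsDiscreteValuationRing O] [Field L] [Algebra O L]
    [IsFractionRing O L] [Algebra k O] [Algebra k L] [IsScalarTower k O L] [Algebra R O]
    [Algebra R L] [IsScalarTower R O L] [IsScalarTower k R O] [IsScalarTower k R L]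
    [IsFractionRing R L] (b : Fin n → O),
    Submodule.span O (Set.range fun i => KaehlerDifferential.D k O (b i)) = ⊤ →
    ∀ ϖ : O, Irreducible ϖ → ∃ r : O,
      algebraMap O L ϖ • wedge k (fun i => algebraMap R L (a i)) =
        (algebraMap R L φ * algebraMap O L r) • wedge k (fun i => algebraMap O L (b i))

section
variable {k R : Type u} [Field k] [CommRing R] [Algebra k R]

theorem isFractionRing_evalAt_id [IsDomain R] :
    letI : Algebra R (Spec (CommRingCat.of R)).functionField :=
      (evalAt (𝟙 _) (genericPoint _)).toAlgebra
    IsFractionRing R (Spec (CommRingCat.of R)).functionField :=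
  functionField_isFractionRing_of_affine (CommRingCat.of R)

theorem isFractionRing_evalAt [IsDomain R] {Z : Scheme.{u}} [IsIntegral Z]
    (g : Z ⟶ Spec (CommRingCat.of R)) [IsDominant g] (hg : IsBirationalMorphism g) :
    letI := (evalAt g (genericPoint Z)).toAlgebra
    IsFractionRing R Z.functionField := by
  let _ := (evalAt g (genericPoint Z)).toAlgebra
  let _ : Algebra R (Spec (CommRingCat.of R)).functionField :=
    (evalAt (𝟙 _) (genericPoint _)).toAlgebra
  let e : (Spec (CommRingCat.of R)).functionField ≃+* Z.functionField :=
    RingEquiv.ofBijective _ (pullbackRat_bijective g hg)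
  let e' : (Spec (CommRingCat.of R)).functionField ≃ₐ[R] Z.functionField :=
    { e with commutes' := fun r => pullbackRat_evalAt g r }
  have h : IsFractionRing R (Spec (CommRingCat.of R)).functionField := isFractionRing_evalAt_id
  exact IsLocalization.isLocalization_of_algEquiv (M := nonZeroDivisors R) e'

theorem isScalarTower_evalAt {Z : Scheme.{u}} (g : Z ⟶ Spec (CommRingCat.of R)) (z : Z) :
    letI := (evalAt g z).toAlgebra
    letI := (stalkStructureHom (g ≫ specMap k R) z).toAlgebra
    IsScalarTower k R (Z.presheaf.stalk z) := by
  let _ := (evalAt g z).toAlgebra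
  let _ := (stalkStructureHom (g ≫ specMap k R) z).toAlgebra
  exact IsScalarTower.of_algebraMap_eq' (stalkStructureHom_comp_specMap g z)

theorem isScalarTower_functionField {Z : Scheme.{u}} [IsIntegral Z]
    (g : Z ⟶ Spec (CommRingCat.of R)) (z : Z) :
    letI := (stalkStructureHom (g ≫ specMap k R) z).toAlgebra
    letI : Algebra k Z.functionField :=
      (stalkStructureHom (g ≫ specMap k R) (genericPoint Z)).toAlgebra
    IsScalarTower k (Z.presheaf.stalk z) Z.functionField := by
  let _ := (stalkStructureHom (g ≫ specMap k R) z).toAlgebra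
  let _ : Algebra k Z.functionField :=
      (stalkStructureHom (g ≫ specMap k R) (genericPoint Z)).toAlgebra
  refine IsScalarTower.of_algebraMap_eq fun x => ?_
  change stalkStructureHom (g ≫ specMap k R) (genericPoint Z) x =
    algebraMap _ _ (stalkStructureHom (g ≫ specMap k R) z x)
  rw [stalkStructureHom_comp_specMap, stalkStructureHom_comp_specMap, RingHom.comp_apply,
    RingHom.comp_apply, algebraMap_evalAt]

/-- If the form is `u db₁ ∧ ⋯ ∧ dbₙ` at `z`, the pole condition becomes `ϖ u = φ r` with `r`
regular. Taking orders gives `1 + c = ord φ + ord r ≥ ord φ`. -/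
theorem discrepancy_ge_of_hasLogPoles [IsDomain R] {n : ℕ} {a : Fin n → R} {φ : R} (hφ : φ ≠ 0)
    (ha : IsNonzeroForm k R a) (hlog : HasLogPoles k R a φ) {Z : Scheme.{u}} [IsIntegral Z]
    [IsLocallyNoetherian Z] (g : Z ⟶ Spec (CommRingCat.of R)) [IsDominant g]
    (hg : IsBirationalMorphism g) (z : Z) (hz : Order.coheight z = 1)
    [IsIntegrallyClosed (Z.presheaf.stalk z)] (c : ℤ)
    (hc : HasFormOrder (g ≫ specMap k R) (fun i => evalAt g (genericPoint Z) (a i)) z c) :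
    -1 ≤ c - Scheme.ord (evalAt g (genericPoint Z) φ) z := by
  let algk : Algebra k Z.functionField :=
    (stalkStructureHom (g ≫ specMap k R) (genericPoint Z)).toAlgebra
  let algk' : Algebra k (Z.presheaf.stalk z) :=
    (stalkStructureHom (g ≫ specMap k R) z).toAlgebra
  let algR : Algebra R Z.functionField := (evalAt g (genericPoint Z)).toAlgebra
  let algR' : Algebra R (Z.presheaf.stalk z) := (evalAt g z).toAlgebra
  have := isDiscreteValuationRing_stalk hz
  have : IsFractionRing R Z.functionField := isFractionRing_evalAt g hg
  have : IsScalarTower k R Z.functionField := isScalarTower_evalAt g _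
  have : IsScalarTower k R (Z.presheaf.stalk z) := isScalarTower_evalAt g _
  have : IsScalarTower k (Z.presheaf.stalk z) Z.functionField := isScalarTower_functionField g z
  have : IsScalarTower R (Z.presheaf.stalk z) Z.functionField :=
    IsScalarTower.of_algebraMap_eq fun x => (algebraMap_evalAt g z x).symm
  obtain ⟨b, u, hb, hu, hw, hc⟩ := hc
  obtain ⟨ϖ, hϖ⟩ := IsDiscreteValuationRing.exists_irreducible (Z.presheaf.stalk z)
  obtain ⟨r, hr⟩ := hlog (Z.presheaf.stalk z) Z.functionField b hb ϖ hϖ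
  have hne : wedge k (fun i => algebraMap R Z.functionField (a i)) ≠ 0 := ha _
  have hw' : wedge k (fun i => algebraMap R Z.functionField (a i)) =
    u • wedge k (fun i => algebraMap (Z.presheaf.stalk z) Z.functionField (b i)) := hw
  have hb0 : wedge k (fun i => algebraMap (Z.presheaf.stalk z) Z.functionField (b i)) ≠ 0 := by
    intro h0
    rw [h0, smul_zero] at hw'
    exact hne hw'
  rw [hw', smul_smul] at hr
  have heq := smul_left_injective _ hb0 hr
  have hϖ0 : algebraMap (Z.presheaf.stalk z) Z.functionField ϖ ≠ 0 := by simpa using hϖ.ne_zero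
  have hφ0 : algebraMap R Z.functionField φ ≠ 0 := by simpa using hφ
  have hr0 : algebraMap (Z.presheaf.stalk z) Z.functionField r ≠ 0 := by
    intro h0
    simp only [h0, mul_zero] at heq
    exact mul_ne_zero hϖ0 hu heq
  have hord := congrArg (fun t => Scheme.ord t z) heq
  simp only [Scheme.ord_mul hϖ0 hu, Scheme.ord_mul hφ0 hr0, ord_algebraMap_irreducible hz hϖ] at hord
  have h0 := ord_algebraMap_nonneg (x := z) (r := r) (by simpa using hr0)
  change -1 ≤ c - Scheme.ord (algebraMap R Z.functionField φ) z
  omega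

end

/-! ### Divisors and closed subschemes of affine schemes -/

section
variable {R : Type u} [CommRing R]

/-- The rational function on `Spec R` given by an element of `R`. -/
abbrev ratFun [IsDomain R] (r : R) : (Spec (CommRingCat.of R)).functionField :=
  evalAt (𝟙 (Spec (CommRingCat.of R))) (genericPoint _) r

theorem isLocalization_evalAt_id (z : Spec (CommRingCat.of R)) :
    letI := (evalAt (𝟙 (Spec (CommRingCat.of R))) z).toAlgebra
    have : z.asIdeal.IsPrime := z.isPrime
    IsLocalization.AtPrime ((Spec (CommRingCat.of R)).presheaf.stalk z) z.asIdeal :=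
  StructureSheaf.IsLocalization.to_stalk (CommRingCat.of R) z

theorem isUnit_evalAt_id (z : Spec (CommRingCat.of R)) {r : R} (hr : r ∉ z.asIdeal) : IsUnit (evalAt (𝟙 (Spec (CommRingCat.of R))) z r) := by
  let _ := (evalAt (𝟙 (Spec (CommRingCat.of R))) z).toAlgebra
  have : z.asIdeal.IsPrime := z.isPrime
  have := isLocalization_evalAt_id z
  exact (IsLocalization.AtPrime.isUnit_to_map_iff _ z.asIdeal r).mpr hr

theorem ratFun_ne_zero [IsDomain R] {r : R} (hr : r ≠ 0) : ratFun r ≠ 0 := by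
  let _ : Algebra R (Spec (CommRingCat.of R)).functionField :=
    (evalAt (𝟙 _) (genericPoint _)).toAlgebra
  have := isFractionRing_evalAt_id (R := R)
  exact (map_ne_zero_iff _ (IsFractionRing.injective R (Spec (CommRingCat.of R)).functionField)).mpr hr

theorem coheight_eq_one_iff (z : Spec (CommRingCat.of R)) : Order.coheight z = 1 ↔ z.asIdeal.height = 1 := by
  rw [idealHeight_eq_coheight (CommRingCat.of R) z]

/-- The ideal sheaf of the closed subscheme `r = 0` of `Spec R`. -/
def idealSheaf (r : R) : (Spec (CommRingCat.of R)).IdealSheafData :=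
  Scheme.Hom.ker (Spec.map (CommRingCat.ofHom (Ideal.Quotient.mk (Ideal.span {r}))))

theorem idealSheaf_ideal (r : R) (U : (Spec (CommRingCat.of R)).affineOpens) :
    (idealSheaf r).ideal U = Ideal.span
      {((Spec (CommRingCat.of R)).presheaf.map (homOfLE (le_top (a := U.1))).op).hom
        ((Scheme.ΓSpecIso (CommRingCat.of R)).inv.hom r)} := by
  have hker : RingHom.ker (Spec.map (CommRingCat.ofHom
      (Ideal.Quotient.mk (Ideal.span {r})))).appTop.hom =
      Ideal.span {(Scheme.ΓSpecIso (CommRingCat.of R)).inv.hom r} := by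
    ext x
    obtain ⟨x, rfl⟩ := (ConcreteCategory.bijective_of_isIso
      (Scheme.ΓSpecIso (CommRingCat.of R)).inv).2 x
    have h := ConcreteCategory.congr_hom (Scheme.ΓSpecIso_inv_naturality (CommRingCat.ofHom
      (Ideal.Quotient.mk (Ideal.span {r})))) x
    simp only [ConcreteCategory.comp_apply] at h
    rw [RingHom.mem_ker]
    change (Spec.map (CommRingCat.ofHom (Ideal.Quotient.mk (Ideal.span {r})))).appTop
      ((Scheme.ΓSpecIso (CommRingCat.of R)).inv x) = 0 ↔ _
    rw [← h, map_eq_zero_iff _ (ConcreteCategory.bijective_of_isIso _).1]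
    change Ideal.Quotient.mk (Ideal.span {r}) x = 0 ↔ _
    rw [Ideal.Quotient.eq_zero_iff_mem, Ideal.mem_span_singleton, Ideal.mem_span_singleton]
    refine ⟨fun ⟨y, hy⟩ => ⟨(Scheme.ΓSpecIso (CommRingCat.of R)).inv.hom y, ?_⟩, fun ⟨y, hy⟩ => ?_⟩
    · rw [← map_mul, ← hy]
    · obtain ⟨y, rfl⟩ := (ConcreteCategory.bijective_of_isIso
        (Scheme.ΓSpecIso (CommRingCat.of R)).inv).2 y
      refine ⟨y, (ConcreteCategory.bijective_of_isIso
        (Scheme.ΓSpecIso (CommRingCat.of R)).inv).1 ?_⟩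
      exact hy.trans (map_mul (Scheme.ΓSpecIso (CommRingCat.of R)).inv.hom r y).symm
  rw [idealSheaf, Scheme.ker_of_isAffine, Scheme.IdealSheafData.ofIdealTop_ideal, hker,
    Ideal.map_span, Set.image_singleton]

/-- The closed subscheme `r = 0` of `Spec R` is the spectrum of `R / (r)`. -/
def idealSheafIso (r : R) :
    (idealSheaf r).subscheme ≅ Spec (CommRingCat.of (R ⧸ Ideal.span {r})) :=
  have : IsClosedImmersion (Spec.map (CommRingCat.ofHom (Ideal.Quotient.mk (Ideal.span {r})))) :=
    IsClosedImmersion.spec_of_surjective _ Ideal.Quotient.mk_surjective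
  (asIso (Scheme.Hom.toImage
    (Spec.map (CommRingCat.ofHom (Ideal.Quotient.mk (Ideal.span {r})))))).symm

variable [IsDomain R] [IsLocallyNoetherian (Spec (CommRingCat.of R))]

theorem ord_ratFun_of_notMem (z : Spec (CommRingCat.of R)) {r : R} (hr : r ∉ z.asIdeal) :
    Scheme.ord (ratFun r) z = 0 := by
  rw [ratFun, ← algebraMap_evalAt (𝟙 (Spec (CommRingCat.of R))) z r]
  exact ord_algebraMap_of_isUnit (isUnit_evalAt_id z hr)

theorem ord_ratFun_nonneg (z : Spec (CommRingCat.of R)) {r : R} (hr : r ≠ 0) : 0 ≤ Scheme.ord (ratFun r) z := by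
  rw [ratFun, ← algebraMap_evalAt (𝟙 (Spec (CommRingCat.of R))) z r]
  refine ord_algebraMap_nonneg fun h => ratFun_ne_zero hr ?_
  rw [ratFun, ← algebraMap_evalAt (𝟙 (Spec (CommRingCat.of R))) z r, h, map_zero]

/-- A prime of height one that contains `r` is minimal over `(r)`, and a Noetherian ring has
finitely many of those. -/
theorem finite_setOf_ord_ne_zero {r : R} (hr : r ≠ 0) :
    {z : PrimeDivisor (Spec (CommRingCat.of R)) | Scheme.ord (ratFun r) z.1 ≠ 0}.Finite := by
  have : IsNoetherianRing R := (isLocallyNoetherian_Spec (R := CommRingCat.of R)).mp inferInstance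
  refine Set.Finite.of_finite_image (f := fun z => z.1.asIdeal)
    ((Ideal.finite_minimalPrimes_of_isNoetherianRing R (Ideal.span {r})).subset ?_) ?_
  · rintro _ ⟨z, hz, rfl⟩
    have hmem : r ∈ z.1.asIdeal := by
      by_contra h
      exact hz (ord_ratFun_of_notMem z.1 h)
    have : z.1.asIdeal.IsPrime := z.1.isPrime
    refine Ideal.mem_minimalPrimes_of_height_le (J := z.1.asIdeal) ((Ideal.span_singleton_le_iff_mem _).mpr hmem) ?_
    rw [(coheight_eq_one_iff z.1).mp z.2]
    exact Ideal.one_le_height_span_singleton_of_mem_nonZeroDivisors (mem_nonZeroDivisors_of_ne_zero hr)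
  · intro z _ z' _ h
    exact Subtype.ext (PrimeSpectrum.ext h)

/-- The Weil divisor of a regular function on `Spec R`. -/
def divisor (r : R) (hr : r ≠ 0) : QDivisor (Spec (CommRingCat.of R)) :=
  Finsupp.onFinset (finite_setOf_ord_ne_zero hr).toFinset
    (fun z => (Scheme.ord (ratFun r) z.1 : ℚ)) (fun z hz => by simpa using hz)

theorem divisor_apply (r : R) (hr : r ≠ 0) (z : PrimeDivisor (Spec (CommRingCat.of R))) :
    divisor r hr z = (Scheme.ord (ratFun r) z.1 : ℚ) := rfl

end

/-! ### Purely inseparable extensions and weak normality -/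

/-- Two maps from `B` to a field that agree on `Q` agree on `p`-th powers, and Frobenius is
injective on the field. -/
theorem universallyInjective_specMap_of_pow_mem {Q B : Type u} [CommRing Q] [CommRing B] (p : ℕ)
    [Fact p.Prime] (hp : (p : B) = 0) (τ : Q →+* B) (hτ : ∀ b : B, b ^ p ∈ τ.range) :
    UniversallyInjective (Spec.map (CommRingCat.ofHom τ)) := by
  refine ((tfae_universallyInjective (Spec.map (CommRingCat.ofHom τ))).out 0 1).mpr ?_
  intro K _ g₁ g₂ h
  obtain ⟨σ₁, rfl⟩ := Spec.map_surjective g₁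
  obtain ⟨σ₂, rfl⟩ := Spec.map_surjective g₂
  have h' : CommRingCat.ofHom τ ≫ σ₁ = CommRingCat.ofHom τ ≫ σ₂ := by
    apply Spec.map_injective
    rw [Spec.map_comp, Spec.map_comp]
    exact h
  congr 1
  ext b
  obtain ⟨q, hq⟩ := hτ b
  have h2 : σ₁.hom (τ q) = σ₂.hom (τ q) := ConcreteCategory.congr_hom h' q
  have : CharP K p := by
    refine (CharP.charP_iff_prime_eq_zero (Fact.out : p.Prime)).mpr ?_
    have := congrArg σ₁.hom hp
    simpa using this
  rw [hq, map_pow, map_pow] at h2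
  exact frobenius_inj K p h2

/-- The three properties survive base change, and a finite morphism is closed. -/
theorem isUniversalHomeomorphism_of_finite {Y X : Scheme.{u}} (f : Y ⟶ X) [IsFinite f]
    [UniversallyInjective f] [Surjective f] : IsUniversalHomeomorphism f := by
  intro X' Y' i₁ i₂ f' h
  have h1 : IsFinite f' := MorphismProperty.of_isPullback h.flip inferInstance
  have h2 : UniversallyInjective f' := MorphismProperty.of_isPullback h.flip inferInstance
  have h3 : Surjective f' := MorphismProperty.of_isPullback h.flip inferInstance
  exact isHomeomorph_iff_continuous_isClosedMap_bijective.mpr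
    ⟨f'.continuous, f'.isClosedMap, f'.injective, f'.surjective⟩

theorem IsBirationalMorphism.comp_iso {T S S' : Scheme.{u}} {g : T ⟶ S'}
    (hg : IsBirationalMorphism g) (e : S' ≅ S) : IsBirationalMorphism (g ≫ e.hom) := by
  obtain ⟨U, hU, hU', hiso⟩ := hg
  obtain ⟨V, rfl⟩ : ∃ V : S.Opens, e.hom ⁻¹ᵁ V = U :=
    ⟨e.inv ⁻¹ᵁ U, by rw [← Scheme.Hom.comp_preimage]; simp⟩
  refine ⟨V, ?_, hU', ?_⟩
  · have h : Dense (e.hom '' ((e.hom ⁻¹ᵁ V : S'.Opens) : Set S')) :=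
      e.hom.surjective.denseRange.dense_image e.hom.continuous hU
    refine h.mono ?_
    rintro _ ⟨x, hx, rfl⟩
    exact hx
  · have h1 : IsIso (g ∣_ e.hom ⁻¹ᵁ V) := hiso
    have h2 : IsIso (e.hom ∣_ V) := inferInstance
    rw [morphismRestrict_comp]
    exact @IsIso.comp_isIso _ _ _ _ _ _ _ h1 h2

/-- The element `c` plays the role of a conductor: after inverting it, `τ` becomes an isomorphism.
-/
theorem isBirationalMorphism_specMap {Q B : Type u} [CommRing Q] [CommRing B] [IsDomain B]
    (τ : Q →+* B) (hinj : Function.Injective τ) (c : Q) (hc : c ≠ 0)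
    (hcb : ∀ b : B, ∃ n : ℕ, τ c ^ n * b ∈ τ.range) :
    IsBirationalMorphism (Spec.map (CommRingCat.ofHom τ)) := by
  have hdense : ∀ {P : Type u} [CommRing P] [IsDomain P] (r : P), r ≠ 0 →
      Dense ((PrimeSpectrum.basicOpen r : TopologicalSpace.Opens (PrimeSpectrum P)) :
        Set (PrimeSpectrum P)) := by
    intro P _ _ r hr
    exact (PrimeSpectrum.basicOpen r).isOpen.dense
      ⟨⟨⊥, Ideal.isPrime_bot⟩, by simpa [PrimeSpectrum.mem_basicOpen] using hr⟩
  have hQ : IsDomain Q := hinj.isDomain τ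
  refine ⟨PrimeSpectrum.basicOpen c, hdense c hc, ?_, ?_⟩
  · exact hdense (τ c) (by simpa using (map_ne_zero_iff τ hinj).mpr hc)
  · have h := (SpecMapRestrictBasicOpenIso (CommRingCat.ofHom τ) c)
    have h2 : IsIso (Spec.map (CommRingCat.ofHom (Localization.awayMap τ c))) := by
      rw [isIso_SpecMap_iff]
      refine ⟨Localization.awayMap_injective_iff.mpr fun a ha => ⟨0, ?_⟩,
        Localization.awayMap_surjective_iff.mpr fun a => ?_⟩
      · have : a = 0 := hinj (by rw [ha, map_zero])
        simp [this]
      · obtain ⟨n, b, hb⟩ := hcb a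
        exact ⟨b, n, by rw [hb]⟩
    exact ((MorphismProperty.isomorphisms Scheme).arrow_mk_iso_iff h).mpr h2

/-- The spectrum of a domain `Q` is not weakly normal if `Q` has a strictly larger finite
extension in its field of fractions which contains `p`-th roots only. -/
theorem not_isWeaklyNormal_of_iso {Q B : Type u} [CommRing Q] [CommRing B] [IsDomain B] (p : ℕ)
    [Fact p.Prime] (hp : (p : B) = 0) (τ : Q →+* B) (hfin : τ.Finite) (hinj : Function.Injective τ)
    (hsurj : ¬ Function.Surjective τ) (hτ : ∀ b : B, b ^ p ∈ τ.range) (c : Q) (hc : c ≠ 0)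
    (hcb : ∀ b : B, ∃ n : ℕ, τ c ^ n * b ∈ τ.range)
    {S : Scheme.{u}} (e : S ≅ Spec (CommRingCat.of Q)) : ¬ IsWeaklyNormal S := by
  rintro ⟨-, hS⟩
  set g := Spec.map (CommRingCat.ofHom τ) with hg
  have hfinite : IsFinite g := (IsFinite.SpecMap_iff _).mpr hfin
  have hui : UniversallyInjective g := universallyInjective_specMap_of_pow_mem p hp τ hτ
  have hs : Surjective g := ⟨(hfin.to_isIntegral).comap_surjective hinj⟩
  have hbir : IsBirationalMorphism g := isBirationalMorphism_specMap τ hinj c hc hcb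
  have h1 : IsFinite (g ≫ e.inv) := inferInstance
  have h2 : UniversallyInjective (g ≫ e.inv) := MorphismProperty.comp_mem _ _ _ hui inferInstance
  have h3 : Surjective (g ≫ e.inv) := ⟨e.inv.surjective.comp hs.surj⟩
  have h := hS (Spec (CommRingCat.of B)) (g ≫ e.inv) inferInstance h1
    (hbir.comp_iso e.symm) (isUniversalHomeomorphism_of_finite _)
  have : IsIso g := by
    have : g = (g ≫ e.inv) ≫ e.hom := by simp
    rw [this]; exact IsIso.comp_isIso
  rw [hg, isIso_SpecMap_iff] at this
  exact hsurj this.2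

/-! ### From algebra to a log canonical pair -/

section
variable {k R : Type u} [Field k] [CommRing R] [IsDomain R] [Algebra k R]

theorem isNormalVariety_specMap [Algebra.FiniteType k R] [IsIntegrallyClosed R] :
    IsNormalVariety (Spec (CommRingCat.of R)) (specMap k R) where
  isIntegral := inferInstance
  isSeparated := inferInstance
  locallyOfFiniteType := by
    refine (HasRingHomProperty.Spec_iff (P := @LocallyOfFiniteType)).mpr ?_
    exact (RingHom.finiteType_algebraMap (A := k) (B := R)).mpr inferInstance
  quasiCompact := inferInstance
  normal z := by
    let _ := (evalAt (𝟙 (Spec (CommRingCat.of R))) z).toAlgebra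
    have : z.asIdeal.IsPrime := z.isPrime
    have := isLocalization_evalAt_id z
    exact isIntegrallyClosed_of_isLocalization _ z.asIdeal.primeCompl
      (Ideal.primeCompl_le_nonZeroDivisors _)

/-- The section `r` of the structure sheaf of `Spec R` over an open set. -/
abbrev sec (r : R) (U : (Spec (CommRingCat.of R)).Opens) : Γ(Spec (CommRingCat.of R), U) :=
  ((Spec (CommRingCat.of R)).presheaf.map (homOfLE (le_top (a := U))).op).hom
    ((Scheme.ΓSpecIso (CommRingCat.of R)).inv.hom r)

theorem germ_sec (r : R) (U : (Spec (CommRingCat.of R)).Opens) (z : Spec (CommRingCat.of R))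
    (hz : z ∈ U) :
    (Spec (CommRingCat.of R)).presheaf.germ U z hz (sec r U) = evalAt (𝟙 _) z r := by
  simp only [sec, evalAt, RingHom.comp_apply]
  rw [TopCat.Presheaf.germ_res_apply']
  simp

theorem isEffectiveCartier_idealSheaf {r : R} (hr : r ≠ 0) : IsEffectiveCartier (idealSheaf r) := by
  intro x
  refine ⟨⟨⊤, isAffineOpen_top _⟩, sec r ⊤, trivial, ?_, idealSheaf_ideal r _⟩
  refine mem_nonZeroDivisors_of_ne_zero fun h => ratFun_ne_zero hr ?_
  rw [ratFun, ← germ_sec r ⊤ _ trivial, h]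
  exact map_zero _

theorem isWeilDivisorOf_idealSheaf [IsLocallyNoetherian (Spec (CommRingCat.of R))] {r : R}
    (hr : r ≠ 0) : IsWeilDivisorOf (idealSheaf r) (divisor r hr) := by
  intro z U hz f hf
  have : Nonempty U.1 := ⟨⟨z.1, hz⟩⟩
  have : IsDomain Γ(Spec (CommRingCat.of R), U.1) := inferInstance
  rw [idealSheaf_ideal, Ideal.span_singleton_eq_span_singleton] at hf
  obtain ⟨w, hw⟩ := hf
  rw [divisor_apply, ← hw, ratFun, ← algebraMap_evalAt (𝟙 (Spec (CommRingCat.of R))) z.1 r,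
    ← germ_sec r U.1 z.1 hz]
  have h1 : algebraMap ((Spec (CommRingCat.of R)).presheaf.stalk z.1)
      (Spec (CommRingCat.of R)).functionField
      ((Spec (CommRingCat.of R)).presheaf.germ U.1 z.1 hz (sec r U.1)) ≠ 0 := by
    rw [germ_sec, algebraMap_evalAt]
    exact ratFun_ne_zero hr
  have h2 : IsUnit ((Spec (CommRingCat.of R)).presheaf.germ U.1 z.1 hz w.1) :=
    w.isUnit.map ((Spec (CommRingCat.of R)).presheaf.germ U.1 z.1 hz).hom
  have h3 := ord_algebraMap_of_isUnit h2
  have h4 : algebraMap ((Spec (CommRingCat.of R)).presheaf.stalk z.1)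
      (Spec (CommRingCat.of R)).functionField
      ((Spec (CommRingCat.of R)).presheaf.germ U.1 z.1 hz w.1) ≠ 0 :=
    (h2.map (algebraMap _ _)).ne_zero
  congr 1
  rw [map_mul, map_mul, Scheme.ord_mul h1 h4, h3, add_zero]

theorem ratFun_mul (r r' : R) : ratFun (r * r') = ratFun r * ratFun r' := map_mul _ _ _

theorem ratFun_pow (r : R) (n : ℕ) : ratFun (r ^ n) = ratFun r ^ n := map_pow _ _ _

/-- Coordinates at a height one prime: the form `db₁ ∧ ⋯ ∧ dbₙ` generates the dualizing module at
`P`, and `da₁ ∧ ⋯ ∧ daₙ = (g / g') db₁ ∧ ⋯ ∧ dbₙ`, where `g s η^(1/m) / (g' φ)` is a unit at `P`. -/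
def HasCoordinatesAt (k : Type u) [Field k] [Algebra k R] {n : ℕ} (a : Fin n → R) (φ s η : R)
    (m : ℕ) (P : Ideal R) : Prop :=
  ∃ (b : Fin n → R) (g g' : R), g ≠ 0 ∧ g' ≠ 0 ∧
    (∀ r : R, ∃ c ∉ P, c • KaehlerDifferential.D k R r ∈
      Submodule.span R (Set.range fun i => KaehlerDifferential.D k R (b i))) ∧
    (∀ (L : Type u) [Field L] [Algebra k L] [Algebra R L] [IsScalarTower k R L]
      [IsFractionRing R L], algebraMap R L g' • wedge k (fun i => algebraMap R L (a i)) =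
        algebraMap R L g • wedge k (fun i => algebraMap R L (b i))) ∧
    ∃ v ∉ P, ∃ w ∉ P, v * (φ * g') ^ m = w * (g * s) ^ m * η

/-- The order of the form at `P` is `c = ord g - ord g'`. Taking orders in the last relation of
`HasCoordinatesAt` yields `m ord φ = m (c + ord s) + ord η`. -/
theorem isLocalEquation_top [IsLocallyNoetherian (Spec (CommRingCat.of R))] {n : ℕ}
    {a : Fin n → R} {φ s η : R} (hφ : φ ≠ 0) (hs : s ≠ 0) (hη : η ≠ 0) {m : ℕ} (hm : 0 < m)
    (hX : ∀ P : Ideal R, P.IsPrime → P.height = 1 → HasCoordinatesAt k a φ s η m P) :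
    IsLocalEquation (specMap k R) (divisor s hs + (1 / m : ℚ) • divisor η hη)
      (fun i => ratFun (a i)) 1 ⊤ (ratFun φ) := by
  refine ⟨ratFun_ne_zero hφ, fun z _ => ?_⟩
  obtain ⟨b, g, g', hg, hg', hb, hw, v, hv, w, hw', e⟩ :=
    hX z.1.asIdeal z.1.isPrime ((coheight_eq_one_iff z.1).mp z.2)
  have hid : 𝟙 (Spec (CommRingCat.of R)) ≫ specMap k R = specMap k R := Category.id_comp _
  refine ⟨Scheme.ord (ratFun g) z.1 - Scheme.ord (ratFun g') z.1,
    ⟨fun i => evalAt (𝟙 _) z.1 (b i), ratFun g / ratFun g', ?_, ?_, ?_, ?_⟩, ?_⟩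
  · let _ := (evalAt (𝟙 (Spec (CommRingCat.of R))) z.1).toAlgebra
    let _ : Algebra k ((Spec (CommRingCat.of R)).presheaf.stalk z.1) :=
      (stalkStructureHom (specMap k R) z.1).toAlgebra
    have : z.1.asIdeal.IsPrime := z.1.isPrime
    have := isLocalization_evalAt_id z.1
    have h := isScalarTower_evalAt (k := k) (𝟙 (Spec (CommRingCat.of R))) z.1
    rw [hid] at h
    exact span_D_eq_top_of_isLocalization z.1.asIdeal b hb
  · exact div_ne_zero (ratFun_ne_zero hg) (ratFun_ne_zero hg')
  · let _ : Algebra R (Spec (CommRingCat.of R)).functionField :=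
      (evalAt (𝟙 _) (genericPoint _)).toAlgebra
    let _ : Algebra k (Spec (CommRingCat.of R)).functionField :=
      (stalkStructureHom (specMap k R) (genericPoint _)).toAlgebra
    have h := isScalarTower_evalAt (k := k) (𝟙 (Spec (CommRingCat.of R))) (genericPoint _)
    rw [hid] at h
    have := isFractionRing_evalAt_id (R := R)
    have h1 := hw (Spec (CommRingCat.of R)).functionField
    have h2 : algebraMap R (Spec (CommRingCat.of R)).functionField g' ≠ 0 := ratFun_ne_zero hg'
    have h3 : (fun i => algebraMap ((Spec (CommRingCat.of R)).presheaf.stalk z.1)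
        (Spec (CommRingCat.of R)).functionField (evalAt (𝟙 _) z.1 (b i))) =
        fun i => ratFun (b i) :=
      funext fun i => algebraMap_evalAt (𝟙 (Spec (CommRingCat.of R))) z.1 (b i)
    rw [h3, div_eq_inv_mul, mul_smul]
    exact (eq_inv_smul_iff₀ h2).mpr h1
  · have h1 : ratFun g = (ratFun g / ratFun g') * ratFun g' :=
      (div_mul_cancel₀ _ (ratFun_ne_zero hg')).symm
    have h2 := congrArg (fun t => Scheme.ord t z.1) h1
    rw [Scheme.ord_mul (div_ne_zero (ratFun_ne_zero hg) (ratFun_ne_zero hg'))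
      (ratFun_ne_zero hg')] at h2
    omega
  · have hv0 : v ≠ 0 := fun h => hv (h ▸ z.1.asIdeal.zero_mem)
    have hw0 : w ≠ 0 := fun h => hw' (h ▸ z.1.asIdeal.zero_mem)
    have h1 : Scheme.ord (ratFun (v * (φ * g') ^ m)) z.1 =
        Scheme.ord (ratFun (w * (g * s) ^ m * η)) z.1 := by rw [e]
    rw [ratFun_mul, ratFun_pow, ratFun_mul, ratFun_mul, ratFun_mul, ratFun_pow, ratFun_mul] at h1
    have nφ := ratFun_ne_zero hφ
    have ns := ratFun_ne_zero hs
    have nη := ratFun_ne_zero hη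
    have ng := ratFun_ne_zero hg
    have ng' := ratFun_ne_zero hg'
    have nv := ratFun_ne_zero hv0
    have nw := ratFun_ne_zero hw0
    rw [Scheme.ord_mul nv (pow_ne_zero _ (mul_ne_zero nφ ng')), ord_pow _ (mul_ne_zero nφ ng'),
      Scheme.ord_mul nφ ng', Scheme.ord_mul (mul_ne_zero nw (pow_ne_zero _ (mul_ne_zero ng ns))) nη,
      Scheme.ord_mul nw (pow_ne_zero _ (mul_ne_zero ng ns)), ord_pow _ (mul_ne_zero ng ns),
      Scheme.ord_mul ng ns, ord_ratFun_of_notMem z.1 hv, ord_ratFun_of_notMem z.1 hw'] at h1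
    have hm' : (m : ℚ) ≠ 0 := by positivity
    have h2 := congrArg (fun t : ℤ => (t : ℚ)) h1
    push_cast at h2
    rw [Finsupp.add_apply, Finsupp.smul_apply, divisor_apply, divisor_apply, smul_eq_mul]
    push_cast
    field_simp
    linarith

/-- This turns the geometric statement into ring theory: both characteristics only have to supply
`R`, the form, the equation `s` of `S`, and `η` with `Δ = (1/m) div η`. -/
theorem exists_logCanonical_pair [Algebra.FiniteType k R] [IsIntegrallyClosed R] {n : ℕ}
    (hdim : ringKrullDim R = n) (a : Fin n → R) (φ s η : R) (hφ : φ ≠ 0) (hs : s ≠ 0) (hη : η ≠ 0)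
    {m : ℕ} (hm : 0 < m) (hN : IsNonzeroForm k R a) (hlog : HasLogPoles k R a φ)
    (hX : ∀ P : Ideal R, P.IsPrime → P.height = 1 → HasCoordinatesAt k a φ s η m P)
    (hred : IsReduced (R ⧸ Ideal.span {s}))
    (hW : ∀ S : Scheme.{u}, (S ≅ Spec (CommRingCat.of (R ⧸ Ideal.span {s}))) →
      ¬ IsWeaklyNormal S) :
    ∃ (X : Scheme.{u}) (σ : X ⟶ Spec (CommRingCat.of k))
      (_ : IsIntegral X) (_ : IsLocallyNoetherian X),
      IsNormalVariety X σ ∧ topologicalKrullDim X = n ∧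
      ∃ (S : X.IdealSheafData) (D Δ : QDivisor X),
        IsEffectiveCartier S ∧ IsWeilDivisorOf S D ∧ 0 ≤ Δ ∧ IsLogCanonical σ n (D + Δ) ∧
        IsReduced S.subscheme ∧ ¬ IsWeaklyNormal S.subscheme := by
  have hnoeth : IsNoetherianRing R := Algebra.FiniteType.isNoetherianRing k R
  have hln : IsLocallyNoetherian (Spec (CommRingCat.of R)) :=
    isLocallyNoetherian_Spec.mpr hnoeth
  have hid : 𝟙 (Spec (CommRingCat.of R)) ≫ specMap k R = specMap k R := Category.id_comp _
  refine ⟨Spec (CommRingCat.of R), specMap k R, inferInstance, hln, isNormalVariety_specMap, ?_,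
    idealSheaf s, divisor s hs, (1 / m : ℚ) • divisor η hη, isEffectiveCartier_idealSheaf hs,
    isWeilDivisorOf_idealSheaf hs, ?_, ?_, ?_, hW _ (idealSheafIso s)⟩
  · rw [← hdim]
    exact PrimeSpectrum.topologicalKrullDim_eq_ringKrullDim R
  · intro z
    rw [Finsupp.smul_apply, divisor_apply, smul_eq_mul]
    have := ord_ratFun_nonneg z.1 hη
    have : (0 : ℚ) ≤ (Scheme.ord (ratFun η) z.1 : ℚ) := by exact_mod_cast this
    exact mul_nonneg (by positivity) this
  -- The index is `1`, although `Δ` has denominator `m`: the log canonical divisor is that of `φ` on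
  -- all of `X`, so a single chart suffices.
  · refine ⟨fun i => ratFun (a i), 1, ?_, one_pos, fun x => ⟨⊤, ratFun φ, trivial,
      isLocalEquation_top hφ hs hη hm hX, ?_⟩⟩
    · let _ : Algebra R (Spec (CommRingCat.of R)).functionField :=
        (evalAt (𝟙 _) (genericPoint _)).toAlgebra
      let _ : Algebra k (Spec (CommRingCat.of R)).functionField :=
        (stalkStructureHom (specMap k R) (genericPoint _)).toAlgebra
      have h := isScalarTower_evalAt (k := k) (𝟙 (Spec (CommRingCat.of R))) (genericPoint _)
      rw [hid] at h
      have := isFractionRing_evalAt_id (R := R)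
      exact hN (Spec (CommRingCat.of R)).functionField
    · intro Y _ _ f _ hY hf y _ c hc
      simp only [pullbackRat_evalAt] at hc ⊢
      have := hY.normal y.1
      have h := discrepancy_ge_of_hasLogPoles hφ hN hlog f hf y.1 y.2 c hc
      have h' : ((-1 : ℤ) : ℚ) ≤ ((c - Scheme.ord (evalAt f (genericPoint Y) φ) y.1 : ℤ) : ℚ) :=
        Int.cast_le.mpr h
      push_cast at h' ⊢
      simpa using h'
  · have : IsReduced (Spec (CommRingCat.of (R ⧸ Ideal.span {s}))) := inferInstance
    exact isReduced_of_isOpenImmersion (idealSheafIso s).hom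

end

/-! ### Wedge products of logarithmic forms -/

section
variable {K M : Type*} [Field K] [AddCommGroup M] [Module K M] {n : ℕ}

/-- As functions of the rows of `A` both sides are alternating, so it suffices to compare them on
permutations of the standard basis. -/
theorem ιMulti_eq_det_smul (β v : Fin n → M) (A : Matrix (Fin n) (Fin n) K)
    (hv : ∀ i, v i = ∑ j, A i j • β j) :
    exteriorPower.ιMulti K n v = A.det • exteriorPower.ιMulti K n β := by
  let f : (Fin n → K) →ₗ[K] M := Fintype.linearCombination K β
  have h : (exteriorPower.ιMulti K n (M := M)).compLinearMap f =
      (LinearMap.toSpanSingleton K _ (exteriorPower.ιMulti K n β)).compAlternatingMap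
        Matrix.detRowAlternating := by
    refine (Pi.basisFun K (Fin n)).ext_alternating fun w hw => ?_
    obtain ⟨σ, rfl⟩ : ∃ σ : Equiv.Perm (Fin n), w = σ :=
      ⟨Equiv.ofBijective w (Finite.injective_iff_bijective.mp hw), rfl⟩
    simp only [AlternatingMap.compLinearMap_apply, LinearMap.compAlternatingMap_apply,
      Pi.basisFun_apply, LinearMap.toSpanSingleton_apply]
    have h1 : (fun i => f (Pi.single (σ i) 1)) = fun i => β (σ i) := by
      funext i
      simp [f, Fintype.linearCombination_apply, Pi.single_apply]
    have h2 : (Matrix.detRowAlternating fun i => (Pi.single (σ i) 1 : Fin n → K)) =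
        Equiv.Perm.sign σ := by
      have := Matrix.detRowAlternating.map_perm (fun i => (Pi.single i 1 : Fin n → K)) σ
      have h3 : (Matrix.detRowAlternating fun i => (Pi.single i 1 : Fin n → K)) = 1 := by
        have : (fun i => (Pi.single i 1 : Fin n → K)) = (1 : Matrix (Fin n) (Fin n) K) := by
          ext i j; simp [Matrix.one_apply, Pi.single_apply, eq_comm]
        rw [this]; exact Matrix.det_one
      rw [h3] at this
      simpa [Function.comp_def, Units.smul_def] using this
    rw [h1, h2]
    have := (exteriorPower.ιMulti K n (M := M)).map_perm β σ
    rw [show (fun i => β (σ i)) = β ∘ σ from rfl, this, Units.smul_def, ← Int.cast_smul_eq_zsmul K]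
  have h1 := congrArg (fun g => g A) h
  have h2 : v = fun i => f (A i) := by
    funext i
    rw [hv]
    simp [f, Fintype.linearCombination_apply]
  rw [h2]
  exact h1

end

section
variable (k : Type*) {O L : Type*} [Field k] [CommRing O] [Field L] [Algebra O L] [Algebra k O]
  [Algebra k L] [IsScalarTower k O L]

variable (L) in
/-- The differential forms on a discrete valuation ring `O` with a logarithmic pole in the
uniformizer `ϖ`. -/
def logForms (ϖ : O) : Submodule O (Ω[L⁄k]) :=
  Submodule.span O (Set.range fun x : O => KaehlerDifferential.D k L (algebraMap O L x)) ⊔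
    Submodule.span O {(algebraMap O L ϖ)⁻¹ • KaehlerDifferential.D k L (algebraMap O L ϖ)}

theorem D_mem_logForms (ϖ x : O) :
    KaehlerDifferential.D k L (algebraMap O L x) ∈ logForms k L ϖ :=
  Submodule.mem_sup_left (Submodule.subset_span ⟨x, rfl⟩)

/-- The logarithmic differential of `z`. -/
def dlog (z : L) : Ω[L⁄k] := z⁻¹ • KaehlerDifferential.D k L z

theorem dlog_mul {z w : L} (hz : z ≠ 0) (hw : w ≠ 0) :
    dlog k (z * w) = dlog k z + dlog k w := by
  simp only [dlog, Derivation.leibniz, smul_add, smul_smul]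
  rw [add_comm]
  congr 2 <;> field_simp

theorem dlog_one : dlog k (1 : L) = 0 := by simp [dlog]

theorem dlog_inv {z : L} (hz : z ≠ 0) : dlog k z⁻¹ = - dlog k z := by
  have := dlog_mul k hz (inv_ne_zero hz)
  rw [mul_inv_cancel₀ hz, dlog_one] at this
  exact eq_neg_of_add_eq_zero_right this.symm

theorem dlog_pow {z : L} (hz : z ≠ 0) (n : ℕ) : dlog k (z ^ n) = (n : L) • dlog k z := by
  induction n with
  | zero => simp [dlog_one]
  | succ n ih => rw [pow_succ, dlog_mul k (pow_ne_zero _ hz) hz, ih]; push_cast; module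

theorem smul_dlog {z : L} (hz : z ≠ 0) : z • dlog k z = KaehlerDifferential.D k L z := by
  rw [dlog, smul_smul, mul_inv_cancel₀ hz, one_smul]

/-- Write a nonzero element of `O` as a unit times `ϖ ^ n`: the unit has a regular logarithmic
derivative, and the power contributes `n` times that of `ϖ`. -/
theorem dlog_mem_logForms [IsDomain O] [IsDiscreteValuationRing O] [IsFractionRing O L] {ϖ : O}
    (hϖ : Irreducible ϖ) {z : L} (hz : z ≠ 0) : dlog k z ∈ logForms k L ϖ := by
  have hinj := IsFractionRing.injective O L
  have key : ∀ x : O, x ≠ 0 → dlog k (algebraMap O L x) ∈ logForms k L ϖ := by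
    intro x hx
    obtain ⟨n, w, rfl⟩ := IsDiscreteValuationRing.eq_unit_mul_pow_irreducible hx hϖ
    have hϖ0 : algebraMap O L ϖ ≠ 0 := (map_ne_zero_iff _ hinj).mpr hϖ.ne_zero
    have hw0 : algebraMap O L w ≠ 0 := (map_ne_zero_iff _ hinj).mpr w.ne_zero
    rw [map_mul, map_pow, dlog_mul k hw0 (pow_ne_zero _ hϖ0), dlog_pow k hϖ0]
    refine add_mem ?_ ?_
    · have : dlog k (algebraMap O L w) = (↑w⁻¹ : O) • KaehlerDifferential.D k L (algebraMap O L w) := by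
        rw [dlog, ← algebraMap_smul L (↑w⁻¹ : O)]
        congr 1
        exact inv_eq_of_mul_eq_one_right (by rw [← map_mul, Units.mul_inv, map_one])
      rw [this]
      exact Submodule.smul_mem _ _ (D_mem_logForms k ϖ _)
    · have : ((n : L) • dlog k (algebraMap O L ϖ)) = (n : O) • dlog k (algebraMap O L ϖ) := by
        rw [← algebraMap_smul L (n : O), map_natCast]
      rw [this]
      exact Submodule.smul_mem _ _
        (Submodule.mem_sup_right (Submodule.mem_span_singleton_self _))
  obtain ⟨x, y, hy, rfl⟩ := IsFractionRing.div_surjective (A := O) z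
  have hy0 : y ≠ 0 := nonZeroDivisors.ne_zero hy
  have hx0 : x ≠ 0 := by rintro rfl; simp at hz
  have hx' : algebraMap O L x ≠ 0 := (map_ne_zero_iff _ hinj).mpr hx0
  have hy' : algebraMap O L y ≠ 0 := (map_ne_zero_iff _ hinj).mpr hy0
  rw [div_eq_mul_inv, dlog_mul k hx' (inv_ne_zero hy'), dlog_inv k hy', ← sub_eq_add_neg]
  exact sub_mem (key x hx0) (key y hy0)

/-- Each factor is a regular form plus a multiple of the same form `ϖ⁻¹ dϖ`, whose square is zero.
Hence only one factor `ϖ⁻¹` survives in the product. -/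
theorem exists_smul_ιMulti_eq [IsDomain O] [IsFractionRing O L] {n : ℕ} (b : Fin n → O)
    (hb : Submodule.span O (Set.range fun i => KaehlerDifferential.D k O (b i)) = ⊤) {ϖ : O}
    (hϖ : ϖ ≠ 0) (v : Fin n → Ω[L⁄k]) (hv : ∀ i, v i ∈ logForms k L ϖ) :
    ∃ r : O, algebraMap O L ϖ • exteriorPower.ιMulti L n v =
      algebraMap O L r • wedge k (fun i => algebraMap O L (b i)) := by
  have hϖ0 : algebraMap O L ϖ ≠ 0 := (map_ne_zero_iff _ (IsFractionRing.injective O L)).mpr hϖ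
  have hspan : ∀ w ∈ Submodule.span O
      (Set.range fun x : O => KaehlerDifferential.D k L (algebraMap O L x)),
      ∃ c : Fin n → O, w = ∑ j, algebraMap O L (c j) •
        KaehlerDifferential.D k L (algebraMap O L (b j)) := by
    intro w hw
    have h1 : w ∈ Submodule.span O
        (Set.range fun j => KaehlerDifferential.D k L (algebraMap O L (b j))) := by
      refine Submodule.span_le.mpr ?_ hw
      rintro _ ⟨x, rfl⟩
      have hx : KaehlerDifferential.D k O x ∈ Submodule.span O
          (Set.range fun i => KaehlerDifferential.D k O (b i)) := hb ▸ trivial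
      have := Submodule.mem_map_of_mem (f := KaehlerDifferential.map k k O L) hx
      rw [Submodule.map_span, ← Set.range_comp] at this
      simpa [Function.comp_def, KaehlerDifferential.map_D] using this
    obtain ⟨c, hc⟩ := (Submodule.mem_span_range_iff_exists_fun O).mp h1
    exact ⟨c, by rw [← hc]; simp only [algebraMap_smul]⟩
  have hv' : ∀ i, ∃ (c : Fin n → O) (s : O), v i = (∑ j, algebraMap O L (c j) •
      KaehlerDifferential.D k L (algebraMap O L (b j))) +
      (algebraMap O L s * (algebraMap O L ϖ)⁻¹) •
        KaehlerDifferential.D k L (algebraMap O L ϖ) := by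
    intro i
    obtain ⟨w, hw, w', hw', h⟩ := Submodule.mem_sup.mp (hv i)
    obtain ⟨c, hc⟩ := hspan w hw
    obtain ⟨s, rfl⟩ := Submodule.mem_span_singleton.mp hw'
    exact ⟨c, s, by rw [← h, hc, mul_smul, algebraMap_smul]⟩
  choose m s hms using hv'
  obtain ⟨c, hc⟩ := hspan (KaehlerDifferential.D k L (algebraMap O L ϖ))
    (Submodule.subset_span ⟨ϖ, rfl⟩)
  -- The coefficient matrix `W` is a rank one perturbation of `m`, namely the Schur complement of
  -- the corner `ϖ` in this bordered matrix. So `ϖ det W` is a determinant with entries in `O`.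
  let A : Matrix Unit Unit O := Matrix.of fun _ _ => ϖ
  let B : Matrix Unit (Fin n) O := Matrix.of fun _ j => - c j
  let C : Matrix (Fin n) Unit O := Matrix.of fun i _ => s i
  let W : Matrix (Fin n) (Fin n) L := Matrix.of fun i j =>
    algebraMap O L (m i j) + algebraMap O L (s i) * (algebraMap O L ϖ)⁻¹ * algebraMap O L (c j)
  refine ⟨(Matrix.fromBlocks A B C (Matrix.of m)).det, ?_⟩
  have h1 : ∀ i, v i = ∑ j, W i j • KaehlerDifferential.D k L (algebraMap O L (b j)) := by
    intro i
    simp only [W, Matrix.of_apply, add_smul, Finset.sum_add_distrib]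
    rw [hms i, hc, Finset.smul_sum]
    simp only [mul_smul]
  rw [ιMulti_eq_det_smul _ v W h1, smul_smul, wedge]
  congr 1
  have hdet : IsUnit (A.map (algebraMap O L)).det := by simpa [A] using hϖ0
  let inv := (A.map (algebraMap O L)).invertibleOfIsUnitDet hdet
  rw [RingHom.map_det, RingHom.mapMatrix_apply, Matrix.fromBlocks_map, Matrix.det_fromBlocks₁₁]
  congr 1
  · simp [A]
  · congr 1
    ext i j
    have : ⅟(A.map (algebraMap O L)) = Matrix.of fun _ _ => (algebraMap O L ϖ)⁻¹ := by
      rw [invOf_eq_right_inv]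
      ext i j
      simp [A, Matrix.mul_apply, hϖ0]
    rw [this]
    simp [W, B, C, Matrix.mul_apply]

end

/-! ### Nonvanishing of top forms -/

theorem ιMulti_ne_zero_of_linearIndependent {K M : Type*} [Field K] [AddCommGroup M] [Module K M]
    {n : ℕ} {v : Fin n → M} (hv : LinearIndependent K v)
    (hs : Submodule.span K (Set.range v) = ⊤) : exteriorPower.ιMulti K n v ≠ 0 := by
  intro h
  let e := Module.Basis.mk hv hs.ge
  have h1 := exteriorPower.alternatingMapLinearEquiv_apply_ιMulti e.det v
  rw [h, map_zero] at h1
  have h2 : e.det v = 1 := by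
    have := e.det_self
    rwa [Module.Basis.coe_mk] at this
  rw [h2] at h1
  exact zero_ne_one h1

/-- A finitely generated field extension whose differentials are spanned by the differentials of
`s` has transcendence degree at most `#s`. -/
theorem trdeg_le_of_span_D_eq_top {k L : Type u} [Field k] [Field L] [Algebra k L]
    [Algebra.EssFiniteType k L] (s : Set L)
    (hs : Submodule.span L ((KaehlerDifferential.D k L) '' s) = ⊤) :
    Algebra.trdeg k L ≤ Cardinal.mk s := by
  let F := IntermediateField.adjoin k s
  have h1 : Subsingleton (Ω[L⁄F]) := by
    have hsurj : Function.Surjective (KaehlerDifferential.map k F L L) :=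
      KaehlerDifferential.map_surjective k F L
    have hz : ∀ ω : Ω[L⁄k], KaehlerDifferential.map k F L L ω = 0 := by
      intro ω
      have hω : ω ∈ Submodule.span L ((KaehlerDifferential.D k L) '' s) := hs ▸ trivial
      induction hω using Submodule.span_induction with
      | mem x hx =>
        obtain ⟨y, hy, rfl⟩ := hx
        rw [KaehlerDifferential.map_D]
        exact (KaehlerDifferential.D F L).map_algebraMap ⟨y, IntermediateField.subset_adjoin k s hy⟩
      | zero => exact map_zero _
      | add x y _ _ hx hy => rw [map_add, hx, hy, add_zero]
      | smul c x _ hx => rw [map_smul, hx, smul_zero]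
    refine ⟨fun x y => ?_⟩
    obtain ⟨x, rfl⟩ := hsurj x
    obtain ⟨y, rfl⟩ := hsurj y
    rw [hz, hz]
  -- A field extension essentially of finite type without differentials is separable algebraic, so
  -- `s` contains a transcendence basis.
  have h2 : Algebra.FormallyUnramified F L := ⟨h1⟩
  have h3 : Algebra.EssFiniteType F L := Algebra.EssFiniteType.of_comp k F L
  have h4 : Algebra.IsSeparable F L := Algebra.FormallyUnramified.isSeparable F L
  have h5 : Algebra.IsAlgebraic F L := inferInstance
  open scoped IntermediateField.algebraAdjoinAdjoin in
  have h6 : IsFractionRing (Algebra.adjoin k s) F := inferInstance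
  open scoped IntermediateField.algebraAdjoinAdjoin in
  have h7 : IsScalarTower (Algebra.adjoin k s) F L := inferInstance
  have h8 : Algebra.IsAlgebraic (Algebra.adjoin k s) L :=
    (IsFractionRing.comap_isAlgebraic_iff (A := Algebra.adjoin k s) (K := F) (C := L)).mpr h5
  exact Algebra.IsAlgebraic.trdeg_le_cardinalMk k s

/-- If one of the differentials depended on the others, `n - 1` of them would span and the
transcendence degree would be at most `n - 1`. -/
theorem wedge_ne_zero {k L : Type u} [Field k] [Field L] [Algebra k L]
    [Algebra.EssFiniteType k L] {n : ℕ} (htr : n ≤ Algebra.trdeg k L) (a : Fin n → L)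
    (ha : Submodule.span L (Set.range fun i => KaehlerDifferential.D k L (a i)) = ⊤) :
    wedge k a ≠ 0 := by
  refine ιMulti_ne_zero_of_linearIndependent ?_ ha
  rw [linearIndependent_iff_notMem_span]
  intro i hi
  have h := trdeg_le_of_span_D_eq_top (k := k) (a '' (Set.univ \ {i})) (by
    rw [Set.image_image, eq_top_iff, ← ha, Submodule.span_le]
    rintro _ ⟨j, rfl⟩
    by_cases hj : j = i
    · subst hj; exact hi
    · exact Submodule.subset_span ⟨j, ⟨trivial, hj⟩, rfl⟩)
  have h2 : Cardinal.mk (a '' (Set.univ \ {i})) ≤ (n - 1 : ℕ) := by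
    have h3 := Cardinal.mk_image_le_lift (f := a) (s := Set.univ \ {i})
    have h4 : Cardinal.mk ((Set.univ \ {i} : Set (Fin n))) = (n - 1 : ℕ) := by
      rw [Cardinal.mk_fintype, ← Set.toFinset_card]
      simp [Finset.card_sdiff]
    rw [h4] at h3
    simpa using h3
  have h3 : ((n : ℕ) : Cardinal.{u}) ≤ (n - 1 : ℕ) := htr.trans (h.trans h2)
  rw [Nat.cast_le] at h3
  have := i.2
  omega

/-- Functions on `R` whose differentials generate `Ω_R` generically define a nonzero form. -/
theorem isNonzeroForm_of_span {k R : Type u} [Field k] [CommRing R] [IsDomain R] [Algebra k R]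
    [Algebra.FiniteType k R] {n : ℕ} (htr : n ≤ Algebra.trdeg k R) (a : Fin n → R)
    (h : ∀ r : R, ∃ c : R, c ≠ 0 ∧ c • KaehlerDifferential.D k R r ∈
      Submodule.span R (Set.range fun i => KaehlerDifferential.D k R (a i))) :
    IsNonzeroForm k R a := by
  intro L _ _ _ _ _
  have : Algebra.EssFiniteType R L := Algebra.EssFiniteType.of_isLocalization L (nonZeroDivisors R)
  have : Algebra.EssFiniteType k L := Algebra.EssFiniteType.comp k R L
  refine wedge_ne_zero (htr.trans ?_) _ ?_
  · exact trdeg_le_of_injective (IsScalarTower.toAlgHom k R L)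
      (IsFractionRing.injective R L)
  · have : IsLocalization.AtPrime L (⊥ : Ideal R) := by
      have h1 : (⊥ : Ideal R).primeCompl = nonZeroDivisors R := by
        ext x
        simp [Ideal.primeCompl]
      show IsLocalization (⊥ : Ideal R).primeCompl L
      rw [h1]; infer_instance
    exact span_D_eq_top_of_isLocalization (⊥ : Ideal R) a (by simpa using h)

/-- A form on `R` has logarithmic poles along a discrete valuation ring if it is a multiple of
a product of logarithmic one-forms. -/
theorem exists_smul_wedge_eq_of_det {k O L : Type*} [Field k] [CommRing O] [Field L] [Algebra O L]
    [Algebra k O] [Algebra k L] [IsScalarTower k O L] [IsDomain O] [IsFractionRing O L] {n : ℕ}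
    (b : Fin n → O)
    (hb : Submodule.span O (Set.range fun i => KaehlerDifferential.D k O (b i)) = ⊤) {ϖ : O}
    (hϖ : ϖ ≠ 0) (v : Fin n → Ω[L⁄k]) (hv : ∀ i, v i ∈ logForms k L ϖ) (a : Fin n → L)
    (M : Matrix (Fin n) (Fin n) L)
    (hM : ∀ i, KaehlerDifferential.D k L (a i) = ∑ j, M i j • v j) (φ : L) (c : O)
    (hφ : M.det = φ * algebraMap O L c) :
    ∃ r : O, algebraMap O L ϖ • wedge k a =
        (φ * algebraMap O L r) • wedge k (fun i => algebraMap O L (b i)) := by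
  obtain ⟨r, hr⟩ := exists_smul_ιMulti_eq k b hb hϖ v hv
  refine ⟨c * r, ?_⟩
  rw [wedge, ιMulti_eq_det_smul v _ M hM, smul_comm, hr, smul_smul, hφ, map_mul, mul_assoc]

theorem span_D_polynomial {k A : Type*} [Field k] [CommRing A] [Algebra k A] (s : Set A)
    (hs : ∀ a : A, KaehlerDifferential.D k A a ∈
      Submodule.span A ((KaehlerDifferential.D k A) '' s)) (f : Polynomial A) :
    KaehlerDifferential.D k (Polynomial A) f ∈ Submodule.span (Polynomial A)
      ((KaehlerDifferential.D k (Polynomial A)) '' (insert Polynomial.X (Polynomial.C '' s))) := by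
  set N := Submodule.span (Polynomial A)
      ((KaehlerDifferential.D k (Polynomial A)) '' (insert Polynomial.X (Polynomial.C '' s)))
  have hX : KaehlerDifferential.D k (Polynomial A) Polynomial.X ∈ N :=
    Submodule.subset_span ⟨_, Set.mem_insert _ _, rfl⟩
  have hC : ∀ a : A, KaehlerDifferential.D k (Polynomial A) (Polynomial.C a) ∈ N := by
    intro a
    have h := Submodule.mem_map_of_mem (f := KaehlerDifferential.map k k A (Polynomial A)) (hs a)
    rw [KaehlerDifferential.map_D, Submodule.map_span] at h
    have h2 : Submodule.span A (KaehlerDifferential.map k k A (Polynomial A) ''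
        (KaehlerDifferential.D k A '' s)) ≤ N.restrictScalars A := by
      rw [Submodule.span_le]
      rintro _ ⟨_, ⟨x, hx, rfl⟩, rfl⟩
      rw [KaehlerDifferential.map_D]
      exact Submodule.subset_span ⟨_, Set.mem_insert_of_mem _ ⟨x, hx, rfl⟩, rfl⟩
    exact h2 h
  induction f using Polynomial.induction_on' with
  | add p q hp hq => rw [map_add]; exact add_mem hp hq
  | monomial n a =>
    rw [← Polynomial.C_mul_X_pow_eq_monomial, Derivation.leibniz, Derivation.leibniz_pow]
    exact add_mem (N.smul_mem _ (nsmul_mem (N.smul_mem _ hX) n)) (N.smul_mem _ (hC a))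

/-! ### Inseparable extensions of a quotient ring -/

/-- A finite type algebra whose `p`-th powers come from the subring `Q` is finite over `Q`. -/
theorem finite_of_pow_mem {k Q B : Type*} [CommRing k] [CommRing Q] [CommRing B] [Algebra k Q]
    [Algebra k B] [Algebra.FiniteType k B] {p : ℕ} (hp : p ≠ 0) (τ : Q →ₐ[k] B)
    (hτ : ∀ b : B, b ^ p ∈ τ.toRingHom.range) : τ.toRingHom.Finite := by
  refine RingHom.IsIntegral.to_finite ?_ ?_
  · intro b
    obtain ⟨q, hq⟩ := hτ b
    refine ⟨Polynomial.X ^ p - Polynomial.C q, Polynomial.monic_X_pow_sub_C q hp, ?_⟩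
    rw [Polynomial.eval₂_sub, Polynomial.eval₂_pow, Polynomial.eval₂_X, Polynomial.eval₂_C, hq, sub_self]
  · refine RingHom.FiniteType.of_comp_finiteType (f := algebraMap k Q) ?_
    rw [AlgHom.toRingHom_eq_coe, AlgHom.comp_algebraMap]
    exact RingHom.finiteType_algebraMap.mpr inferInstance

/-- If `τ : R → B` has kernel generated by `s`, the spectrum of `R / s` is not weakly normal as soon
as `B` is a strictly larger extension in its field of fractions which contains `p`-th roots only. -/
theorem not_isWeaklyNormal_quotient {k R B : Type u} [CommRing k] [CommRing R] [CommRing B]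
    [Algebra k R] [Algebra k B] [Algebra.FiniteType k B] [IsDomain B] (p : ℕ) [Fact p.Prime]
    (hp : (p : B) = 0) (τ : R →ₐ[k] B) (s : R) (hs : RingHom.ker τ.toRingHom = Ideal.span {s})
    (hsurj : ¬ Function.Surjective τ) (hτ : ∀ b : B, ∃ r, τ r = b ^ p) (c : R) (hc : τ c ≠ 0)
    (hcb : ∀ b : B, ∃ n : ℕ, ∃ r, τ r = τ c ^ n * b)
    {S : Scheme.{u}} (e : S ≅ Spec (CommRingCat.of (R ⧸ Ideal.span {s}))) : ¬ IsWeaklyNormal S := by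
  let Q := R ⧸ Ideal.span {s}
  let τ' : Q →ₐ[k] B := Ideal.Quotient.liftₐ _ τ fun a ha => by
      have : a ∈ RingHom.ker τ.toRingHom := by rwa [hs]
      exact this
  have hτ' : ∀ r, τ' (Ideal.Quotient.mk _ r) = τ r := fun r => rfl
  have hpow : ∀ b : B, b ^ p ∈ τ'.toRingHom.range := fun b => by
    obtain ⟨r, hr⟩ := hτ b
    exact ⟨Ideal.Quotient.mk _ r, hr⟩
  refine not_isWeaklyNormal_of_iso p hp τ'.toRingHom
    (finite_of_pow_mem (Fact.out : p.Prime).ne_zero τ' hpow) ?_ ?_ hpow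
    (Ideal.Quotient.mk _ c) ?_ ?_ e
  · refine (injective_iff_map_eq_zero _).mpr fun a ha => ?_
    obtain ⟨f, rfl⟩ := Ideal.Quotient.mk_surjective a
    rw [Ideal.Quotient.eq_zero_iff_mem, ← hs]
    exact ha
  · intro h
    refine hsurj fun b => ?_
    obtain ⟨a, ha⟩ := h b
    obtain ⟨f, rfl⟩ := Ideal.Quotient.mk_surjective a
    exact ⟨f, ha⟩
  · intro h
    apply hc
    rw [← hτ', h, map_zero]
  · intro b
    obtain ⟨n, r, hr⟩ := hcb b
    exact ⟨n, Ideal.Quotient.mk _ r, hr⟩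

theorem isReduced_quotient_of_ker {R B : Type*} [CommRing R] [CommRing B] [IsDomain B]
    (τ : R →+* B) (s : R) (hs : RingHom.ker τ = Ideal.span {s}) :
    IsReduced (R ⧸ Ideal.span {s}) := by
  rw [← hs]
  have : (RingHom.ker τ).IsPrime := RingHom.ker_isPrime _
  infer_instance

theorem trdeg_polynomial (k A : Type u) [Field k] [CommRing A] [IsDomain A] [Algebra k A] :
    Algebra.trdeg k (Polynomial A) = Algebra.trdeg k A + 1 := by
  rw [← trdeg_add_eq k A (A := Polynomial A), Polynomial.trdeg_of_isDomain]

/-! ### Characteristic two: the pinch point -/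

namespace Pinch
open Polynomial

section
variable {P : Type u} [CommRing P] [IsDomain P]

/-- The parametrization `x ↦ u y`, `t ↦ u²` of the pinch point `x² = t y²`. -/
def param (y : P) : P[X][X] →+* P[X] :=
  Polynomial.eval₂RingHom (Polynomial.expand P 2).toRingHom (X * C y)

/-- The equation of the pinch point. -/
def pinch (y : P) : P[X][X] := X ^ 2 - C (X * C (y ^ 2))

theorem monic_pinch (y : P) : (pinch y).Monic := monic_X_pow_sub_C _ two_ne_zero

theorem param_C (y : P) (f : P[X]) : param y (C f) = Polynomial.expand P 2 f := by simp [param]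

theorem param_X (y : P) : param y X = X * C y := by simp [param]

theorem param_pinch (y : P) : param y (pinch y) = 0 := by
  rw [pinch, map_sub, map_pow, param_X, param_C, map_mul, expand_X, expand_C, mul_pow, ← C_pow,
    sub_self]

theorem exists_eq_add (y : P) (f : P[X][X]) : ∃ a b : P[X], ∃ q, f = C a + C b * X + pinch y * q := by
  refine ⟨(f %ₘ pinch y).coeff 0, (f %ₘ pinch y).coeff 1, f /ₘ pinch y, ?_⟩
  conv_lhs => rw [← modByMonic_add_div f (pinch y)]
  congr 1
  have h : (f %ₘ pinch y).natDegree < 2 := by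
    have := natDegree_modByMonic_lt f (monic_pinch y) (by
      intro h
      have := congrArg Polynomial.natDegree h
      rw [pinch, natDegree_X_pow_sub_C, natDegree_one] at this
      omega)
    rwa [pinch, natDegree_X_pow_sub_C] at this
  conv_lhs => rw [(f %ₘ pinch y).as_sum_range' 2 h]
  simp [Finset.sum_range_succ, ← C_mul_X_pow_eq_monomial]

/-- Even coefficients see only `a`, odd ones only `b y`. Kernel and image of the parametrization can
thus be read off coefficient by coefficient. -/
theorem coeff_param (y : P) (a b : P[X]) (n : ℕ) :
    (param y (C a + C b * X)).coeff (2 * n) = a.coeff n ∧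
    (param y (C a + C b * X)).coeff (2 * n + 1) = b.coeff n * y := by
  simp only [map_add, map_mul, param_C, param_X]
  rw [← mul_assoc, coeff_add, coeff_add, coeff_mul_C, coeff_mul_C]
  constructor
  · rw [coeff_expand_mul' two_pos]
    cases n with
    | zero => simp
    | succ n =>
      rw [show 2 * (n + 1) = (2 * n + 1) + 1 by ring, coeff_mul_X, coeff_expand two_pos, if_neg (by omega)]
      simp
  · rw [coeff_mul_X, coeff_expand_mul' two_pos, coeff_expand two_pos, if_neg (by omega), zero_add]

theorem ker_param {y : P} (hy : y ≠ 0) : RingHom.ker (param y) = Ideal.span {pinch y} := by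
  refine le_antisymm (fun f hf => ?_) ?_
  · obtain ⟨a, b, q, rfl⟩ := exists_eq_add y f
    rw [RingHom.mem_ker, map_add (param y) _ (pinch y * q), map_mul _ (pinch y), param_pinch,
      zero_mul, add_zero] at hf
    have ha : a = 0 := by
      ext n; have := (coeff_param y a b n).1; rw [hf] at this; simpa using this.symm
    have hb : b = 0 := by
      ext n; have := (coeff_param y a b n).2; rw [hf] at this; simpa [hy] using this.symm
    rw [ha, hb]
    simpa using Ideal.mul_mem_right q _ (Ideal.mem_span_singleton_self (pinch y))
  · rw [Ideal.span_singleton_le_iff_mem, RingHom.mem_ker, param_pinch]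

/-- In the image, the coefficient of the first power is a multiple of `y`. -/
theorem X_notMem_range_param {y : P} (hy : ¬ IsUnit y) : X ∉ (param y).range := by
  rintro ⟨f, hf⟩
  obtain ⟨a, b, q, rfl⟩ := exists_eq_add y f
  rw [map_add (param y) _ (pinch y * q), map_mul _ (pinch y), param_pinch,
      zero_mul, add_zero] at hf
  have := (coeff_param y a b 0).2
  rw [hf] at this
  simp only [mul_zero, zero_add, coeff_X_one] at this
  exact hy (IsUnit.of_mul_eq_one _ (by rw [mul_comm]; exact this.symm))

/-- So `y` lies in the conductor, which makes the parametrization birational. -/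
theorem mul_mem_range_param (y : P) (b : P[X]) : C y * b ∈ (param y).range := by
  induction b using Polynomial.induction_on' with
  | add p q hp hq => rw [mul_add]; exact add_mem hp hq
  | monomial n a =>
    obtain ⟨m, rfl | rfl⟩ := n.even_or_odd'
    · refine ⟨C (C (y * a) * X ^ m), ?_⟩
      rw [param_C, map_mul, map_pow, expand_X, expand_C, ← C_mul_X_pow_eq_monomial, C_mul, pow_mul, mul_assoc]
    · refine ⟨X * C (C a * X ^ m), ?_⟩
      rw [map_mul, param_C, param_X, map_mul, map_pow, expand_X, expand_C, ← C_mul_X_pow_eq_monomial]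
      ring

theorem pow_mem_range_param (h2 : (2 : P) = 0) (y : P) (b : P[X]) : b ^ 2 ∈ (param y).range := by
  have h2' : (2 : P[X]) = 0 := by
    have := congrArg (C : P → P[X]) h2
    rwa [map_ofNat, map_zero] at this
  induction b using Polynomial.induction_on' with
  | add p q hp hq =>
    have : (p + q) ^ 2 = p ^ 2 + q ^ 2 := by linear_combination p * q * h2'
    rw [this]; exact add_mem hp hq
  | monomial n a =>
    refine ⟨C (C (a ^ 2) * X ^ n), ?_⟩
    rw [param_C, map_mul, map_pow _ X, expand_X, expand_C, ← C_mul_X_pow_eq_monomial]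
    simp only [C_pow]
    ring
end

section
variable {k A : Type u} [Field k] [CommRing A] [IsDomain A] [Algebra k A] {y : A}

theorem two_eq_zero [CharP k 2] : (2 : A) = 0 := by
  have := congrArg (algebraMap k A) (CharP.cast_eq_zero k 2)
  rwa [map_natCast, map_zero] at this

variable (k) in
/-- The spectrum of `A[t, x] / (x² - t y²)` is not weakly normal in characteristic two. -/
theorem not_isWeaklyNormal [CharP k 2] [Algebra.FiniteType k A] (hy : y ≠ 0) (hy' : ¬ IsUnit y)
    {S : Scheme.{u}} (e : S ≅ Spec (CommRingCat.of (A[X][X] ⧸ Ideal.span {pinch y}))) :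
    ¬ IsWeaklyNormal S := by
  have : Fact (Nat.Prime 2) := ⟨Nat.prime_two⟩
  have h2 : (2 : A) = 0 := two_eq_zero (k := k)
  have h2' : (2 : A[X]) = 0 := two_eq_zero (k := k)
  let τ : A[X][X] →ₐ[k] A[X] :=
    { param y with
      commutes' := fun r => by
        change param y (C (C (algebraMap k A r))) = C (algebraMap k A r)
        rw [param_C, expand_C] }
  have hC : param y (C (C y)) = C y := by rw [param_C, expand_C]
  refine not_isWeaklyNormal_quotient 2 (by exact_mod_cast h2') τ (pinch y) (ker_param hy)
    (fun h => X_notMem_range_param hy' (h X)) (fun b => pow_mem_range_param h2 y b) (C (C y)) ?_ ?_ e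
  · change param y (C (C y)) ≠ 0
    rw [hC]
    exact C_ne_zero.mpr hy
  · intro b
    refine ⟨1, ?_⟩
    change ∃ r, param y r = param y (C (C y)) ^ 1 * b
    rw [hC, pow_one]
    exact mul_mem_range_param _ _

theorem span_D {w : A} (hyw : ∀ a : A, KaehlerDifferential.D k A a ∈
      Submodule.span A ((KaehlerDifferential.D k A) '' {y, w})) (f : A[X][X]) :
    KaehlerDifferential.D k A[X][X] f ∈
    Submodule.span A[X][X] (Set.range fun i => KaehlerDifferential.D k A[X][X]
      ((![X, C (C y), C X, C (C w)] : Fin 4 → A[X][X]) i)) := by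
  have h := span_D_polynomial (k := k) _ (span_D_polynomial _ hyw) f
  refine Submodule.span_mono ?_ h
  rintro _ ⟨g, hg, rfl⟩
  simp only [Set.image_insert_eq, Set.image_singleton, Set.mem_insert_iff,
    Set.mem_singleton_iff] at hg
  rcases hg with rfl | rfl | rfl | rfl
  · exact ⟨0, rfl⟩
  · exact ⟨2, rfl⟩
  · exact ⟨1, rfl⟩
  · exact ⟨3, rfl⟩

/-- In a valuation ring either `x = z y` or `y = q x` with `q` not a unit, as on the two charts of
the blow-up of `x = y = 0`. The equation becomes `y² (z² - t)` or `x²` times a unit, while `dx ∧ dy`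
acquires a factor `y² dz ∧ dlog y` or `x² dlog x ∧ dq`. -/
theorem hasLogPoles [CharP k 2] (hy : y ≠ 0) (w : A) :
    HasLogPoles k A[X][X] (![X, C (C y), C X, C (C w)] : Fin 4 → A[X][X]) (pinch y) := by
  intro O L _ _ _ _ _ _ _ _ _ _ _ _ _ _ _ b hb ϖ hϖ
  have hinj := IsFractionRing.injective A[X][X] L
  set g := algebraMap A[X][X] L
  have h2 : (2 : L) = 0 := two_eq_zero (k := k)
  have hx0 : g X ≠ 0 := (map_ne_zero_iff g hinj).mpr X_ne_zero
  have hy0 : g (C (C y)) ≠ 0 := (map_ne_zero_iff g hinj).mpr (by simpa using hy)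
  have hs0 : g (pinch y) ≠ 0 := (map_ne_zero_iff g hinj).mpr (monic_pinch y).ne_zero
  have hgO : ∀ r, g r = algebraMap O L (algebraMap A[X][X] O r) := fun r =>
    IsScalarTower.algebraMap_apply _ O L r
  have hs : g (pinch y) = g X ^ 2 - g (C X) * g (C (C y)) ^ 2 := by
    simp only [pinch, map_sub, map_mul, map_pow]
  have hmem : ∀ r, KaehlerDifferential.D k L (g r) ∈ logForms k L ϖ := fun r => by
    rw [hgO]; exact D_mem_logForms k ϖ _
  have hlog : ∀ z : L, z ≠ 0 → dlog k z ∈ logForms k L ϖ := fun z hz => dlog_mem_logForms k hϖ hz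
  have hval : (∃ z : O, g X = algebraMap O L z * g (C (C y))) ∨
      ∃ q : O, g (C (C y)) = algebraMap O L q * g X ∧ ¬ IsUnit q := by
    obtain ⟨z, hz | hz⟩ := ValuationRing.cond (algebraMap A[X][X] O X) (algebraMap A[X][X] O (C (C y)))
    · by_cases hu : IsUnit z
      · obtain ⟨z', hz'⟩ := hu.exists_right_inv
        refine Or.inl ⟨z', ?_⟩
        rw [hgO, hgO, ← hz, ← map_mul, mul_comm, mul_assoc, hz', mul_one]
      · refine Or.inr ⟨z, ?_, hu⟩
        rw [hgO, hgO, ← hz, ← map_mul, mul_comm]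
    · refine Or.inl ⟨z, ?_⟩
      rw [hgO, hgO, ← hz, ← map_mul, mul_comm]
  have ht := hmem (C X)
  have hw := hmem (C (C w))
  have htO := hgO (C X)
  rcases hval with ⟨z, hz⟩ | ⟨q, hq, hqu⟩
  · have hs1 : algebraMap O L z ^ 2 - g (C X) ≠ 0 := by
      intro h
      apply hs0
      rw [hs, hz]
      linear_combination g (C (C y)) ^ 2 * h
    refine exists_smul_wedge_eq_of_det b hb hϖ.ne_zero
      ![KaehlerDifferential.D k L (algebraMap O L z), dlog k (g (C (C y))),
        dlog k (algebraMap O L z ^ 2 - g (C X)), KaehlerDifferential.D k L (g (C (C w)))] ?_ _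
      !![g (C (C y)), algebraMap O L z * g (C (C y)), 0, 0; 0, g (C (C y)), 0, 0;
        0, 0, -(algebraMap O L z ^ 2 - g (C X)), 0; 0, 0, 0, 1] ?_ _ (-1) ?_
    · intro i
      fin_cases i
      exacts [D_mem_logForms k ϖ z, hlog _ hy0, hlog _ hs1, hw]
    · intro i
      fin_cases i
      · simp [Fin.sum_univ_four, hz, Derivation.leibniz, mul_smul, smul_dlog k hy0, add_comm]
      · simp [Fin.sum_univ_four, smul_dlog k hy0]
      -- Here characteristic two enters: `d(z²) = 0`, so `z² - t` can replace `t` as a coordinate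
      -- and carry the logarithmic pole.
      · have h3 : KaehlerDifferential.D k L (algebraMap O L z ^ 2 - g (C X)) =
            -KaehlerDifferential.D k L (g (C X)) := by
          simp [Derivation.leibniz_pow, h2, ← Nat.cast_smul_eq_nsmul L]
        rw [← smul_dlog k hs1] at h3
        simp [Fin.sum_univ_four, -neg_sub, neg_smul, h3]
      · simp [Fin.sum_univ_four]
    · simp [Matrix.det_succ_row_zero, Fin.sum_univ_succ, Fin.succAbove]
      rw [hs, hz]; ring
  · have hu : IsUnit (1 - algebraMap A[X][X] O (C X) * q ^ 2) := by
      by_contra h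
      have h1 : (1 : O) ∈ IsLocalRing.maximalIdeal O := by
        have : (1 : O) = (1 - algebraMap A[X][X] O (C X) * q ^ 2) +
          (algebraMap A[X][X] O (C X) * q) * q := by ring
        rw [this]
        exact add_mem h (Ideal.mul_mem_left _ _ hqu)
      exact h1 isUnit_one
    obtain ⟨c, hc⟩ := hu.exists_right_inv
    have hc' : (1 - g (C X) * algebraMap O L q ^ 2) * algebraMap O L c = 1 := by
      have := congrArg (algebraMap O L) hc
      simpa [← htO] using this
    refine exists_smul_wedge_eq_of_det b hb hϖ.ne_zero
      ![dlog k (g X), KaehlerDifferential.D k L (algebraMap O L q),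
        KaehlerDifferential.D k L (g (C X)), KaehlerDifferential.D k L (g (C (C w)))] ?_ _
      !![g X, 0, 0, 0; algebraMap O L q * g X, g X, 0, 0; 0, 0, 1, 0; 0, 0, 0, 1] ?_ _ c ?_
    · intro i
      fin_cases i
      exacts [hlog _ hx0, D_mem_logForms k ϖ q, ht, hw]
    · intro i
      fin_cases i
      · simp [Fin.sum_univ_four, smul_dlog k hx0]
      · simp [Fin.sum_univ_four, hq, Derivation.leibniz, mul_smul, smul_dlog k hx0]
      · simp [Fin.sum_univ_four]
      · simp [Fin.sum_univ_four]
    · simp [Matrix.det_succ_row_zero, Fin.sum_univ_succ, Fin.succAbove]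
      rw [hs, hq]
      linear_combination (-g X ^ 2) * hc'

variable (k A) in
theorem exists_pair_polynomial [CharP k 2] [Algebra.FiniteType k A] [IsIntegrallyClosed A]
    (hdim : ringKrullDim A = 2) (htr : 2 ≤ Algebra.trdeg k A) (hy : y ≠ 0) (hy' : ¬ IsUnit y)
    {w : A} (hyw : ∀ a : A, KaehlerDifferential.D k A a ∈
      Submodule.span A ((KaehlerDifferential.D k A) '' {y, w})) :
    ∃ (X : Scheme.{u}) (σ : X ⟶ Spec (CommRingCat.of k))
      (_ : IsIntegral X) (_ : IsLocallyNoetherian X),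
      IsNormalVariety X σ ∧ topologicalKrullDim X = (4 : ℕ) ∧
      ∃ (S : X.IdealSheafData) (D Δ : QDivisor X),
        IsEffectiveCartier S ∧ IsWeilDivisorOf S D ∧ 0 ≤ Δ ∧ IsLogCanonical σ 4 (D + Δ) ∧
        IsReduced S.subscheme ∧ ¬ IsWeaklyNormal S.subscheme := by
  have : IsNoetherianRing A := Algebra.FiniteType.isNoetherianRing k A
  have hspan := span_D (k := k) hyw
  have hdim : ringKrullDim A[X][X] = (4 : ℕ) := by
    rw [Polynomial.ringKrullDim_of_isNoetherianRing, Polynomial.ringKrullDim_of_isNoetherianRing,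
      hdim]
    rfl
  have htr' : ((4 : ℕ) : Cardinal) ≤ Algebra.trdeg k A[X][X] := by
    rw [trdeg_polynomial, trdeg_polynomial]
    calc ((4 : ℕ) : Cardinal) = 2 + 1 + 1 := by norm_num
      _ ≤ _ := by gcongr
  have hN := isNonzeroForm_of_span htr' (![X, C (C y), C X, C (C w)]) fun r => ⟨(1 : A[X][X]), one_ne_zero, Submodule.smul_mem _ 1 (hspan r)⟩
  have hX : ∀ P : Ideal A[X][X], P.IsPrime → P.height = 1 →
      HasCoordinatesAt k (![X, C (C y), C X, C (C w)] : Fin 4 → A[X][X]) (pinch y) (pinch y) 1 1 P :=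
    fun P hP _ => ⟨_, 1, 1, one_ne_zero, one_ne_zero, fun r => ⟨1, hP.one_notMem, Submodule.smul_mem _ 1 (hspan r)⟩, fun L _ _ _ _ _ => rfl, 1, hP.one_notMem, 1,
      hP.one_notMem, by ring⟩
  -- With `η = 1` and `m = 1` the divisor `Δ` is zero.
  exact exists_logCanonical_pair hdim _ (pinch y) (pinch y) 1 (monic_pinch _).ne_zero
    (monic_pinch _).ne_zero one_ne_zero one_pos hN (hasLogPoles hy _) hX
    (isReduced_quotient_of_ker (param y) _ (ker_param hy)) (fun S e => not_isWeaklyNormal k hy hy' e)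

end

/-- The pair `(𝔸⁴, (x² = t y²))` in characteristic two. -/
theorem exists_pair (k : Type u) [Field k] [CharP k 2] :
    ∃ (X : Scheme.{u}) (σ : X ⟶ Spec (CommRingCat.of k))
      (_ : IsIntegral X) (_ : IsLocallyNoetherian X),
      IsNormalVariety X σ ∧ topologicalKrullDim X = 4 ∧
      ∃ (S : X.IdealSheafData) (D Δ : QDivisor X),
        IsEffectiveCartier S ∧ IsWeilDivisorOf S D ∧ 0 ≤ Δ ∧ IsLogCanonical σ 4 (D + Δ) ∧
        IsReduced S.subscheme ∧ ¬ IsWeaklyNormal S.subscheme := by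
  let A := MvPolynomial (Fin 2) k
  have hspan : ∀ a : A, KaehlerDifferential.D k A a ∈ Submodule.span A
      ((KaehlerDifferential.D k A) '' {MvPolynomial.X 0, MvPolynomial.X 1}) := by
    intro a
    have h := (KaehlerDifferential.mvPolynomialBasis k (Fin 2)).span_eq
    have h1 : KaehlerDifferential.D k A a ∈ Submodule.span A
      (Set.range (KaehlerDifferential.mvPolynomialBasis k (Fin 2))) := h ▸ trivial
    refine Submodule.span_mono ?_ h1
    rintro _ ⟨i, rfl⟩
    rw [KaehlerDifferential.mvPolynomialBasis_apply]
    fin_cases i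
    · exact ⟨_, Or.inl rfl, rfl⟩
    · exact ⟨_, Or.inr rfl, rfl⟩
  refine exists_pair_polynomial k A (y := MvPolynomial.X 0) ?_ ?_ (MvPolynomial.X_ne_zero 0) ?_ hspan
  · rw [MvPolynomial.ringKrullDim_of_isNoetherianRing, ringKrullDim_eq_zero_of_field]
    norm_num
  · rw [MvPolynomial.trdeg_of_isDomain]
    norm_num
  · exact fun h => by simpa using MvPolynomial.isUnit_iff_totalDegree_of_isReduced.mp h

end Pinch

/-! ### The Hasse polynomial -/

section
open Polynomial

/-- The Hasse polynomial, whose roots are the parameters of the supersingular Legendre curves. -/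
def hasse (F : Type*) [CommRing F] (m : ℕ) : F[X] :=
  ∑ i ∈ Finset.range (m + 1), C ((-1) ^ m * (m.choose i : F) ^ 2) * X ^ i

section Hasse
variable {F : Type*} [Field F] (m : ℕ)

theorem coeff_hasse (n : ℕ) : (hasse F m).coeff n = (-1) ^ m * (m.choose n : F) ^ 2 := by
  simp only [hasse, finsetSum_coeff, coeff_C_mul_X_pow]
  rw [Finset.sum_ite_eq]
  split_ifs with h
  · rfl
  · rw [Nat.choose_eq_zero_of_lt (by simpa using h)]; simp

theorem hasse_ne_zero : hasse F m ≠ 0 := by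
  intro h
  have := coeff_hasse (F := F) m 0
  rw [h, coeff_zero, Nat.choose_zero_right, Nat.cast_one, one_pow, mul_one] at this
  exact pow_ne_zero m (neg_ne_zero.mpr one_ne_zero) this.symm

theorem eval_hasse_zero_ne_zero : (hasse F m).eval 0 ≠ 0 := by
  rw [← coeff_zero_eq_eval_zero, coeff_hasse]
  simp

theorem natDegree_hasse : (hasse F m).natDegree = m := by
  refine le_antisymm ?_ (le_natDegree_of_ne_zero ?_)
  · refine natDegree_le_iff_coeff_eq_zero.mpr fun n hn => ?_
    rw [coeff_hasse, Nat.choose_eq_zero_of_lt hn]; simp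
  · rw [coeff_hasse]; simp

variable {m} {p : ℕ} [CharP F p]

/-- This is the Picard–Fuchs equation of the Legendre family. On coefficients it follows from `(i +
1) choose (m, i + 1) = (m - i) choose (m, i)` together with `2m = -1`. -/
theorem hasse_ode (hpm : p = 2 * m + 1) : 4 * (X * (1 - X) * derivative (derivative (hasse F m)) +
    (1 - 2 * X) * derivative (hasse F m)) = hasse F m := by
  have hm : (2 * (m : F) + 1) = 0 := by
    have := CharP.cast_eq_zero F p
    rw [hpm] at this
    push_cast at this
    exact this
  ext n
  have key : ∀ i : ℕ, ((m.choose (i + 1) : F) * (i + 1)) = m.choose i * (m - i) := by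
    intro i
    rcases le_or_gt i m with h | h
    · have := Nat.choose_succ_right_eq m i
      have h2 := congrArg (fun t : ℕ => (t : F)) this
      push_cast [Nat.cast_sub h] at h2
      exact h2
    · rw [Nat.choose_eq_zero_of_lt h, Nat.choose_eq_zero_of_lt (by omega)]; simp
  have e : 4 * (X * (1 - X) * derivative (derivative (hasse F m)) +
    (1 - 2 * X) * derivative (hasse F m)) = C 4 * (derivative (derivative (hasse F m)) * X -
      derivative (derivative (hasse F m)) * X * X + derivative (hasse F m) -
      C 2 * (derivative (hasse F m) * X)) := by
    rw [map_ofNat, map_ofNat]; ring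
  rw [e, coeff_C_mul, coeff_sub, coeff_C_mul, coeff_add, coeff_sub]
  have k0 := key n
  rcases n with _ | _ | n
  · simp only [coeff_mul_X_zero, coeff_derivative, coeff_hasse]
    simp at k0 ⊢
    linear_combination (-1) ^ m * (2 * (m : F) - 1) * hm
  · simp only [coeff_mul_X, coeff_mul_X_zero, coeff_derivative, coeff_hasse]
    simp at k0 ⊢
    linear_combination (-1) ^ m * 4 * ((m.choose 2 : F) * 2 + m * (m - 1)) * k0 +
      (-1) ^ m * (m : F) ^ 2 * (2 * (m : F) - 5) * hm
  · simp only [coeff_mul_X, coeff_derivative, coeff_hasse]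
    push_cast at k0 ⊢
    linear_combination (-1) ^ m * 4 * ((m.choose (n + 1 + 1 + 1) : F) * (n + 1 + 1 + 1) +
      m.choose (n + 1 + 1) * (m - (n + 1 + 1))) * k0 +
      (-1) ^ m * (m.choose (n + 1 + 1) : F) ^ 2 * (2 * (m : F) - 4 * (n + 1 + 1) - 1) * hm

/-- The value is `± choose (2m, m)`, a divisor of `(2m)!`, and `2m < p`. -/
theorem eval_hasse_one_ne_zero [Fact p.Prime] (hpm : p = 2 * m + 1) : (hasse F m).eval 1 ≠ 0 := by
  have h1 : (hasse F m).eval 1 = (-1) ^ m * ((2 * m).choose m : ℕ) := by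
    rw [← Nat.sum_range_choose_sq, hasse, eval_finsetSum]
    push_cast
    rw [Finset.mul_sum]
    simp
  rw [h1, mul_ne_zero_iff]
  refine ⟨pow_ne_zero _ (neg_ne_zero.mpr one_ne_zero), fun h => ?_⟩
  rw [CharP.cast_eq_zero_iff F p] at h
  have h2 : p ∣ (2 * m).factorial := h.trans ⟨_, by
    rw [← Nat.choose_mul_factorial_mul_factorial (n := 2 * m) (k := m) (by omega), mul_assoc]⟩
  rw [(Fact.out : p.Prime).dvd_factorial] at h2
  omega

/-- The roots of the Hasse polynomial are simple. -/
theorem eval_derivative_hasse_ne_zero [Fact p.Prime] (hpm : p = 2 * m + 1) {a : F} (ha : (hasse F m).eval a = 0) :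
    (derivative (hasse F m)).eval a ≠ 0 := by
  classical
  intro ha'
  have hp2 : (2 : F) ≠ 0 := by
    intro h
    have h' : ((2 : ℕ) : F) = 0 := by exact_mod_cast h
    rw [CharP.cast_eq_zero_iff F p] at h'
    have := (Nat.prime_dvd_prime_iff_eq (Fact.out : p.Prime) Nat.prime_two).mp h'
    omega
  have ha0 : a ≠ 0 := by rintro rfl; exact eval_hasse_zero_ne_zero m ha
  have ha1 : 1 - a ≠ 0 := by
    intro h
    rw [← sub_eq_zero.mp h] at ha
    exact eval_hasse_one_ne_zero hpm ha
  have hne := hasse_ne_zero (F := F) m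
  obtain ⟨G, hG, hGa⟩ := exists_eq_pow_rootMultiplicity_mul_and_not_dvd (hasse F m) hne a
  have h2 : 2 ≤ rootMultiplicity a (hasse F m) :=
    (one_lt_rootMultiplicity_iff_isRoot hne).mpr ⟨ha, ha'⟩
  have hle : rootMultiplicity a (hasse F m) ≤ m := by
    have h := (Multiset.count_le_card a (hasse F m).roots).trans (card_roots' _)
    rwa [count_roots, natDegree_hasse] at h
  -- Here `n + 2` is the multiplicity of the root, which is at most `m`.
  obtain ⟨n, hn⟩ := Nat.exists_eq_add_of_le h2
  rw [hn] at hG hle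
  rw [dvd_iff_isRoot, IsRoot.def] at hGa
  have h4 := hasse_ode (F := F) hpm
  have hT : X - C a ≠ 0 := X_sub_C_ne_zero a
  obtain ⟨N, hN⟩ : ∃ N : F[X], N = (n : F[X]) := ⟨_, rfl⟩
  have dN : derivative N = 0 := by rw [hN, derivative_natCast]
  have d0 : ∀ (j : ℕ) (M : F[X]), ((j + 1 : ℕ) : F[X]) = M →
      derivative ((X - C a) ^ (j + 1)) = M * (X - C a) ^ j := by
    rintro j _ rfl
    rw [derivative_X_sub_C_pow, Nat.add_sub_cancel, map_natCast]
  have d1 : derivative ((X - C a) ^ (2 + n) * G) =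
      (N + 2) * (X - C a) ^ (n + 1) * G + (X - C a) ^ (n + 2) * derivative G := by
    rw [derivative_mul, show 2 + n = n + 1 + 1 by ring,
      d0 (n + 1) (N + 2) (by rw [hN]; push_cast; ring)]
  have d2 : derivative ((N + 2) * (X - C a) ^ (n + 1) * G + (X - C a) ^ (n + 2) * derivative G) =
      (N + 2) * (N + 1) * (X - C a) ^ n * G + 2 * (N + 2) * (X - C a) ^ (n + 1) * derivative G +
        (X - C a) ^ (n + 2) * derivative (derivative G) := by
    simp only [derivative_add, derivative_mul, dN, derivative_ofNat,
      d0 (n + 1) (N + 2) (by rw [hN]; push_cast; ring), d0 n (N + 1) (by rw [hN]; push_cast; ring)]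
    ring
  -- After division by `(X - a) ^ n` and evaluation at `a`, only `4 a (1 - a) (n + 2)(n + 1) G(a) =
  -- 0` remains of the differential equation; this fails since `n + 2 ≤ m < p`.
  have e : (X - C a) ^ n * (4 * (X * (1 - X) * ((N + 2) * (N + 1) * G +
      2 * (N + 2) * (X - C a) * derivative G + (X - C a) ^ 2 * derivative (derivative G)) +
      (1 - 2 * X) * ((N + 2) * (X - C a) * G + (X - C a) ^ 2 * derivative G))) =
      (X - C a) ^ n * ((X - C a) ^ 2 * G) := by
    rw [hG, d1, d2] at h4
    linear_combination h4
  have h5 := congrArg (eval a) (mul_left_cancel₀ (pow_ne_zero n hT) e)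
  rw [hN] at h5
  simp only [eval_mul, eval_add, eval_sub, eval_X, eval_C, eval_one, eval_pow, eval_natCast,
    eval_ofNat, sub_self] at h5
  have h6 : ((n : F) + 2) * (n + 1) = 0 := by
    have h7 : (2 * 2 * a * (1 - a) * G.eval a) * (((n : F) + 2) * (n + 1)) = 0 := by
      linear_combination h5
    exact (mul_eq_zero.mp h7).resolve_left (by simp [hp2, ha0, ha1, hGa])
  have h8 : (((n + 2) * (n + 1) : ℕ) : F) = 0 := by push_cast; exact h6
  rw [CharP.cast_eq_zero_iff F p, (Fact.out : p.Prime).dvd_mul] at h8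
  rcases h8 with h | h <;> have := Nat.le_of_dvd (by omega) h <;> omega

end Hasse

/-! ### The base curve -/

/-- If `a / d` is integral over an integrally closed domain `B`, then `d` divides `a`. -/
theorem dvd_of_isIntegral {B K : Type*} [CommRing B] [IsDomain B] [IsIntegrallyClosed B] [Field K]
    [Algebra B K] (hinj : Function.Injective (algebraMap B K)) {a d : B} (hd : d ≠ 0) {w : K}
    (hw : w * algebraMap B K d = algebraMap B K a) (hint : IsIntegral B w) : d ∣ a := by
  let φ : FractionRing B →ₐ[B] K := IsFractionRing.liftAlgHom (g := Algebra.ofId B K) hinj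
  have hd' : algebraMap B K d ≠ 0 := (map_ne_zero_iff _ hinj).mpr hd
  have hd'' : algebraMap B (FractionRing B) d ≠ 0 :=
    (map_ne_zero_iff _ (IsFractionRing.injective B _)).mpr hd
  have hφ : φ (algebraMap B _ a / algebraMap B _ d) = w := by
    rw [map_div₀, φ.commutes, φ.commutes, ← hw, mul_div_cancel_right₀ _ hd']
  rw [← hφ, isIntegral_algHom_iff φ φ.toRingHom.injective, IsIntegrallyClosed.isIntegral_iff] at hint
  obtain ⟨c, hc⟩ := hint
  refine ⟨c, IsFractionRing.injective B (FractionRing B) ?_⟩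
  rw [map_mul, hc, mul_div_cancel₀ _ hd'']

/-- A smooth affine curve with a family of Legendre curves of parameter `l`, whose Hasse invariant
is a power of the function `u`, which has a simple zero at one point. -/
structure IsHasseBase (k : Type u) {A : Type u} [Field k] [CommRing A] [Algebra k A]
    (m : ℕ) (l u : A) : Prop where
  isDomain : IsDomain A
  finiteType : Algebra.FiniteType k A
  isIntegrallyClosed : IsIntegrallyClosed A
  ringKrullDim_eq : ringKrullDim A = 1
  one_le_trdeg : 1 ≤ Algebra.trdeg k A
  prime : Prime u
  isUnit_left : IsUnit l
  isUnit_right : IsUnit (1 - l)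
  pow_eq : u ^ (2 * m) = aeval l (hasse k m)
  D_mem_span : ∀ a : A, KaehlerDifferential.D k A a ∈
    Submodule.span A {KaehlerDifferential.D k A u}

section
variable {k A : Type u} [Field k] [CommRing A] [Algebra k A] {l u s : A} {g : k[X]}

theorem aeval_sub_algebraMap_mem (I : Ideal A) {α : k} (h : l - algebraMap k A α ∈ I) (f : k[X]) :
    aeval l f - algebraMap k A (f.eval α) ∈ I := by
  obtain ⟨e, he⟩ := X_sub_C_dvd_sub_C_eval (a := α) (p := f)
  have := congrArg (aeval l) he
  simp only [map_sub, map_mul, aeval_X, aeval_C] at this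
  rw [this]
  exact I.mul_mem_right _ h

/-- Modulo `I` all generators are constants: `l` and `u` by assumption, and `s` because it inverts
`g(l) ≡ g(α) ≠ 0`. -/
theorem exists_sub_algebraMap_mem (hgen : Algebra.adjoin k {l, u, s} = ⊤) (hs : s * aeval l g = 1)
    (I : Ideal A) {α β : k} (hl : l - algebraMap k A α ∈ I) (hu : u - algebraMap k A β ∈ I)
    (hg : g.eval α ≠ 0) (a : A) : ∃ c : k, a - algebraMap k A c ∈ I := by
  have ha : a ∈ Algebra.adjoin k {l, u, s} := hgen ▸ trivial
  induction ha using Algebra.adjoin_induction with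
  | mem x hx =>
    rcases hx with rfl | rfl | rfl
    · exact ⟨α, hl⟩
    · exact ⟨β, hu⟩
    · refine ⟨(g.eval α)⁻¹, ?_⟩
      have h1 := aeval_sub_algebraMap_mem I hl g
      have h2 : algebraMap k A (g.eval α) * algebraMap k A (g.eval α)⁻¹ = 1 := by
        rw [← map_mul, mul_inv_cancel₀ hg, map_one]
      have h3 : x - algebraMap k A (g.eval α)⁻¹ =
          -(x * algebraMap k A (g.eval α)⁻¹) * (aeval l g - algebraMap k A (g.eval α)) := by
        linear_combination (-x) * h2 + algebraMap k A (g.eval α)⁻¹ * hs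
      rw [h3]
      exact I.mul_mem_left _ h1
  | algebraMap r => exact ⟨r, by simp⟩
  | add x y _ _ hx hy =>
    obtain ⟨c, hc⟩ := hx
    obtain ⟨d, hd⟩ := hy
    refine ⟨c + d, ?_⟩
    rw [map_add, add_sub_add_comm]
    exact add_mem hc hd
  | mul x y _ _ hx hy =>
    obtain ⟨c, hc⟩ := hx
    obtain ⟨d, hd⟩ := hy
    refine ⟨c * d, ?_⟩
    have : x * y - algebraMap k A (c * d) =
        y * (x - algebraMap k A c) + algebraMap k A c * (y - algebraMap k A d) := by
      rw [map_mul]; ring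
    rw [this]
    exact add_mem (I.mul_mem_left _ hc) (I.mul_mem_left _ hd)

/-- An affine curve `u ^ r = H (l)` is regular where `H'(l)` does not vanish. -/
theorem maximalIdeal_isPrincipal [IsAlgClosed k] [IsDomain A] [Algebra.FiniteType k A]
    (hgen : Algebra.adjoin k {l, u, s} = ⊤) (hs : s * aeval l g = 1) {H : k[X]}
    (hH : derivative H ∣ g) {r : ℕ} (hu : u ^ r = aeval l H) (M : Ideal A) [hM : M.IsMaximal] :
    (IsLocalRing.maximalIdeal (Localization.AtPrime M)).IsPrincipal := by
  have hsurj : ∀ a : A, ∃ c : k, a - algebraMap k A c ∈ M := by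
    intro a
    let _ : Field (A ⧸ M) := Ideal.Quotient.field M
    have : Module.Finite k (A ⧸ M) := finite_of_finite_type_of_isJacobsonRing k (A ⧸ M)
    obtain ⟨c, hc⟩ := (IsAlgClosed.algebraMap_bijective_of_isIntegral (k := k) (K := A ⧸ M)).2
      (Ideal.Quotient.mk M a)
    refine ⟨c, Ideal.Quotient.eq.mp ?_⟩
    rw [← hc]; rfl
  have hk : ∀ c : k, algebraMap k A c ∈ M → c = 0 := by
    intro c hc
    by_contra h
    refine hM.ne_top (Ideal.eq_top_of_isUnit_mem _ hc ((Ne.isUnit h).map _))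
  obtain ⟨α, hα⟩ := hsurj l
  obtain ⟨β, hβ⟩ := hsurj u
  have hgα : g.eval α ≠ 0 := by
    intro h
    have h1 := aeval_sub_algebraMap_mem M hα g
    rw [h, map_zero, sub_zero] at h1
    have : (1 : A) ∈ M := hs ▸ M.mul_mem_left s h1
    exact hM.ne_top ((Ideal.eq_top_iff_one M).mpr this)
  have hHα : (derivative H).eval α ≠ 0 := by
    obtain ⟨e, rfl⟩ := hH
    rw [eval_mul] at hgα
    exact left_ne_zero_of_mul hgα
  obtain ⟨E, hE⟩ := X_sub_C_dvd_sub_C_eval (a := α) (p := H)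
  have hEα : E.eval α = (derivative H).eval α := by
    have := congrArg (fun f => (derivative f).eval α) hE
    simpa using this.symm
  have hEM : aeval l E ∉ M := by
    intro h
    have h1 := sub_mem h (aeval_sub_algebraMap_mem M hα E)
    rw [sub_sub_cancel] at h1
    exact hHα (hEα ▸ hk _ h1)
  obtain ⟨G, hG⟩ := sub_dvd_pow_sub_pow u (algebraMap k A β) r
  have hval : H.eval α = β ^ r := by
    have h1 := aeval_sub_algebraMap_mem M hα H
    have h2 : u ^ r - algebraMap k A β ^ r ∈ M := by rw [hG]; exact M.mul_mem_right _ hβ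
    have h3 := sub_mem h2 h1
    rw [hu, sub_sub_sub_cancel_left, ← map_pow, ← map_sub] at h3
    exact sub_eq_zero.mp (hk _ h3)
  -- At `α` the cofactor `E` takes the value `H'(α) ≠ 0`. So `E(l)` is a unit at `M`, and `l - α` is
  -- locally a multiple of `u - β`.
  have hrel : (l - algebraMap k A α) * aeval l E = (u - algebraMap k A β) * G := by
    rw [← hG, hu, ← map_pow, ← hval]
    have := congrArg (aeval l) hE
    simp only [map_sub, map_mul, aeval_X, aeval_C] at this
    exact this.symm
  have hMspan : M = Ideal.span {l - algebraMap k A α, u - algebraMap k A β} := by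
    -- Modulo the smaller ideal an element of `M` is a constant, and a constant in `M` is zero.
    refine le_antisymm (fun a ha => ?_) (Ideal.span_le.mpr ?_)
    · obtain ⟨c, hc⟩ := exists_sub_algebraMap_mem hgen hs
        (Ideal.span {l - algebraMap k A α, u - algebraMap k A β}) (α := α) (β := β)
        (Ideal.subset_span (by simp)) (Ideal.subset_span (by simp)) hgα a
      have hcM : a - algebraMap k A c ∈ M := by
        refine Ideal.span_le.mpr ?_ hc
        rintro x (rfl | rfl)
        exacts [hα, hβ]
      have hc0 : c = 0 := hk c (by simpa using sub_mem ha hcM)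
      simpa [hc0] using hc
    · rintro x (rfl | rfl)
      exacts [hα, hβ]
  refine ⟨⟨algebraMap A _ (u - algebraMap k A β), ?_⟩⟩
  rw [← Localization.AtPrime.map_eq_maximalIdeal]
  refine le_antisymm ?_ ?_
  · have hunit : IsUnit (algebraMap A (Localization.AtPrime M) (aeval l E)) :=
      (IsLocalization.AtPrime.isUnit_to_map_iff _ M _).mpr hEM
    refine Ideal.map_le_iff_le_comap.mpr (hMspan.le.trans (Ideal.span_le.mpr ?_))
    rintro x (rfl | rfl)
    · obtain ⟨e, he⟩ := hunit.exists_right_inv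
      rw [SetLike.mem_coe, Ideal.mem_comap]
      refine Ideal.mem_span_singleton.mpr ⟨algebraMap A _ G * e, ?_⟩
      have := congrArg (algebraMap A (Localization.AtPrime M)) hrel
      rw [map_mul, map_mul] at this
      linear_combination e * this - algebraMap A (Localization.AtPrime M) (l - algebraMap k A α) * he
    · exact Ideal.mem_span_singleton_self _
  · rw [Submodule.span_singleton_le_iff_mem]
    exact Ideal.mem_map_of_mem _ hβ

/-- Inverting `l (1 - l)` keeps the Legendre curves smooth, inverting `H'(l)` keeps the base smooth,
and inverting `q(l)` leaves `l = a₀` as the only place where `u` vanishes. Since `a₀` is a simple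
root different from `0` and `1`, that point itself is not removed. -/
theorem isHasseBase_of_adjoin [IsAlgClosed k] [IsDomain A] {p m : ℕ} [CharP k p] [Fact p.Prime]
    (hpm : p = 2 * m + 1) (htr : Transcendental k l) (hu : u ^ (2 * m) = aeval l (hasse k m))
    {q : k[X]} {a₀ : k} (hq : hasse k m = (X - C a₀) * q)
    (hs : s * aeval l (X * (1 - X) * derivative (hasse k m) * q) = 1)
    (hgen : Algebra.adjoin k {l, u, s} = ⊤) : IsHasseBase k m l u := by
  set g := X * (1 - X) * derivative (hasse k m) * q with hg
  have hm : m ≠ 0 := by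
    rintro rfl
    exact (Fact.out : p.Prime).ne_one (by omega)
  have hft : Algebra.FiniteType k A := by
    classical
    exact ⟨⟨{l, u, s}, by simpa using hgen⟩⟩
  have hnoeth : IsNoetherianRing A := Algebra.FiniteType.isNoetherianRing k A
  have hroot : (hasse k m).eval a₀ = 0 := by rw [hq]; simp
  have hder := eval_derivative_hasse_ne_zero hpm hroot
  have hqa : q.eval a₀ ≠ 0 := by
    have : (derivative (hasse k m)).eval a₀ = q.eval a₀ := by rw [hq]; simp
    rwa [← this]
  have hga : g.eval a₀ ≠ 0 := by
    simp only [hg, eval_mul, eval_sub, eval_X, eval_one]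
    refine mul_ne_zero (mul_ne_zero (mul_ne_zero ?_ ?_) hder) hqa
    · rintro rfl; exact eval_hasse_zero_ne_zero m hroot
    · intro h
      rw [← sub_eq_zero.mp h] at hroot
      exact eval_hasse_one_ne_zero hpm hroot
  have hdvd : ∀ f : k[X], f ∣ g → IsUnit (aeval l f) := by
    rintro f ⟨e, he⟩
    refine IsUnit.of_mul_eq_one (aeval l e * s) ?_
    rw [← mul_assoc, ← map_mul, ← he, mul_comm, hs]
  have hlu : IsUnit l := by
    have := hdvd X ⟨(1 - X) * derivative (hasse k m) * q, by rw [hg]; ring⟩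
    rwa [aeval_X] at this
  have hlu' : IsUnit (1 - l) := by
    have := hdvd (1 - X) ⟨X * derivative (hasse k m) * q, by rw [hg]; ring⟩
    rwa [map_sub, map_one, aeval_X] at this
  have hinj : Function.Injective (aeval l : k[X] →ₐ[k] A) :=
    transcendental_iff_injective.mp htr
  have hu0 : u ≠ 0 := by
    intro h
    rw [h, zero_pow (by omega)] at hu
    exact hasse_ne_zero m (hinj (by rw [← hu, map_zero]))
  -- If `v` were inverse to `u`, some `g(l) ^ N v` would be integral over `k[l]`. As `k[X]` is
  -- normal, `H` would divide a power of `g`, although `H(a₀) = 0 ≠ g(a₀)`.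
  have hnu : ¬ IsUnit u := by
    intro h
    obtain ⟨v, hv⟩ := h.exists_right_inv
    let _ : Algebra k[X] A := (aeval l : k[X] →ₐ[k] A).toRingHom.toAlgebra
    have hmap : ∀ f : k[X], algebraMap k[X] A f = aeval l f := fun f => rfl
    have key : ∀ a : A, ∃ N : ℕ, IsIntegral k[X] (aeval l g ^ N * a) := by
      intro a
      have hgi : ∀ N : ℕ, IsIntegral k[X] (aeval l g ^ N) := fun N => by
        rw [← map_pow, ← hmap]; exact isIntegral_algebraMap
      have ha : a ∈ Algebra.adjoin k {l, u, s} := hgen ▸ trivial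
      induction ha using Algebra.adjoin_induction with
      | mem x hx =>
        rcases hx with rfl | rfl | rfl
        · refine ⟨0, ?_⟩
          rw [pow_zero, one_mul]
          have := isIntegral_algebraMap (R := k[X]) (A := A) (x := X)
          rwa [hmap, aeval_X] at this
        · refine ⟨0, ?_⟩
          rw [pow_zero, one_mul]
          refine IsIntegral.of_pow (n := 2 * m) (by omega) ?_
          rw [hu, ← hmap]
          exact isIntegral_algebraMap
        · exact ⟨1, by rw [pow_one, mul_comm, hs]; exact isIntegral_one⟩
      | algebraMap r =>
        refine ⟨0, ?_⟩
        have := isIntegral_algebraMap (R := k[X]) (A := A) (x := C r)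
        rwa [hmap, aeval_C, ← one_mul (algebraMap k A r), ← pow_zero (aeval l g)] at this
      | add x y _ _ hx hy =>
        obtain ⟨N, hN⟩ := hx
        obtain ⟨M, hM⟩ := hy
        refine ⟨N + M, ?_⟩
        have : aeval l g ^ (N + M) * (x + y) = aeval l g ^ M * (aeval l g ^ N * x) +
            aeval l g ^ N * (aeval l g ^ M * y) := by ring
        rw [this]
        exact ((hgi M).mul hN).add ((hgi N).mul hM)
      | mul x y _ _ hx hy =>
        obtain ⟨N, hN⟩ := hx
        obtain ⟨M, hM⟩ := hy
        refine ⟨N + M, ?_⟩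
        have : aeval l g ^ (N + M) * (x * y) = (aeval l g ^ N * x) * (aeval l g ^ M * y) := by ring
        rw [this]
        exact hN.mul hM
    obtain ⟨N, hN⟩ := key v
    have h2 := (hN.pow (2 * m)).algebraMap (B := FractionRing A)
    have hinj' : Function.Injective (algebraMap k[X] (FractionRing A)) := by
      rw [IsScalarTower.algebraMap_eq k[X] A (FractionRing A)]
      exact (IsFractionRing.injective A _).comp hinj
    have h3 : hasse k m ∣ (g ^ N) ^ (2 * m) := by
      refine dvd_of_isIntegral hinj' (hasse_ne_zero m) ?_ h2
      rw [IsScalarTower.algebraMap_apply k[X] A (FractionRing A),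
        IsScalarTower.algebraMap_apply k[X] A (FractionRing A), hmap, hmap, ← map_mul, ← hu,
        mul_pow, mul_assoc, ← mul_pow, mul_comm v, hv, one_pow, mul_one]
      simp only [map_pow]
    obtain ⟨e, he⟩ := h3
    have h4 := congrArg (eval a₀) he
    rw [eval_mul, hroot, zero_mul, eval_pow, eval_pow] at h4
    exact pow_ne_zero _ (pow_ne_zero _ hga) h4
  -- The quotient by `u` consists of constants, since `(l - a₀) q(l) = u ^ (2m)` with `q(l)` a unit.
  -- Primality of `u` follows.
  have hconst : ∀ a : A, ∃ c : k, u ∣ a - algebraMap k A c := by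
    intro a
    have h1 : l - algebraMap k A a₀ ∈ Ideal.span {u} := by
      obtain ⟨e, he⟩ := (hdvd q ⟨X * (1 - X) * derivative (hasse k m), by rw [hg]; ring⟩).exists_right_inv
      have h2 : u ^ (2 * m) = (l - algebraMap k A a₀) * aeval l q := by
        rw [hu, hq]; simp
      refine Ideal.mem_span_singleton.mpr ⟨u ^ (2 * m - 1) * e, ?_⟩
      rw [← mul_assoc, ← pow_succ', show 2 * m - 1 + 1 = 2 * m by omega, h2, mul_assoc, he, mul_one]
    obtain ⟨c, hc⟩ := exists_sub_algebraMap_mem hgen hs (Ideal.span {u}) (α := a₀) (β := 0) h1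
      (by simp) hga a
    exact ⟨c, Ideal.mem_span_singleton.mp hc⟩
  have hprime : Prime u := by
    refine ⟨hu0, hnu, fun a b hab => ?_⟩
    obtain ⟨c, hc⟩ := hconst a
    obtain ⟨d, hd⟩ := hconst b
    have h1 : u ∣ algebraMap k A (c * d) := by
      have : algebraMap k A (c * d) = a * b - (b * (a - algebraMap k A c) +
          algebraMap k A c * (b - algebraMap k A d)) := by rw [map_mul]; ring
      rw [this]
      exact dvd_sub hab (dvd_add (hc.mul_left _) (hd.mul_left _))
    have h2 : c * d = 0 := by
      by_contra h
      exact hnu (isUnit_of_dvd_unit h1 ((Ne.isUnit h).map _))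
    rcases mul_eq_zero.mp h2 with h | h
    · left; simpa [h] using hc
    · right; simpa [h] using hd
  have hprinc : ∀ (M : Ideal A) [M.IsMaximal],
      (IsLocalRing.maximalIdeal (Localization.AtPrime M)).IsPrincipal := fun M _ =>
    maximalIdeal_isPrincipal hgen hs ⟨X * (1 - X) * q, by rw [hg]; ring⟩ hu M
  refine ⟨inferInstance, hft, ?_, ?_, ?_, hprime, hlu, hlu', hu, ?_⟩
  · refine IsIntegrallyClosed.of_localization_maximal fun M _ hM => ?_
    have h1 := hprinc M
    have : IsDomain (Localization.AtPrime M) :=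
      IsLocalization.isDomain_localization M.primeCompl_le_nonZeroDivisors
    have h2 := ((tfae_of_isNoetherianRing_of_isLocalRing_of_isDomain
      (Localization.AtPrime M)).out 4 3).mp h1
    exact h2.1
  · refine le_antisymm ?_ ?_
    · rw [ringKrullDim_le_iff_isMaximal_height_le]
      intro M hM
      have h1 := hprinc M
      have h2 : (IsLocalRing.maximalIdeal (Localization.AtPrime M)).height ≤ 1 :=
        Ideal.height_le_one_of_isPrincipal_of_mem_minimalPrimes
          (IsLocalRing.maximalIdeal (Localization.AtPrime M)) _ (by
            rw [Ideal.minimalPrimes_eq_subsingleton_self]; rfl)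
      rw [← IsLocalization.AtPrime.ringKrullDim_eq_height M (Localization.AtPrime M),
        ← IsLocalRing.maximalIdeal_height_eq_ringKrullDim]
      exact_mod_cast h2
    · have hp : (Ideal.span {u}).IsPrime := (Ideal.span_singleton_prime hu0).mpr hprime
      have h1 : (Ideal.span {u}).height ≠ 0 := by
        rw [Ne, Ideal.height_eq_zero_iff_eq_bot, Ideal.span_singleton_eq_bot]
        exact hu0
      have h2 : (1 : ℕ∞) ≤ (Ideal.span {u}).height := Order.one_le_iff_ne_zero.mpr h1
      refine le_trans ?_ (Ideal.height_le_ringKrullDim_of_ne_top hp.ne_top)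
      exact_mod_cast h2
  · have h := AlgebraicIndependent.lift_cardinalMk_le_trdeg
      ((algebraicIndependent_unique_type_iff (x := fun _ : Unit => l)).mpr htr)
    simpa using h
  · intro a
    have ha : a ∈ Algebra.adjoin k {l, u, s} := hgen ▸ trivial
    set N := Submodule.span A {KaehlerDifferential.D k A u}
    have hu' : KaehlerDifferential.D k A u ∈ N := Submodule.mem_span_singleton_self _
    -- Differentiate `u ^ (2m) = H(l)`, where `H'(l)` is a unit.
    have hl' : KaehlerDifferential.D k A l ∈ N := by
      obtain ⟨e, he⟩ := (hdvd (derivative (hasse k m)) ⟨X * (1 - X) * q, by rw [hg]; ring⟩).exists_left_inv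
      have h1 : KaehlerDifferential.D k A (aeval l (hasse k m)) =
          aeval l (derivative (hasse k m)) • KaehlerDifferential.D k A l := by
        rw [Derivation.map_aeval]
      rw [← hu, Derivation.leibniz_pow] at h1
      have h2 : KaehlerDifferential.D k A l = e • (aeval l (derivative (hasse k m)) • KaehlerDifferential.D k A l) := by
        rw [smul_smul, he, one_smul]
      rw [h2, ← h1]
      exact N.smul_mem _ (nsmul_mem (N.smul_mem _ hu') _)
    induction ha using Algebra.adjoin_induction with
    | mem x hx =>
      rcases hx with rfl | rfl | rfl
      · exact hl'
      · exact hu'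
      · have h1 := congrArg (KaehlerDifferential.D k A) hs
        rw [Derivation.leibniz, Derivation.map_one_eq_zero, Derivation.map_aeval] at h1
        have h2 : KaehlerDifferential.D k A x = (x * aeval l g) • KaehlerDifferential.D k A x := by
          rw [hs, one_smul]
        rw [h2, mul_smul, eq_neg_of_add_eq_zero_right h1]
        exact N.smul_mem _ (neg_mem (N.smul_mem _ (N.smul_mem _ hl')))
    | algebraMap r => rw [Derivation.map_algebraMap]; exact zero_mem _
    | add x y _ _ hx hy => rw [map_add]; exact add_mem hx hy
    | mul x y _ _ hx hy =>
      rw [Derivation.leibniz]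
      exact add_mem (N.smul_mem _ hy) (N.smul_mem _ hx)

end

theorem exists_isHasseBase (k : Type u) [Field k] [IsAlgClosed k] {p m : ℕ} [CharP k p]
    [Fact p.Prime] (hpm : p = 2 * m + 1) :
    ∃ (A : Type u) (_ : CommRing A) (_ : Algebra k A) (l u : A), IsHasseBase k m l u := by
  have hm : m ≠ 0 := by
    rintro rfl
    exact (Fact.out : p.Prime).ne_one (by omega)
  obtain ⟨a₀, ha₀⟩ := IsAlgClosed.exists_root (hasse k m) (by
    intro h
    rw [degree_eq_natDegree (hasse_ne_zero m), natDegree_hasse] at h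
    exact hm (by exact_mod_cast h))
  obtain ⟨q, hq⟩ := dvd_iff_isRoot.mpr ha₀
  -- Inside a field `A` is automatically a domain: no irreducibility of `u ^ (2m) = H(l)` has to be
  -- shown.
  let K := AlgebraicClosure (RatFunc k)
  let l : K := algebraMap (RatFunc k) K RatFunc.X
  have htr : Transcendental k l :=
    (transcendental_algebraMap_iff (FaithfulSMul.algebraMap_injective _ _)).mpr RatFunc.transcendental_X
  obtain ⟨u, hu⟩ := IsAlgClosed.exists_pow_nat_eq (aeval l (hasse k m)) (n := 2 * m) (by omega)
  set g := X * (1 - X) * derivative (hasse k m) * q with hg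
  have hg0 : g ≠ 0 := by
    refine mul_ne_zero (mul_ne_zero (mul_ne_zero X_ne_zero ?_) ?_) ?_
    · intro h
      have := congrArg (eval 0) h
      simp at this
    · intro h
      apply eval_derivative_hasse_ne_zero hpm ha₀
      rw [h, eval_zero]
    · rintro rfl
      exact hasse_ne_zero m (by rw [hq, mul_zero])
  have hgl : aeval l g ≠ 0 := fun h =>
    hg0 (transcendental_iff_injective.mp htr (by rw [h, map_zero]))
  let s := (aeval l g)⁻¹
  let A := Algebra.adjoin k ({l, u, s} : Set K)
  have hlA : l ∈ A := Algebra.subset_adjoin (by simp)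
  have huA : u ∈ A := Algebra.subset_adjoin (by simp)
  have hsA : s ∈ A := Algebra.subset_adjoin (by simp)
  have haev : ∀ f : k[X], ((aeval (⟨l, hlA⟩ : A) f : A) : K) = aeval l f := fun f =>
    (aeval_algHom_apply A.val (⟨l, hlA⟩ : A) f).symm
  refine ⟨A, inferInstance, inferInstance, ⟨l, hlA⟩, ⟨u, huA⟩,
    isHasseBase_of_adjoin (s := ⟨s, hsA⟩) hpm ?_ ?_ hq ?_ ?_⟩
  · exact fun h => htr (h.algebraMap (A := K))
  · apply Subtype.ext
    rw [haev]
    exact hu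
  · apply Subtype.ext
    rw [MulMemClass.coe_mul, haev]
    exact inv_mul_cancel₀ hgl
  · have h := Algebra.adjoin_adjoin_coe_preimage (R := k) (s := ({l, u, s} : Set K))
    rw [← h]
    congr 1
    ext x
    simp [Subtype.ext_iff]

/-! ### Quadratic extensions `Y² = f` of a polynomial ring -/

section
variable {P : Type*} [CommRing P]

/-- The degrees of the two sides have different parity. -/
theorem eq_zero_of_sq_eq_mul_sq [IsDomain P] {f a b : P[X]} (hf : Odd f.natDegree)
    (h : a ^ 2 = f * b ^ 2) : a = 0 ∧ b = 0 := by
  have hf0 : f ≠ 0 := by rintro rfl; simp at hf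
  by_cases hb : b = 0
  · subst hb
    refine ⟨?_, rfl⟩
    simpa using h
  · exfalso
    have h1 := congrArg natDegree h
    rw [natDegree_pow, natDegree_mul hf0 (pow_ne_zero _ hb), natDegree_pow] at h1
    obtain ⟨c, hc⟩ := hf
    omega

variable {f : P[X]}

theorem isDomain_quadraticAlgebra [IsDomain P] (hf : Odd f.natDegree) :
    IsDomain (QuadraticAlgebra P[X] f 0) := by
  have key : ∀ z : QuadraticAlgebra P[X] f 0, z.norm = 0 → z = 0 := by
    intro z hz
    rw [QuadraticAlgebra.norm_def] at hz
    obtain ⟨h1, h2⟩ := eq_zero_of_sq_eq_mul_sq (a := z.re) (b := z.im) hf (by linear_combination hz)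
    exact QuadraticAlgebra.ext h1 h2
  have : NoZeroDivisors (QuadraticAlgebra P[X] f 0) := ⟨fun {z w} h => by
    have h1 := congrArg QuadraticAlgebra.norm h
    rw [map_mul, QuadraticAlgebra.norm_zero] at h1
    rcases mul_eq_zero.mp h1 with h2 | h2
    · exact Or.inl (key z h2)
    · exact Or.inr (key w h2)⟩
  exact NoZeroDivisors.to_isDomain _

/-- Reduce modulo `π`: if `π` divides the norm of `z`, then `re² = f im²` over the domain `P / π`,
and the parity of degrees forces `π ∣ z`. Multiplicativity of the norm does the rest. It gives the
primality of `u` and `z` on the cone. -/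
theorem prime_algebraMap_C [IsDomain P] (hf : f.Monic) (hf' : Odd f.natDegree) {π : P}
    (hπ : Prime π) : Prime (algebraMap P[X] (QuadraticAlgebra P[X] f 0) (C π)) := by
  have hI : (Ideal.span {π}).IsPrime := (Ideal.span_singleton_prime hπ.ne_zero).mpr hπ
  have hmap : ∀ g : P[X], g.map (Ideal.Quotient.mk (Ideal.span {π})) = 0 ↔ C π ∣ g := by
    intro g
    rw [C_dvd_iff_dvd_coeff, Polynomial.ext_iff]
    simp only [coeff_map, coeff_zero, Ideal.Quotient.eq_zero_iff_mem, Ideal.mem_span_singleton]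
  have key : ∀ z : QuadraticAlgebra P[X] f 0, C π ∣ z.norm →
      algebraMap P[X] (QuadraticAlgebra P[X] f 0) (C π) ∣ z := by
    intro z hz
    rw [QuadraticAlgebra.norm_def, ← hmap] at hz
    rw [QuadraticAlgebra.algebraMap_dvd_iff, ← hmap, ← hmap]
    refine eq_zero_of_sq_eq_mul_sq (f := f.map (Ideal.Quotient.mk (Ideal.span {π}))) ?_ ?_
    · rwa [hf.natDegree_map]
    · simp only [Polynomial.map_sub, Polynomial.map_add, Polynomial.map_mul] at hz
      rw [Polynomial.map_zero] at hz
      linear_combination hz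
  refine ⟨?_, ?_, fun z w h => ?_⟩
  · rw [map_ne_zero_iff _ QuadraticAlgebra.algebraMap_injective]
    exact C_ne_zero.mpr hπ.ne_zero
  · intro h
    have := QuadraticAlgebra.isUnit_iff_norm_isUnit.mp h
    rw [QuadraticAlgebra.norm_algebraMap, isUnit_pow_iff two_ne_zero, isUnit_C] at this
    exact hπ.not_isUnit this
  · have h1 := (QuadraticAlgebra.algebraMap_dvd_iff.mp h)
    have h2 : C π ∣ (z * w).norm := by
      rw [QuadraticAlgebra.norm_def]
      obtain ⟨⟨a, ha⟩, ⟨b, hb⟩⟩ := h1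
      exact ⟨a * (z * w).re + 0 * a * (z * w).im - f * (b * (z * w).im), by rw [ha, hb]; ring⟩
    rw [map_mul] at h2
    rcases (prime_C_iff.mpr hπ).dvd_or_dvd h2 with h3 | h3
    · exact Or.inl (key z h3)
    · exact Or.inr (key w h3)

/-- The conjugation of a quadratic algebra. -/
def conj {R : Type*} [CommRing R] (a : R) : QuadraticAlgebra R a 0 ≃ₐ[R] QuadraticAlgebra R a 0 where
  toFun z := ⟨z.re, -z.im⟩
  invFun z := ⟨z.re, -z.im⟩
  left_inv z := by simp
  right_inv z := by simp
  map_mul' z w := by ext1 <;> simp; ring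
  map_add' z w := by ext1 <;> simp; ring
  commutes' r := by ext1 <;> simp

theorem conj_apply {R : Type*} [CommRing R] (a : R) (z : QuadraticAlgebra R a 0) :
    conj a z = ⟨z.re, -z.im⟩ := rfl

theorem mul_conj {R : Type*} [CommRing R] (a : R) (z : QuadraticAlgebra R a 0) :
    z * conj a z = algebraMap R _ z.norm := by
  rw [conj_apply]
  ext1
  · simp [QuadraticAlgebra.norm_def]; ring
  · simp; ring

theorem dvd_of_eval_eq_zero [IsDomain P] {α β : P} (hα : α ≠ 0) (hβ : β ≠ 0) (hαβ : α ≠ β)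
    (hf : f = X * (X - C α) * (X - C β)) {e : P[X]} (hr : ∀ c : P, f.eval c = 0 → e.eval c = 0) :
    f ∣ e := by
  obtain ⟨e₁, rfl⟩ : X ∣ e := by
    rw [← sub_zero (X : P[X]), ← C_0, dvd_iff_isRoot]
    exact hr 0 (by rw [hf]; simp)
  obtain ⟨e₂, rfl⟩ : X - C α ∣ e₁ := by
    rw [dvd_iff_isRoot]
    have := hr α (by rw [hf]; simp)
    rw [eval_mul, eval_X] at this
    exact (mul_eq_zero.mp this).resolve_left hα
  obtain ⟨e₃, rfl⟩ : X - C β ∣ e₂ := by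
    rw [dvd_iff_isRoot]
    have := hr β (by rw [hf]; simp)
    rw [eval_mul, eval_X, eval_mul] at this
    exact (mul_eq_zero.mp ((mul_eq_zero.mp this).resolve_left hβ)).resolve_left
      (by simpa [sub_eq_zero] using hαβ.symm)
  exact ⟨e₃, by rw [hf]; ring⟩

/-- The affine model of an elliptic curve is normal. -/
theorem isIntegrallyClosed_quadraticAlgebra [IsDomain P] [IsIntegrallyClosed P]
    (h2 : IsUnit (2 : P)) {α β : P} (hα : α ≠ 0) (hβ : β ≠ 0) (hαβ : α ≠ β)
    (hf : f = X * (X - C α) * (X - C β)) : IsIntegrallyClosed (QuadraticAlgebra P[X] f 0) := by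
  have hdeg : f.natDegree = 3 := by
    rw [hf, natDegree_mul (mul_ne_zero X_ne_zero (X_sub_C_ne_zero _)) (X_sub_C_ne_zero _),
      natDegree_mul X_ne_zero (X_sub_C_ne_zero _)]
    simp
  have hdom : IsDomain (QuadraticAlgebra P[X] f 0) :=
    isDomain_quadraticAlgebra (by rw [hdeg]; decide)
  have hf0 : f ≠ 0 := by rintro rfl; simp at hdeg
  have hsqf : ∀ e n : P[X], e ^ 2 = f * n → f ∣ e := by
    intro e n h
    refine dvd_of_eval_eq_zero hα hβ hαβ hf fun c hc => ?_
    have := congrArg (eval c) h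
    rw [eval_mul, hc, zero_mul, eval_pow] at this
    exact pow_eq_zero_iff two_ne_zero |>.mp this
  let K := FractionRing (QuadraticAlgebra P[X] f 0)
  have hinjQ : Function.Injective (algebraMap (QuadraticAlgebra P[X] f 0) K) :=
    IsFractionRing.injective _ K
  have hinj : Function.Injective (algebraMap P[X] K) := by
    rw [IsScalarTower.algebraMap_eq P[X] (QuadraticAlgebra P[X] f 0) K]
    exact hinjQ.comp QuadraticAlgebra.algebraMap_injective
  let τ : K ≃ₐ[P[X]] K := IsFractionRing.algEquivOfAlgEquiv (conj f)
  have hτ : ∀ z, τ (algebraMap (QuadraticAlgebra P[X] f 0) K z) = algebraMap _ K (conj f z) :=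
    fun z => IsFractionRing.algEquivOfAlgEquiv_algebraMap (conj f) z
  have htow : ∀ g : P[X], algebraMap P[X] K g =
      algebraMap (QuadraticAlgebra P[X] f 0) K (algebraMap P[X] _ g) := fun g =>
    IsScalarTower.algebraMap_apply _ _ _ g
  rw [isIntegrallyClosed_iff K]
  intro w hw
  have hwP : _root_.IsIntegral P[X] w := by
    have : Algebra.IsIntegral P[X] (QuadraticAlgebra P[X] f 0) := inferInstance
    exact isIntegral_trans w hw
  obtain ⟨a, b, d, hd, hwd⟩ : ∃ a b d : P[X], d ≠ 0 ∧ w * algebraMap P[X] K d =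
      algebraMap (QuadraticAlgebra P[X] f 0) K ⟨a, b⟩ := by
    obtain ⟨z, y, hy, rfl⟩ := IsFractionRing.div_surjective (A := QuadraticAlgebra P[X] f 0) w
    have hy0 : y ≠ 0 := nonZeroDivisors.ne_zero hy
    have hy' : algebraMap (QuadraticAlgebra P[X] f 0) K y ≠ 0 := (map_ne_zero_iff _ hinjQ).mpr hy0
    refine ⟨(z * conj f y).re, (z * conj f y).im, y.norm, ?_, ?_⟩
    · intro h
      have h1 := mul_conj f y
      rw [h, map_zero] at h1
      have h2 := (mul_eq_zero.mp h1).resolve_left hy0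
      exact hy0 ((map_eq_zero_iff _ (conj f).injective).mp h2)
    · rw [htow, ← mul_conj, QuadraticAlgebra.mk_eta, map_mul, map_mul, ← mul_assoc,
        div_mul_cancel₀ _ hy']
  have hd' : algebraMap P[X] K d ≠ 0 := (map_ne_zero_iff _ hinj).mpr hd
  -- The trace `2a / d` of `w = (a + b Y) / d` is integral over `P[X]`, and `2` is a unit.
  obtain ⟨a₀, rfl⟩ : d ∣ a := by
    have h1 : d ∣ C 2 * a := by
      refine dvd_of_isIntegral hinj hd (w := w + τ w) ?_ (hwP.add (hwP.map τ.toAlgHom))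
      have h3 : τ w * algebraMap P[X] K d =
          algebraMap (QuadraticAlgebra P[X] f 0) K ⟨a, -b⟩ := by
        rw [← τ.commutes d, ← map_mul, hwd, hτ, conj_apply]
      rw [add_mul, hwd, h3, ← map_add, htow]
      congr 1
      ext1 <;> simp [two_mul, map_ofNat]
    exact ((isUnit_C.mpr h2).dvd_mul_left).mp h1
  set w₀ := w - algebraMap P[X] K a₀ with hw₀
  have hw₀i : _root_.IsIntegral P[X] w₀ := hwP.sub isIntegral_algebraMap
  have hw₀d : w₀ * algebraMap P[X] K d = algebraMap (QuadraticAlgebra P[X] f 0) K ⟨0, b⟩ := by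
    rw [hw₀, sub_mul, hwd, ← map_mul, htow, ← map_sub]
    congr 1
    ext1 <;> simp [mul_comm]
  -- What remains is `w₀ = (b / d) Y`; both `w₀²` and `Y w₀` are integral elements of the fraction
  -- field of `P[X]`.
  obtain ⟨n, hn⟩ : d ^ 2 ∣ b ^ 2 * f := by
    refine dvd_of_isIntegral hinj (pow_ne_zero 2 hd) (w := w₀ ^ 2) ?_ (hw₀i.pow 2)
    rw [map_pow, ← mul_pow, hw₀d, ← map_pow, htow]
    congr 1
    ext1 <;> simp [pow_two]
    ring
  obtain ⟨e, he⟩ : d ∣ f * b := by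
    refine dvd_of_isIntegral hinj hd
      (w := algebraMap (QuadraticAlgebra P[X] f 0) K ⟨0, 1⟩ * w₀) ?_ ?_
    · rw [mul_assoc, hw₀d, ← map_mul, htow]
      congr 1
      ext1 <;> simp
    · refine IsIntegral.mul ?_ hw₀i
      have : _root_.IsIntegral P[X] (⟨0, 1⟩ : QuadraticAlgebra P[X] f 0) :=
        Algebra.IsIntegral.isIntegral _
      exact this.algebraMap
  -- From `f b = d e` and `b² f = d² n` one gets `e² = f n`, and the roots of `f` are distinct.
  obtain ⟨e', rfl⟩ : f ∣ e := by
    refine hsqf e n (mul_left_cancel₀ (pow_ne_zero 2 hd) ?_)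
    calc d ^ 2 * e ^ 2 = (d * e) ^ 2 := by ring
      _ = f * (b ^ 2 * f) := by rw [← he]; ring
      _ = _ := by rw [hn]; ring
  have hb : b = d * e' := mul_left_cancel₀ hf0 (by rw [he]; ring)
  refine ⟨⟨a₀, e'⟩, mul_right_cancel₀ hd' ?_⟩
  rw [hwd, htow, ← map_mul, hb]
  congr 1
  ext1 <;> simp [mul_comm]

end

/-! ### Derivations in characteristic `p` -/

/-- The extension of a derivation `d` of `S` to `S[X]` with `X ↦ c X`. -/
def extDer {k S : Type*} [CommRing k] [CommRing S] [Algebra k S] (d : Derivation k S S) (c : S) :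
    Derivation k S[X] S[X] :=
  (PolynomialModule.equivPolynomialSelf (R := S)).toLinearMap.compDer d.mapCoeffs +
    (C c * X) • (derivative' (R := S)).restrictScalars k

theorem coeff_extDer {k S : Type*} [CommRing k] [CommRing S] [Algebra k S] (d : Derivation k S S)
    (c : S) (f : S[X]) (n : ℕ) : (extDer d c f).coeff n = d (f.coeff n) + n * c * f.coeff n := by
  have h : extDer d c f = PolynomialModule.equivPolynomialSelf (d.mapCoeffs f) +
    (C c * X) * derivative f := rfl
  rw [h, coeff_add, mul_assoc, coeff_C_mul]
  congr 1
  cases n with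
  | zero => simp
  | succ n => rw [coeff_X_mul, coeff_derivative]; push_cast; ring

section
variable {k C : Type*} [CommRing k] [CommRing C] [Algebra k C] (δ : Derivation k C C)

theorem iterate_derivation_mul (n : ℕ) (a b : C) : δ^[n] (a * b) =
    ∑ ij ∈ Finset.HasAntidiagonal.antidiagonal n, n.choose ij.1 • (δ^[ij.1] a * δ^[ij.2] b) := by
  induction n with
  | zero => simp
  | succ n ih =>
    rw [Finset.sum_antidiagonal_choose_succ_nsmul
      (M := C) (fun i j => δ^[i] a * δ^[j] b) n]
    simp only [Function.iterate_succ_apply', ih, map_sum, map_nsmul, Derivation.leibniz,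
      smul_eq_mul, nsmul_add, Finset.sum_add_distrib]
    congr 1
    refine Finset.sum_congr rfl fun ij hij => ?_
    have : ij.1 ≤ n := by have := Finset.HasAntidiagonal.mem_antidiagonal.mp hij; omega
    rw [mul_comm, ← Nat.choose_symm this, show n - ij.1 = ij.2 by
      have := Finset.HasAntidiagonal.mem_antidiagonal.mp hij; omega]

/-- In characteristic `p`, the `p`-th power of a derivation is a derivation. -/
def derivationPow (p : ℕ) [Fact p.Prime] [CharP C p] : Derivation k C C :=
  Derivation.mk' ((δ : Module.End k C) ^ p) fun a b => by
    have hp : p ≠ 0 := (Fact.out : p.Prime).ne_zero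
    simp only [Module.End.pow_apply, Derivation.coeFn_coe]
    rw [iterate_derivation_mul, Finset.Nat.sum_antidiagonal_eq_sum_range_succ_mk,
      Finset.sum_range_succ, Finset.sum_range_eq_add_Ico _ (Nat.pos_of_ne_zero hp),
      Finset.sum_eq_zero]
    · simp [mul_comm]
    · intro i hi
      rw [Finset.mem_Ico] at hi
      rw [← Nat.cast_smul_eq_nsmul C, (CharP.cast_eq_zero_iff C p _).mpr, zero_smul]
      exact (Fact.out : p.Prime).dvd_choose_self (by omega) (by omega)

theorem derivationPow_apply (p : ℕ) [Fact p.Prime] [CharP C p] (a : C) :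
    derivationPow δ p a = δ^[p] a := by
  simp [derivationPow, Module.End.pow_apply]
end

/-! ### The invariant vector field and the Hasse invariant -/

section
variable {P : Type*} [CommRing P] (f : P[X])

/-- The invariant vector field on the family of elliptic curves `Y² = f(x)`. -/
def ellipticDer : Derivation P (QuadraticAlgebra P[X] f 0) (QuadraticAlgebra P[X] f 0) :=
  Derivation.mk'
    { toFun := fun g => ⟨2 * derivative g.im * f + g.im * derivative f, 2 * derivative g.re⟩
      map_add' := fun g h => by ext1 <;> simp <;> ring
      map_smul' := fun c g => by ext1 <;> simp [smul_eq_C_mul] <;> ring }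
    fun g h => by
      ext1 <;> simp [derivative_mul] <;> ring

theorem ellipticDer_apply (g : QuadraticAlgebra P[X] f 0) : ellipticDer f g =
    ⟨2 * derivative g.im * f + g.im * derivative f, 2 * derivative g.re⟩ := rfl

/-- The square of the invariant vector field on functions of `x`. -/
def ellipticOp (g : P[X]) : P[X] :=
  4 * derivative (derivative g) * f + 2 * derivative g * derivative f

theorem ellipticDer_algebraMap (g : P[X]) :
    ellipticDer f (algebraMap _ _ g) = ⟨0, 2 * derivative g⟩ := by
  rw [ellipticDer_apply]
  ext1 <;> simp

theorem ellipticDer_iterate (n : ℕ) (g : P[X]) :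
    (ellipticDer f)^[2 * n] (algebraMap _ _ g) = algebraMap _ _ ((ellipticOp f)^[n] g) := by
  induction n with
  | zero => rfl
  | succ n ih =>
    rw [show 2 * (n + 1) = 2 * n + 1 + 1 by ring, Function.iterate_succ_apply',
      Function.iterate_succ_apply', ih, Function.iterate_succ_apply', ellipticDer_algebraMap,
      ellipticDer_apply]
    ext1 <;> simp [ellipticOp, derivative_mul] <;> ring

variable {f}

theorem natDegree_ellipticOp_le (hf : f.natDegree ≤ 3) {n : ℕ} {g : P[X]} (hg : g.natDegree ≤ n) :
    (ellipticOp f g).natDegree ≤ n + 1 := by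
  have h1 : (derivative g).natDegree ≤ n - 1 := (natDegree_derivative_le g).trans (by omega)
  have h2 : (derivative (derivative g)).natDegree ≤ n - 1 - 1 :=
    (natDegree_derivative_le _).trans (by omega)
  have h3 : (derivative f).natDegree ≤ 2 := (natDegree_derivative_le f).trans (by omega)
  rcases n with _ | _ | n
  · have : derivative g = 0 := by
      rw [eq_C_of_natDegree_eq_zero (Nat.le_zero.mp hg), derivative_C]
    simp [ellipticOp, this]
  · have : derivative (derivative g) = 0 := by
      rw [eq_C_of_natDegree_eq_zero (Nat.le_zero.mp h1), derivative_C]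
    rw [ellipticOp, this, mul_zero, zero_mul, zero_add]
    refine (natDegree_mul_le_of_le (m := 0) (n := 2) ?_ h3)
    exact natDegree_mul_le_of_le (m := 0) (n := 0) (natDegree_ofNat 2).le h1
  · refine natDegree_add_le_of_le (natDegree_mul_le_of_le (m := n) (n := 3) ?_ hf)
      (natDegree_mul_le_of_le (m := n + 1) (n := 2) ?_ h3) |>.trans (by simp)
    · exact (natDegree_mul_le_of_le (m := 0) (n := n) (natDegree_ofNat 4).le (by omega)).trans (by omega)
    · exact (natDegree_mul_le_of_le (m := 0) (n := n + 1) (natDegree_ofNat 2).le (by omega)).trans (by omega)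

theorem natDegree_ellipticOp_iterate_le (hf : f.natDegree ≤ 3) {n : ℕ} {g : P[X]}
    (hg : g.natDegree ≤ n) (j : ℕ) : ((ellipticOp f)^[j] g).natDegree ≤ n + j := by
  induction j with
  | zero => exact hg
  | succ j ih =>
    rw [Function.iterate_succ_apply']
    exact natDegree_ellipticOp_le hf ih

end

section
variable {P : Type*} [CommRing P] {f q : P[X]}

theorem coeff_ellipticOp_of_X_pow_dvd (hf : f = X * q) {g : P[X]} {n : ℕ} (hg : X ^ (n + 1) ∣ g) :
    X ^ n ∣ ellipticOp f g ∧ (ellipticOp f g).coeff n =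
      2 * (n + 1) * (2 * n + 1) * q.coeff 0 * g.coeff (n + 1) := by
  have e : ellipticOp f g = (4 * (X * derivative (derivative g)) + 2 * derivative g) * q +
      2 * (X * derivative g) * derivative q := by
    rw [ellipticOp, hf, derivative_mul, derivative_X]; ring
  rw [X_pow_dvd_iff] at hg
  have c1 : ∀ i, (4 * (X * derivative (derivative g)) + 2 * derivative g).coeff i =
      2 * (i + 1) * (2 * i + 1) * g.coeff (i + 1) := by
    intro i
    rw [coeff_add, coeff_ofNat_mul, coeff_ofNat_mul]
    cases i with
    | zero => simp [coeff_derivative]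
    | succ i => rw [coeff_X_mul, coeff_derivative, coeff_derivative]; push_cast; ring
  have c2 : ∀ i, (X * derivative g).coeff i = i * g.coeff i := by
    intro i
    cases i with
    | zero => simp
    | succ i => rw [coeff_X_mul, coeff_derivative]; push_cast; ring
  obtain ⟨r, hr⟩ : X ^ n ∣ 4 * (X * derivative (derivative g)) + 2 * derivative g := by
    rw [X_pow_dvd_iff]
    intro d hd
    rw [c1, hg _ (by omega), mul_zero]
  obtain ⟨s, hs⟩ : X ^ (n + 1) ∣ X * derivative g := by
    rw [X_pow_dvd_iff]
    intro d hd
    rw [c2, hg _ hd, mul_zero]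
  have hr0 : r.coeff 0 = 2 * (n + 1) * (2 * n + 1) * g.coeff (n + 1) := by
    rw [← c1, hr, coeff_X_pow_mul', if_pos le_rfl, Nat.sub_self]
  have e2 : ellipticOp f g = X ^ n * (r * q + X * (2 * s * derivative q)) := by
    rw [e, hr, hs]; ring
  refine ⟨⟨_, e2⟩, ?_⟩
  rw [e2, coeff_X_pow_mul', if_pos le_rfl, Nat.sub_self, coeff_add, mul_coeff_zero, hr0]
  simp
  ring

/-- Each application lowers the lowest exponent `n` by one and multiplies its coefficient by `2n (2n
- 1) q(0)`; these factors multiply to `(2m)! q(0) ^ m`. -/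
theorem coeff_zero_ellipticOp_iterate (hf : f = X * q) (m : ℕ) :
    ((ellipticOp f)^[m] (X ^ m)).coeff 0 = (2 * m).factorial * q.coeff 0 ^ m := by
  have key : ∀ j n, n + j = m → X ^ n ∣ (ellipticOp f)^[j] (X ^ m) ∧
      ((ellipticOp f)^[j] (X ^ m)).coeff n * (2 * n).factorial =
        (2 * m).factorial * q.coeff 0 ^ j := by
    intro j
    induction j with
    | zero =>
      rintro n rfl
      simp
    | succ j ih =>
      intro n hn
      obtain ⟨h1, h2⟩ := ih (n + 1) (by omega)
      obtain ⟨h3, h4⟩ := coeff_ellipticOp_of_X_pow_dvd hf h1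
      rw [Function.iterate_succ_apply']
      refine ⟨h3, ?_⟩
      rw [h4, pow_succ, ← mul_assoc, ← h2, show 2 * (n + 1) = 2 * n + 1 + 1 by ring,
        Nat.factorial_succ, Nat.factorial_succ]
      push_cast
      ring
  simpa using (key m 0 (by omega)).2

theorem coeff_ellipticOp_of_natDegree_le (hf : f.natDegree ≤ 3) {g : P[X]} {n : ℕ}
    (hg : g.natDegree ≤ n + 2) : (ellipticOp f g).coeff (n + 3) =
      2 * (n + 2) * (2 * (n + 2) + 1) * f.coeff 3 * g.coeff (n + 2) := by
  have h1 : (derivative g).natDegree ≤ n + 1 := (natDegree_derivative_le g).trans (by omega)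
  have h2 : (derivative (derivative g)).natDegree ≤ n :=
    (natDegree_derivative_le _).trans (by omega)
  have h3 : (derivative f).natDegree ≤ 2 := (natDegree_derivative_le f).trans (by omega)
  rw [ellipticOp, coeff_add, mul_assoc, mul_assoc, coeff_ofNat_mul, coeff_ofNat_mul,
    coeff_mul_add_eq_of_natDegree_le h2 hf, show n + 3 = n + 1 + 2 by ring,
    coeff_mul_add_eq_of_natDegree_le h1 h3, coeff_derivative, coeff_derivative, coeff_derivative]
  push_cast
  ring

variable {p m : ℕ}

/-- Each application raises the top exponent `i` by one and multiplies its coefficient by `2i (2i +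
1)`. Starting at `m + 1`, the factors `2i + 1` stay strictly between `p` and `2p`. This keeps the
standard eigenvector away from multiples of `u` and of `z`. -/
theorem coeff_ellipticOp_iterate [Fact p.Prime] (hpm : p = 2 * m + 1) (hf : f.natDegree ≤ 3) (hf3 : f.coeff 3 = 1) :
    ∃ N : ℕ, ¬ p ∣ N ∧ ((ellipticOp f)^[m] (X ^ (m + 1))).coeff p = N := by
  have hp : p.Prime := Fact.out
  have hm : m ≠ 0 := by rintro rfl; exact hp.ne_one (by omega)
  obtain ⟨m, rfl⟩ := Nat.exists_eq_succ_of_ne_zero hm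
  have key : ∀ j ≤ m + 1, ∃ N : ℕ, ¬ p ∣ N ∧
      ((ellipticOp f)^[j] (X ^ (m + 2) : P[X])).coeff (m + 2 + j) = N := by
    intro j hj
    induction j with
    | zero => exact ⟨1, hp.not_dvd_one, by simp⟩
    | succ j ih =>
      obtain ⟨N, hN, h⟩ := ih (by omega)
      refine ⟨2 * (m + j + 2) * (2 * (m + j + 2) + 1) * N, ?_, ?_⟩
      · rw [hp.dvd_mul, hp.dvd_mul, hp.dvd_mul]
        rintro (((h | h) | h) | h)
        · exact absurd (Nat.le_of_dvd (by norm_num) h) (by omega)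
        · exact absurd (Nat.le_of_dvd (by omega) h) (by omega)
        · obtain ⟨c, hc⟩ := h
          have h1 : c < 2 := by
            by_contra h2
            have : p * 2 ≤ p * c := Nat.mul_le_mul_left p (by omega)
            omega
          have h2 : 1 < c := by
            by_contra h2
            have : p * c ≤ p * 1 := Nat.mul_le_mul_left p (by omega)
            omega
          omega
        · exact hN h
      · have h1 := natDegree_ellipticOp_iterate_le (g := X ^ (m + 2)) hf (natDegree_X_pow_le _) j
        rw [Function.iterate_succ_apply', show m + 2 + (j + 1) = m + j + 3 by ring,
          coeff_ellipticOp_of_natDegree_le hf (n := m + j) (by omega), hf3,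
          show m + j + 2 = m + 2 + j by ring, h]
        push_cast
        ring
  obtain ⟨N, hN, h⟩ := key (m + 1) le_rfl
  exact ⟨N, hN, by rw [← h, hpm]; congr 1; simp; ring⟩

theorem natCast_ne_zero_of_lt [CharP P p] {i : ℕ} (hi : i ≠ 0) (hip : i < p) : (i : P) ≠ 0 := by
  rw [Ne, CharP.cast_eq_zero_iff P p]
  exact fun h => absurd (Nat.le_of_dvd (Nat.pos_of_ne_zero hi) h) (by omega)

theorem natDegree_eq_zero_of_derivative_eq_zero [IsDomain P] [CharP P p] {g : P[X]} (hg : derivative g = 0)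
    (hdeg : g.natDegree < p) : g.natDegree = 0 := by
  by_contra h
  obtain ⟨n, hn⟩ := Nat.exists_eq_succ_of_ne_zero h
  have h1 := congrArg (fun r => coeff r n) hg
  simp only [coeff_derivative, coeff_zero] at h1
  have h2 : ((n + 1 : ℕ) : P) ≠ 0 := natCast_ne_zero_of_lt (p := p) n.succ_ne_zero (by omega)
  push_cast at h2
  have h3 := (mul_eq_zero.mp h1).resolve_right h2
  have h4 : g ≠ 0 := by rintro rfl; simp at h
  exact h4 (leadingCoeff_eq_zero.mp (by rw [leadingCoeff, hn]; exact h3))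

theorem derivation_algebraMap (d : Derivation P (QuadraticAlgebra P[X] f 0) (QuadraticAlgebra P[X] f 0))
    (g : P[X]) : d (algebraMap P[X] _ g) = algebraMap P[X] _ (derivative g) * d (algebraMap P[X] _ X) := by
  have h : ∀ r : P[X], algebraMap P[X] (QuadraticAlgebra P[X] f 0) r =
      aeval (algebraMap P[X] (QuadraticAlgebra P[X] f 0) X) r := fun r => by
    rw [aeval_algebraMap_apply, aeval_X_left_apply]
  rw [h g, Derivation.map_aeval, ← h, smul_eq_mul]

theorem derivation_eq_of_eqOn
    {d d' : Derivation P (QuadraticAlgebra P[X] f 0) (QuadraticAlgebra P[X] f 0)}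
    (h1 : d (algebraMap P[X] _ X) = d' (algebraMap P[X] _ X)) (h2 : d ⟨0, 1⟩ = d' ⟨0, 1⟩) : d = d' := by
  ext1 g
  have h : g = algebraMap P[X] _ g.re + algebraMap P[X] _ g.im * ⟨0, 1⟩ := by ext1 <;> simp
  rw [h, map_add, map_add, Derivation.leibniz, Derivation.leibniz, derivation_algebraMap,
    derivation_algebraMap d', derivation_algebraMap d g.im, derivation_algebraMap d' g.im, h1, h2]

/-- The Hasse invariant: the `p`-th power of the invariant vector field is a multiple of it. -/
theorem ellipticDer_iterate_char [Fact p.Prime] [CharP P p] [IsDomain P] (hpm : p = 2 * m + 1) (hf : f = X * q) (hdeg : f.natDegree ≤ 3)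
    (hq : q.coeff 0 ≠ 0) : ∀ g, (ellipticDer f)^[p] g =
      algebraMap _ _ (C ((f ^ m).coeff (2 * m))) * ellipticDer f g := by
  have hp : p.Prime := Fact.out
  have hm : m ≠ 0 := by rintro rfl; exact hp.ne_one (by omega)
  have hf0 : f ≠ 0 := by
    rintro rfl
    have : q = 0 := by simpa using hf.symm
    exact hq (by rw [this, coeff_zero])
  have h2P : (2 : P) ≠ 0 := by
    have := natCast_ne_zero_of_lt (P := P) (p := p) (i := 2) two_ne_zero (by omega)
    exact_mod_cast this
  have h2 : (2 : P[X]) ≠ 0 := by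
    rw [← map_ofNat C, Ne, C_eq_zero]
    exact h2P
  have : CharP (QuadraticAlgebra P[X] f 0) p :=
    charP_of_injective_algebraMap (R := P) (by
      rw [IsScalarTower.algebraMap_eq P P[X] (QuadraticAlgebra P[X] f 0)]
      exact QuadraticAlgebra.algebraMap_injective.comp C_injective) p
  set δ := ellipticDer f
  set Q := (ellipticOp f)^[m] X with hQ
  have hodd : ∀ g : P[X], derivationPow δ p (algebraMap _ _ g) =
      ⟨0, 2 * derivative ((ellipticOp f)^[m] g)⟩ := by
    intro g
    rw [derivationPow_apply, hpm, Function.iterate_succ_apply', ellipticDer_iterate,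
      ellipticDer_algebraMap]
  have hcomm : ∀ g, derivationPow δ p (δ g) = δ (derivationPow δ p g) := by
    intro g
    rw [derivationPow_apply, derivationPow_apply, ← Function.iterate_succ_apply,
      Function.iterate_succ_apply']
  have hx := hodd X
  have hy : derivationPow δ p ⟨0, 1⟩ = ⟨derivative f * derivative Q, 0⟩ := by
    have h1 : (⟨0, 1⟩ * ⟨0, 1⟩ : QuadraticAlgebra P[X] f 0) = algebraMap _ _ f := by ext1 <;> simp
    have h3 := congrArg (derivationPow δ p) h1
    rw [Derivation.leibniz, derivation_algebraMap, hx] at h3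
    have h4 := congrArg QuadraticAlgebra.re h3
    have h5 := congrArg QuadraticAlgebra.im h3
    simp at h4 h5
    ext1
    · refine mul_left_cancel₀ h2 ?_
      linear_combination h5
    · have h6 : 2 * f * (derivationPow δ p ⟨0, 1⟩).im = 0 := by linear_combination h4
      simpa [h2, hf0] using h6
  -- Compare the two sides of `δ ^ p (δ x) = δ (δ ^ p x)`, where `δ ^ p x = 2 Q' Y` and `δ ^ p Y =
  -- f' Q'`. Since `Q` has degree at most `m + 1`, its derivative is then a constant `a`, and `δ ^ p
  -- = a δ`.
  have hQ'' : derivative (derivative Q) = 0 := by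
    have h3 := hcomm (algebraMap P[X] _ X)
    have h4 : δ (algebraMap P[X] _ X) = (2 : P) • ⟨0, 1⟩ := by
      rw [ellipticDer_algebraMap]; ext1 <;> simp [smul_eq_C_mul, map_ofNat]
    rw [hx, h4, Derivation.map_smul, hy, ellipticDer_apply] at h3
    have h5 := congrArg QuadraticAlgebra.re h3
    simp [smul_eq_C_mul, map_ofNat, derivative_mul] at h5
    have h6 : 2 * 2 * f * derivative (derivative Q) = 0 := by linear_combination -h5
    simpa [h2, hf0] using h6
  obtain ⟨a, ha⟩ : ∃ a, derivative Q = C a := by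
    have h3 : Q.natDegree ≤ 1 + m := natDegree_ellipticOp_iterate_le hdeg natDegree_X_le m
    exact ⟨_, eq_C_of_natDegree_eq_zero (natDegree_eq_zero_of_derivative_eq_zero (p := p) hQ''
      ((natDegree_derivative_le _).trans_lt (by omega)))⟩
  have hmain : derivationPow δ p = C a • δ := by
    refine derivation_eq_of_eqOn ?_ ?_
    · rw [hx, ha, Derivation.smul_apply, ellipticDer_algebraMap]
      ext1 <;> simp [mul_comm]
    · rw [hy, ha, Derivation.smul_apply, ellipticDer_apply]
      ext1 <;> simp [mul_comm]
  have haval : a = (f ^ m).coeff (2 * m) := by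
    have h3 := hodd (X ^ m)
    rw [hmain, Derivation.smul_apply, ellipticDer_algebraMap] at h3
    have h4 := congrArg QuadraticAlgebra.im h3
    simp only [QuadraticAlgebra.im_smul, smul_eq_mul] at h4
    -- Evaluating `δ ^ p = a δ` on `x ^ m` identifies `a`: the difference has degree below `p`,
    -- hence is a constant, and by Wilson's theorem this constant is `-q(0) ^ m`.
    have h5 : derivative ((ellipticOp f)^[m] (X ^ m) - C a * X ^ m) = 0 := by
      refine mul_left_cancel₀ h2 ?_
      rw [derivative_sub, derivative_C_mul]
      linear_combination -h4
    have h6 : ((ellipticOp f)^[m] (X ^ m) - C a * X ^ m).natDegree ≤ m + m := by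
      refine natDegree_sub_le_of_le (natDegree_ellipticOp_iterate_le hdeg (natDegree_X_pow_le m) m)
        ((natDegree_C_mul_X_pow_le a m).trans (by omega)) |>.trans (max_self _).le
    have h7 := eq_C_of_natDegree_eq_zero (natDegree_eq_zero_of_derivative_eq_zero (p := p) h5 (by omega))
    have h8 : ((2 * m).factorial : P) = -1 := by
      have h9 := ZMod.wilsons_lemma p
      have h10 := congrArg (ZMod.castHom (dvd_refl p) P) h9
      rw [map_natCast, map_neg, map_one, show p - 1 = 2 * m by omega] at h10
      exact h10
    rw [coeff_sub, coeff_zero_ellipticOp_iterate hf, h8, coeff_C_mul, coeff_X_pow,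
      if_neg (by omega), mul_zero, sub_zero] at h7
    -- Since `2m + 1 = 0`, the product is the derivative of `4 g' f ^ (m + 1)`, and a derivative has
    -- no term in degree `p - 1`.
    have hμ : ∀ g : P[X], (ellipticOp f g * f ^ m).coeff (2 * m) = 0 := by
      intro g
      have hp2 : (2 * m + 1 : P) = 0 := by
        have := CharP.cast_eq_zero P p
        rw [hpm] at this
        exact_mod_cast this
      have hp2' : (2 * (m : P[X]) + 1) = 0 := by
        have := congrArg C hp2
        simpa only [map_add, map_mul, map_ofNat, map_natCast, map_one, map_zero] using this
      have e : ellipticOp f g * f ^ m = derivative (4 * derivative g * f ^ (m + 1)) := by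
        rw [derivative_mul, derivative_pow_succ, derivative_mul, derivative_ofNat, ellipticOp,
          map_add, map_natCast, map_one]
        linear_combination (-2) * (derivative g * derivative f * f ^ m) * hp2'
      rw [e, coeff_derivative]
      push_cast
      rw [hp2, mul_zero]
    obtain ⟨m', rfl⟩ := Nat.exists_eq_succ_of_ne_zero hm
    have h11 := hμ ((ellipticOp f)^[m'] (X ^ (m' + 1)))
    rw [← Function.iterate_succ_apply' (ellipticOp f), sub_eq_iff_eq_add.mp h7, add_mul, coeff_add, coeff_C_mul,
      mul_assoc (C a), coeff_C_mul] at h11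
    have h12 : (X ^ (m' + 1) * f ^ (m' + 1)).coeff (2 * (m' + 1)) = q.coeff 0 ^ (m' + 1) := by
      rw [hf, mul_pow, ← mul_assoc, ← pow_add, coeff_X_pow_mul', if_pos (by omega),
        show 2 * (m' + 1) - (m' + 1 + (m' + 1)) = 0 by omega, coeff_zero_eq_eval_zero,
        coeff_zero_eq_eval_zero, eval_pow]
    rw [h12] at h11
    rw [Nat.succ_eq_add_one] at h11 ⊢
    refine mul_right_cancel₀ (pow_ne_zero (m' + 1) hq) ?_
    linear_combination h11
  intro g
  rw [← derivationPow_apply, hmain, haval, Derivation.smul_apply, Algebra.smul_def]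

end

/-! ### Dimension and transcendence degree under integral extensions -/

/-- Incomparability gives one inequality, lying over with going up the other. -/
theorem ringKrullDim_eq_of_isIntegral (R S : Type*) [CommRing R] [CommRing S] [Algebra R S]
    [Algebra.IsIntegral R S] [FaithfulSMul R S] : ringKrullDim S = ringKrullDim R := by
  refine le_antisymm ?_ ?_
  · refine Order.krullDim_le_of_strictMono (PrimeSpectrum.comap (algebraMap R S)) fun I J h => ?_
    exact Ideal.IsIntegral.comap_lt_comap (R := R) (show I.asIdeal < J.asIdeal from h)
  · refine iSup_le fun l => ?_
    have := l.head.2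
    obtain ⟨⟨Q, hQ, hQ'⟩⟩ := Ideal.nonempty_primesOver (S := S) l.head.asIdeal
    obtain ⟨L, hL, -⟩ := Ideal.exists_ltSeries_of_hasGoingUp l Q
    rw [← hL]
    exact Order.LTSeries.length_le_krullDim L

theorem trdeg_eq_of_isIntegral (k R S : Type u) [Field k] [CommRing R] [CommRing S] [IsDomain S]
    [Algebra k R] [Algebra k S] [Algebra R S] [IsScalarTower k R S] [Algebra.IsIntegral R S]
    [FaithfulSMul R S] : Algebra.trdeg k S = Algebra.trdeg k R := by
  have := (FaithfulSMul.algebraMap_injective R S).isDomain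
  have : FaithfulSMul k R := (faithfulSMul_iff_algebraMap_injective k R).mpr (algebraMap k R).injective
  rw [← trdeg_add_eq k R (A := S), trdeg_eq_zero (R := R) (A := S), add_zero]

/-! ### First integrals of the invariant vector field -/

section
variable {P : Type*} [CommRing P] {f : P[X]} {p m : ℕ} [CharP P p] [IsDomain P]

/-- First integrals of the invariant vector field. -/
theorem exists_of_ellipticDer_eq_zero [Fact p.Prime] (hpm : p = 2 * m + 1) {α β : P} (hα : α ≠ 0) (hβ : β ≠ 0)
    (hαβ : α ≠ β) (hf : f = X * (X - C α) * (X - C β)) {g : QuadraticAlgebra P[X] f 0}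
    (hg : ellipticDer f g = 0) :
    derivative g.re = 0 ∧ ∃ b, derivative b = 0 ∧ g.im = f ^ m * b := by
  have hp : p.Prime := Fact.out
  have hm : m ≠ 0 := by rintro rfl; exact hp.ne_one (by omega)
  have hf0 : f ≠ 0 := by
    rw [hf]
    exact mul_ne_zero (mul_ne_zero X_ne_zero (X_sub_C_ne_zero _)) (X_sub_C_ne_zero _)
  have h2P : (2 : P) ≠ 0 := by
    have := natCast_ne_zero_of_lt (P := P) (p := p) (i := 2) two_ne_zero (by omega)
    exact_mod_cast this
  have h2 : (2 : P[X]) ≠ 0 := by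
    rw [← map_ofNat C, Ne, C_eq_zero]
    exact h2P
  rw [ellipticDer_apply] at hg
  have hre := congrArg QuadraticAlgebra.im hg
  have him := congrArg QuadraticAlgebra.re hg
  simp only [QuadraticAlgebra.re_zero, QuadraticAlgebra.im_zero, mul_eq_zero, h2, false_or] at hre him
  refine ⟨hre, ?_⟩
  have hsep : ∀ c : P, f.eval c = 0 → (derivative f).eval c ≠ 0 := by
    intro c hc
    have hd : derivative f = (X - C α) * (X - C β) + X * (X - C β) + X * (X - C α) := by
      rw [hf]; simp [derivative_mul]; ring
    rw [hd]
    rw [hf] at hc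
    simp only [eval_mul, eval_X, eval_sub, eval_C, mul_eq_zero, sub_eq_zero] at hc
    rcases hc with (rfl | rfl) | rfl
    · simpa using ⟨hα, hβ⟩
    · simpa using ⟨hα, sub_ne_zero.mpr hαβ⟩
    · simpa using ⟨hβ, sub_ne_zero.mpr hαβ.symm⟩
  -- As long as `2j + 1 ≠ 0`, the equation forces `b` to vanish at the simple roots of `f`, so
  -- another factor `f` splits off. At `j = m` the second term disappears and leaves `b' = 0`.
  have key : ∀ j ≤ m, ∃ b, g.im = f ^ j * b ∧
      2 * derivative b * f + (2 * j + 1) * (b * derivative f) = 0 := by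
    intro j hj
    induction j with
    | zero => exact ⟨g.im, by simp, by simpa using him⟩
    | succ j ih =>
      obtain ⟨b, hb, h⟩ := ih (by omega)
      obtain ⟨b', rfl⟩ : f ∣ b := by
        refine dvd_of_eval_eq_zero hα hβ hαβ hf fun c hc => ?_
        have h1 := congrArg (eval c) h
        have h3 : ((2 * j + 1 : ℕ) : P) ≠ 0 := natCast_ne_zero_of_lt (p := p) (by omega) (by omega)
        push_cast at h3
        simpa [hc, hsep c hc, h3] using h1
      refine ⟨b', by rw [hb]; ring, mul_left_cancel₀ hf0 ?_⟩
      rw [derivative_mul] at h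
      push_cast
      linear_combination h
  obtain ⟨b, hb, h⟩ := key m le_rfl
  refine ⟨b, ?_, hb⟩
  have h1 : (2 * (m : P[X]) + 1) = 0 := by
    have := CharP.cast_eq_zero P[X] p
    rw [hpm] at this
    exact_mod_cast this
  rw [h1, zero_mul, add_zero] at h
  simpa [h2, hf0] using h

/-- A polynomial with zero derivative involves only exponents divisible by `p`. -/
theorem map_mem_of_derivative_eq_zero {B : Type*} [CommRing B] (ψ : P[X] →+* B) (K : Subring B)
    {g : P[X]} (hg : derivative g = 0) (hX : ψ X ^ p ∈ K) (hC : ∀ n, ψ (C (g.coeff n)) ∈ K) :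
    ψ g ∈ K := by
  rw [g.as_sum_support_C_mul_X_pow, map_sum]
  refine sum_mem fun n hn => ?_
  rw [mem_support_iff] at hn
  have hdvd : p ∣ n := by
    cases n with
    | zero => simp
    | succ n =>
      have h1 := congrArg (fun r => coeff r n) hg
      simp only [coeff_derivative, coeff_zero] at h1
      rw [← CharP.cast_eq_zero_iff P p]
      push_cast
      exact (mul_eq_zero.mp h1).resolve_left hn
  obtain ⟨j, rfl⟩ := hdvd
  rw [map_mul, map_pow, pow_mul]
  exact mul_mem (hC _) (pow_mem hX j)

end

/-! ### The cone over the Legendre family -/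

section
variable {P : Type*} [CommRing P] {k : Type*} [Field k] [Algebra k P]

theorem coeff_legendre_pow (l ζ : P) (m : ℕ) :
    ((X * (X - C (ζ ^ 2)) * (X - C (l * ζ ^ 2))) ^ m).coeff (2 * m) =
      ζ ^ (2 * m) * aeval l (hasse k m) := by
  rw [mul_assoc, mul_pow, coeff_X_pow_mul', if_pos (by omega), show 2 * m - m = m by omega, mul_pow,
    coeff_mul, Finset.Nat.sum_antidiagonal_eq_sum_range_succ_mk, hasse, map_sum, Finset.mul_sum]
  refine Finset.sum_congr rfl fun i hi => ?_
  have hi : i ≤ m := by rw [Finset.mem_range] at hi; omega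
  rw [sub_eq_add_neg, sub_eq_add_neg, ← C_neg, ← C_neg, coeff_X_add_C_pow, coeff_X_add_C_pow]
  simp only [map_mul, aeval_X, map_pow, map_neg, map_one, map_natCast]
  rw [Nat.choose_symm hi, show m - (m - i) = i by omega]
  obtain ⟨j, rfl⟩ := Nat.exists_eq_add_of_le hi
  rw [Nat.add_sub_cancel_left, neg_pow, neg_pow (l * ζ ^ 2), mul_pow]
  ring
end

/-- The ring of the cone over a family of elliptic curves, embedded by three times the origin,
with an invariant vector field `δ` and the Euler field `ε`. The `p`-th power of `δ` is
`(u z) ^ (p - 1) δ`. -/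
structure IsEllipticCone (k : Type u) {A C : Type u} [Field k] [CommRing A] [CommRing C]
    [Algebra k C] [Algebra A C] (m : ℕ) (l u : A) (x z Y : C) (δ ε : Derivation A C C) : Prop where
  isDomain : IsDomain C
  isIntegrallyClosed : IsIntegrallyClosed C
  ringKrullDim_eq : ringKrullDim C = 3
  three_le_trdeg : 3 ≤ Algebra.trdeg k C
  adjoin_eq_top : Algebra.adjoin A {x, z, Y} = ⊤
  sq_eq : Y ^ 2 = x * (x - z ^ 2) * (x - algebraMap A C l * z ^ 2)
  der_x : δ x = 2 * Y
  der_z : δ z = 0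
  der_Y : δ Y = (x - z ^ 2) * (x - algebraMap A C l * z ^ 2) +
    x * (x - algebraMap A C l * z ^ 2) + x * (x - z ^ 2)
  euler_x : ε x = 2 * x
  euler_z : ε z = z
  euler_Y : ε Y = 3 * Y
  iterate : ∀ g, δ^[2 * m + 1] g = (algebraMap A C u * z) ^ (2 * m) * δ g
  prime_u : Prime (algebraMap A C u)
  prime_z : Prime z
  not_dvd_u : ¬ algebraMap A C u ∣ δ^[2 * m] (x ^ (m + 1))
  not_dvd_z : ¬ z ∣ δ^[2 * m] (x ^ (m + 1))
  not_dvd_Y_u : ¬ algebraMap A C u ∣ Y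
  not_dvd_Y_z : ¬ z ∣ Y
  mem_adjoin : ∀ g, δ g = 0 → ε g = 0 →
    g ∈ Algebra.adjoin A {x ^ (2 * m + 1), z ^ (2 * m + 1), Y ^ (2 * m + 1)}
  der_ne : ∀ c, δ (1 - algebraMap A C u * c) ≠ algebraMap A C u * z * (1 - algebraMap A C u * c)

section
variable {A : Type u} [CommRing A] (l : A)

/-- The homogeneous Legendre cubic. -/
def legendre : A[X][X] := X * (X - C (X ^ 2)) * (X - C (C l * X ^ 2))

/-- The ring of the cone over a Legendre curve. -/
abbrev LegendreRing : Type u := QuadraticAlgebra A[X][X] (legendre l) 0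

theorem natDegree_legendre [Nontrivial A] : (legendre l).natDegree = 3 := by
  rw [legendre, Monic.natDegree_mul (by monicity!) (by monicity!),
    Monic.natDegree_mul (by monicity!) (by monicity!), natDegree_X, natDegree_X_sub_C,
    natDegree_X_sub_C]

theorem monic_legendre : (legendre l).Monic := by
  rw [legendre]; monicity!

/-- The weighted Euler derivation on polynomials. -/
def eulerPoly : Derivation A A[X][X] A[X][X] := extDer ((X : A[X]) • derivative') 2

theorem coeff_eulerPoly (f : A[X][X]) (n : ℕ) :
    (eulerPoly f).coeff n = X * derivative (f.coeff n) + (n : A[X]) * 2 * f.coeff n := by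
  rw [eulerPoly, coeff_extDer]; rfl

theorem eulerPoly_X : eulerPoly (X : A[X][X]) = 2 * X := by
  ext1 n
  rw [coeff_eulerPoly, coeff_ofNat_mul, coeff_X]
  split_ifs with h
  · subst h; simp
  · simp

theorem eulerPoly_C (g : A[X]) : eulerPoly (C g) = C (X * derivative g) := by
  ext1 n
  rw [coeff_eulerPoly, coeff_C, coeff_C]
  split_ifs with h
  · subst h; simp
  · simp

theorem eulerPoly_legendre : eulerPoly (legendre l) = 6 * legendre l := by
  have h (a : A) : eulerPoly (C (C a * X ^ 2)) = 2 * C (C a * X ^ 2) := by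
    rw [eulerPoly_C, ← map_ofNat C, ← C_mul]
    congr 1
    simp only [pow_two, derivative_mul, derivative_C, derivative_X]
    ring
  have h1 := h 1
  rw [C_1, one_mul] at h1
  rw [legendre]
  simp only [Derivation.leibniz, map_sub, eulerPoly_X, h, h1, smul_eq_mul]
  ring

/-- The Euler derivation of the cone. -/
def eulerDer : Derivation A (LegendreRing l) (LegendreRing l) :=
  Derivation.mk'
    { toFun := fun g => ⟨eulerPoly g.re, eulerPoly g.im + 3 * g.im⟩
      map_add' := fun g h => by ext1 <;> simp; ring
      map_smul' := fun c g => by ext1 <;> simp }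
    fun g h => by
      ext1
      · simp [eulerPoly_legendre]; ring
      · simp; ring

theorem eulerDer_apply (g : LegendreRing l) :
    eulerDer l g = ⟨eulerPoly g.re, eulerPoly g.im + 3 * g.im⟩ := rfl

theorem algebraMap_legendreRing (a : A) :
    algebraMap A (LegendreRing l) a = algebraMap A[X][X] _ (C (C a)) := rfl

theorem X_sq_ne [IsDomain A] {l : A} (hl1 : 1 - l ≠ 0) : (X ^ 2 : A[X]) ≠ C l * X ^ 2 := by
  intro e
  have h1 : C (1 - l) * X ^ 2 = 0 := by rw [C_sub, sub_mul, C_1, one_mul, sub_eq_zero]; exact e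
  rcases mul_eq_zero.mp h1 with h2 | h2
  · exact hl1 (C_eq_zero.mp h2)
  · exact pow_ne_zero 2 X_ne_zero h2

theorem derivative_legendre : derivative (legendre l) = (X - C (X ^ 2)) * (X - C (C l * X ^ 2)) +
    X * (X - C (C l * X ^ 2)) + X * (X - C (X ^ 2)) := by
  rw [legendre]
  simp only [derivative_mul, derivative_X, derivative_sub, derivative_C]
  ring

variable {l}

/-- The vanishing of `δ g` writes `g` as `a + b Y ^ p` with zero `x`-derivatives of `a` and `b`.
Euler's equation then kills their `z`-derivatives, so only powers of `x ^ p` and `z ^ p` occur. -/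
theorem mem_adjoin_of_ellipticDer_eq_zero [IsDomain A] {p m : ℕ} [Fact p.Prime] [CharP A p]
    (hpm : p = 2 * m + 1) (hl0 : l ≠ 0) (hl1 : 1 - l ≠ 0) {g : LegendreRing l}
    (hg : ellipticDer (legendre l) g = 0) (hg' : eulerDer l g = 0) :
    g ∈ Algebra.adjoin A {algebraMap A[X][X] (LegendreRing l) X ^ p,
      algebraMap A[X][X] (LegendreRing l) (C X) ^ p, (⟨0, 1⟩ : LegendreRing l) ^ p} := by
  have hp : p.Prime := Fact.out
  have hα : (X ^ 2 : A[X]) ≠ 0 := pow_ne_zero 2 X_ne_zero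
  have hβ : (C l * X ^ 2 : A[X]) ≠ 0 := mul_ne_zero (C_ne_zero.mpr hl0) hα
  have hαβ := X_sq_ne hl1
  have hY2 : (⟨0, 1⟩ : LegendreRing l) ^ 2 = algebraMap _ _ (legendre l) := by
    ext1 <;> simp [pow_two]
  obtain ⟨hre, b, hb, him⟩ := exists_of_ellipticDer_eq_zero (f := legendre l) hpm hα hβ hαβ rfl hg
  have hYp : (⟨0, 1⟩ : LegendreRing l) ^ (2 * m + 1) = algebraMap _ _ (legendre l ^ m) * ⟨0, 1⟩ := by
    rw [pow_succ, pow_mul, hY2, map_pow]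
  have e : g = algebraMap A[X][X] _ g.re + algebraMap A[X][X] _ b * ⟨0, 1⟩ ^ (2 * m + 1) := by
    rw [hYp]
    ext1
    · simp only [QuadraticAlgebra.re_add, QuadraticAlgebra.re_mul, QuadraticAlgebra.im_mul,
        QuadraticAlgebra.algebraMap_re, QuadraticAlgebra.algebraMap_im]
      ring
    · simp only [QuadraticAlgebra.im_add, QuadraticAlgebra.re_mul, QuadraticAlgebra.im_mul,
        QuadraticAlgebra.algebraMap_re, QuadraticAlgebra.algebraMap_im, him]
      ring
  rw [eulerDer_apply] at hg'
  have hEre : eulerPoly g.re = 0 := congrArg QuadraticAlgebra.re hg'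
  have hEb : eulerPoly b = 0 := by
    have h1 : eulerPoly g.im + 3 * g.im = 0 := congrArg QuadraticAlgebra.im hg'
    have hpz : (2 * m + 1 : A[X][X]) = 0 := by
      have := CharP.cast_eq_zero A[X][X] p
      rw [hpm] at this
      exact_mod_cast this
    rw [him, Derivation.leibniz, Derivation.leibniz_pow, eulerPoly_legendre] at h1
    have hfm : legendre l ^ m ≠ 0 := pow_ne_zero _ (monic_legendre l).ne_zero
    refine (mul_eq_zero.mp ?_).resolve_left hfm
    have h3 : m ≠ 0 := by rintro rfl; exact hp.ne_one (by omega)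
    obtain ⟨n, rfl⟩ := Nat.exists_eq_succ_of_ne_zero h3
    simp only [nsmul_eq_mul, smul_eq_mul, Nat.succ_eq_add_one, Nat.add_sub_cancel] at h1 ⊢
    push_cast at h1 hpz
    -- The weight `3p` of `Y ^ p` is zero, so Euler's equation for `f ^ m b Y` reduces to the one
    -- for `b`.
    linear_combination h1 - 3 * (legendre l ^ (n + 1) * b) * hpz
  rw [← hpm] at e
  set K := Algebra.adjoin A {algebraMap A[X][X] (LegendreRing l) X ^ p,
    algebraMap A[X][X] (LegendreRing l) (C X) ^ p, (⟨0, 1⟩ : LegendreRing l) ^ p}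
  have key : ∀ q : A[X][X], derivative q = 0 → eulerPoly q = 0 → algebraMap _ _ q ∈ K := by
    intro q hq hq'
    refine map_mem_of_derivative_eq_zero (p := p) (algebraMap _ _) K.toSubring hq ?_ fun n => ?_
    · exact Algebra.subset_adjoin (by simp)
    · have h1 : derivative (q.coeff n) = 0 := by
        have h2 := congrArg (fun r => coeff r n) hq'
        simp only [coeff_eulerPoly, coeff_zero] at h2
        have h3 : (n : A[X]) * q.coeff n = 0 := by
          have h4 := congrArg (fun r => coeff (X * r) n) hq
          simp only [mul_zero, coeff_zero] at h4
          cases n with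
          | zero => simp
          | succ n =>
            rw [coeff_X_mul, coeff_derivative] at h4
            push_cast
            linear_combination h4
        have h5 : X * derivative (q.coeff n) = 0 := by linear_combination h2 - 2 * h3
        exact (mul_eq_zero.mp h5).resolve_left X_ne_zero
      refine map_mem_of_derivative_eq_zero (p := p) ((algebraMap A[X][X] (LegendreRing l)).comp C)
        K.toSubring h1 ?_ fun j => ?_
      · exact Algebra.subset_adjoin (by right; left; rfl)
      · exact K.algebraMap_mem _
  rw [e]
  exact add_mem (key _ hre hEre) (mul_mem (key _ hb hEb) (Algebra.subset_adjoin (by simp)))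

/-- Compare the parts without `Y` at `x = 0`. There `f` vanishes and `f'` is `l z⁴`, so the left
side is divisible by `z⁴`. The right side has `z`-linear coefficient `u (1 - u c₀)`, which would
make the prime `u` a unit. -/
theorem ellipticDer_ne [IsDomain A] {u : A} (hu : Prime u) (c : LegendreRing l) :
    ellipticDer (legendre l) (1 - algebraMap A _ u * c) ≠ algebraMap A _ u *
      algebraMap A[X][X] (LegendreRing l) (C X) * (1 - algebraMap A _ u * c) := by
  intro hc
  rw [ellipticDer_apply] at hc
  have h1 := congrArg (fun g => (QuadraticAlgebra.re g).coeff 0) hc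
  have hl4 : (derivative (legendre l)).coeff 0 = C l * X ^ 4 := by
    rw [derivative_legendre]
    simp only [coeff_add, mul_coeff_zero, coeff_sub, coeff_X_zero, coeff_C_zero]
    ring
  have hl5 : (legendre l).coeff 0 = 0 := by rw [legendre]; simp [mul_coeff_zero]
  have h2 : (algebraMap A (LegendreRing l) u * c).re = C (C u) * c.re := by
    rw [algebraMap_legendreRing]; simp
  have h3 : (algebraMap A (LegendreRing l) u * algebraMap A[X][X] (LegendreRing l) (C X) *
      (1 - algebraMap A (LegendreRing l) u * c)).re = C (C u) * C X * (1 - C (C u) * c.re) := by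
    rw [← h2, algebraMap_legendreRing, ← map_mul]
    simp [QuadraticAlgebra.re_one, QuadraticAlgebra.im_one]
  simp only [h3, coeff_add, mul_coeff_zero, hl4, hl5, coeff_C_zero, coeff_sub, coeff_one_zero] at h1
  set b := (1 - algebraMap A (LegendreRing l) u * c).im.coeff 0
  have h4 : X * (C u * (1 - C u * c.re.coeff 0) - b * C l * X ^ 3) = 0 := by
    linear_combination -h1
  have h5 := congrArg (eval 0) ((mul_eq_zero.mp h4).resolve_left X_ne_zero)
  simp only [eval_sub, eval_mul, eval_C, eval_one, eval_pow, eval_X, eval_zero] at h5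
  have h6 : u * (1 - u * (c.re.coeff 0).eval 0) = 0 := by linear_combination h5
  exact hu.not_isUnit (IsUnit.of_mul_eq_one _
    (sub_eq_zero.mp ((mul_eq_zero.mp h6).resolve_left hu.ne_zero)).symm)

theorem isEllipticCone {k : Type u} [Field k] [Algebra k A] {p m : ℕ} [Fact p.Prime] [CharP k p]
    (hpm : p = 2 * m + 1) {u : A} (h : IsHasseBase k m l u) :
    IsEllipticCone k (C := LegendreRing l) m l u (algebraMap A[X][X] _ X)
      (algebraMap A[X][X] _ (C X)) ⟨0, 1⟩
      ((ellipticDer (legendre l)).restrictScalars A) (eulerDer l) := by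
  have hp : p.Prime := Fact.out
  have := h.isDomain
  have := h.finiteType
  have := h.isIntegrallyClosed
  have : IsNoetherianRing A := Algebra.FiniteType.isNoetherianRing k A
  have : CharP A p := charP_of_injective_algebraMap (algebraMap k A).injective p
  have : CharP A[X] p := inferInstance
  have hodd : Odd (legendre l).natDegree := by rw [natDegree_legendre]; decide
  have hdom : IsDomain (LegendreRing l) := isDomain_quadraticAlgebra hodd
  have hXne : (X : A[X]) ≠ 0 := X_ne_zero
  have hl0 : l ≠ 0 := h.isUnit_left.ne_zero
  have hα : (X ^ 2 : A[X]) ≠ 0 := pow_ne_zero 2 X_ne_zero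
  have hβ : (C l * X ^ 2 : A[X]) ≠ 0 := mul_ne_zero (C_ne_zero.mpr hl0) hα
  have hαβ := X_sq_ne h.isUnit_right.ne_zero
  have hunit : ∀ N : ℕ, ¬ p ∣ N → IsUnit (N : A[X]) := by
    intro N hN
    have h1 : (N : k) ≠ 0 := by rwa [Ne, CharP.cast_eq_zero_iff k p]
    have h2 := (Ne.isUnit h1).map (algebraMap k A[X])
    rwa [map_natCast] at h2
  have hinj : Function.Injective (algebraMap A[X][X] (LegendreRing l)) :=
    QuadraticAlgebra.algebraMap_injective
  have hY2 : (⟨0, 1⟩ : LegendreRing l) ^ 2 = algebraMap _ _ (legendre l) := by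
    ext1 <;> simp [pow_two]
  -- The coefficient of `x ^ p` is an integer prime to `p`, hence a unit, which no prime divides.
  have hnot : ∀ π : A[X], Prime π → ¬ algebraMap A[X][X] (LegendreRing l) (C π) ∣
      ((ellipticDer (legendre l)).restrictScalars A)^[2 * m] (algebraMap A[X][X] _ X ^ (m + 1)) := by
    intro π hπ hdvd
    rw [Derivation.coe_restrictScalars, ← map_pow, ellipticDer_iterate,
      QuadraticAlgebra.algebraMap_dvd_iff] at hdvd
    have h1 := hdvd.1
    obtain ⟨N, hN, h2⟩ := coeff_ellipticOp_iterate (P := A[X]) hpm (natDegree_legendre l).le (by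
      rw [← natDegree_legendre l]; exact monic_legendre l)
    rw [QuadraticAlgebra.algebraMap_re, C_dvd_iff_dvd_coeff] at h1
    have h3 := h1 p
    rw [h2] at h3
    exact hπ.not_isUnit (isUnit_of_dvd_unit h3 (hunit N hN))
  have hnotY : ∀ π : A[X], Prime π →
      ¬ algebraMap A[X][X] (LegendreRing l) (C π) ∣ (⟨0, 1⟩ : LegendreRing l) := by
    intro π hπ hdvd
    rw [QuadraticAlgebra.algebraMap_dvd_iff] at hdvd
    exact (prime_C_iff.mpr hπ).not_isUnit (isUnit_of_dvd_one hdvd.2)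
  have hleg : algebraMap A[X][X] (LegendreRing l) (legendre l) =
      algebraMap _ _ (X * (X - C (X ^ 2)) * (X - C (C l * X ^ 2))) := rfl
  have h2u : IsUnit (2 : A[X]) := by
    have := hunit 2 (fun h => absurd (Nat.le_of_dvd two_pos h) (by have := hp.two_le; omega))
    exact_mod_cast this
  have hint : Algebra.IsIntegral A[X][X] (LegendreRing l) := inferInstance
  have hfs : FaithfulSMul A[X][X] (LegendreRing l) := (faithfulSMul_iff_algebraMap_injective _ _).mpr hinj
  refine
    { isDomain := hdom
      isIntegrallyClosed := isIntegrallyClosed_quadraticAlgebra h2u hα hβ hαβ rfl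
      ringKrullDim_eq := ?_
      three_le_trdeg := ?_
      adjoin_eq_top := ?_
      sq_eq := by rw [hY2, hleg]; simp only [map_mul, map_sub, map_pow, algebraMap_legendreRing]
      der_x := ?_
      der_z := ?_
      der_Y := ?_
      euler_x := ?_
      euler_z := ?_
      euler_Y := ?_
      iterate := ?_
      prime_u := ?_
      prime_z := prime_algebraMap_C (monic_legendre l) hodd prime_X
      not_dvd_u := ?_
      not_dvd_z := hnot X prime_X
      not_dvd_Y_u := hnotY (C u) (prime_C_iff.mpr h.prime)
      not_dvd_Y_z := hnotY X prime_X
      mem_adjoin := ?_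
      der_ne := ?_ }
  · rw [ringKrullDim_eq_of_isIntegral A[X][X], Polynomial.ringKrullDim_of_isNoetherianRing,
      Polynomial.ringKrullDim_of_isNoetherianRing, h.ringKrullDim_eq]
    rfl
  · rw [trdeg_eq_of_isIntegral k A[X][X], trdeg_polynomial, trdeg_polynomial]
    have := h.one_le_trdeg
    calc (3 : Cardinal) = 1 + 1 + 1 := by norm_num
      _ ≤ _ := by gcongr
  · rw [eq_top_iff]
    rintro g -
    set N := Algebra.adjoin A {algebraMap A[X][X] (LegendreRing l) X,
      algebraMap A[X][X] (LegendreRing l) (C X), ⟨0, 1⟩}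
    have hC : ∀ q : A[X], algebraMap A[X][X] (LegendreRing l) (C q) ∈ N := by
      intro q
      induction q using Polynomial.induction_on' with
      | add p q hp hq => rw [C_add, map_add]; exact add_mem hp hq
      | monomial n a =>
        rw [← C_mul_X_pow_eq_monomial, C_mul, map_mul, C_pow, map_pow]
        exact mul_mem (N.algebraMap_mem a) (pow_mem (Algebra.subset_adjoin (by simp)) n)
    have hX : ∀ q : A[X][X], algebraMap A[X][X] (LegendreRing l) q ∈ N := by
      intro q
      induction q using Polynomial.induction_on' with
      | add p q hp hq => rw [map_add]; exact add_mem hp hq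
      | monomial n a =>
        rw [← C_mul_X_pow_eq_monomial, map_mul, map_pow]
        exact mul_mem (hC a) (pow_mem (Algebra.subset_adjoin (by simp)) n)
    have e : g = algebraMap A[X][X] _ g.re + algebraMap A[X][X] _ g.im * ⟨0, 1⟩ := by ext1 <;> simp
    rw [e]
    exact add_mem (hX _) (mul_mem (hX _) (Algebra.subset_adjoin (by simp)))
  · rw [Derivation.restrictScalars_apply, ellipticDer_algebraMap, two_mul (⟨0, 1⟩ : LegendreRing l)]
    ext1 <;> simp [one_add_one_eq_two]
  · rw [Derivation.restrictScalars_apply, ellipticDer_algebraMap]; ext1 <;> simp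
  · rw [Derivation.restrictScalars_apply, show ellipticDer (legendre l) ⟨0, 1⟩ =
      algebraMap A[X][X] _ (derivative (legendre l)) by rw [ellipticDer_apply]; ext1 <;> simp, derivative_legendre]
    simp only [map_mul, map_sub, map_add, map_pow, algebraMap_legendreRing]
  · rw [eulerDer_apply]; ext1 <;> simp [eulerPoly_X, two_mul]
  · rw [eulerDer_apply]; ext1 <;> simp [eulerPoly_C]
  · rw [eulerDer_apply]; ext1 <;> simp [QuadraticAlgebra.re_ofNat, QuadraticAlgebra.im_ofNat]
  · intro g
    have h1 := ellipticDer_iterate_char (P := A[X]) (f := legendre l)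
      (q := (X - C (X ^ 2)) * (X - C (C l * X ^ 2))) hpm (by rw [legendre, mul_assoc])
      (natDegree_legendre l).le (by
        rw [mul_coeff_zero, coeff_sub, coeff_sub, coeff_X_zero, coeff_C_zero, coeff_C_zero, zero_sub,
          zero_sub]
        exact mul_ne_zero (neg_ne_zero.mpr hα) (neg_ne_zero.mpr hβ)) g
    have h3 : (legendre l ^ m).coeff (2 * m) = X ^ (2 * m) * aeval (C l) (hasse k m) :=
      coeff_legendre_pow (C l) X m
    rw [Derivation.coe_restrictScalars, ← hpm, h1]
    congr 1
    rw [h3, algebraMap_legendreRing, ← map_mul, ← map_pow, ← C_mul,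
      ← C_pow, mul_pow, ← C_pow, h.pow_eq, mul_comm]
    congr 3
    exact (aeval_algebraMap_apply A[X] l (hasse k m))
  · exact prime_algebraMap_C (monic_legendre l) hodd (prime_C_iff.mpr h.prime)
  · exact hnot (C u) (prime_C_iff.mpr h.prime)
  · exact fun g hg hg' => hpm ▸ mem_adjoin_of_ellipticDer_eq_zero hpm hl0 h.isUnit_right.ne_zero hg hg'
  · exact fun c => ellipticDer_ne h.prime c

end

/-! ### Rings of constants -/

section
variable {A S : Type*} [CommRing A] [CommRing S] [Algebra A S] (D E : Derivation A S S)

/-- The ring of constants of two derivations. -/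
def constants : Subalgebra A S where
  carrier := {r | D r = 0 ∧ E r = 0}
  mul_mem' := by
    rintro a b ⟨h1, h2⟩ ⟨h3, h4⟩
    simp [h1, h2, h3, h4]
  add_mem' := by
    rintro a b ⟨h1, h2⟩ ⟨h3, h4⟩
    simp [h1, h2, h3, h4]
  algebraMap_mem' a := by simp

theorem mem_constants {r : S} : r ∈ constants D E ↔ D r = 0 ∧ E r = 0 := Iff.rfl

theorem mem_constants_of_mul_mem [IsDomain S] {a b : S} (ha : a ∈ constants D E) (ha0 : a ≠ 0)
    (hab : a * b ∈ constants D E) : b ∈ constants D E := by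
  obtain ⟨h1, h2⟩ := ha
  obtain ⟨h3, h4⟩ := hab
  simp only [Derivation.leibniz, h1, h2, smul_eq_mul, mul_zero, add_zero, mul_eq_zero, ha0,
    false_or] at h3 h4
  exact ⟨h3, h4⟩

variable (p : ℕ) [CharP S p]

theorem pow_mem_constants (r : S) : r ^ p ∈ constants D E := by
  have h : (p : S) = 0 := CharP.cast_eq_zero S p
  refine ⟨?_, ?_⟩ <;> rw [Derivation.leibniz_pow, ← Nat.cast_smul_eq_nsmul S, h, zero_smul]

variable [Fact p.Prime]

/-- The Frobenius map to the ring of constants. -/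
def frobConstants : S →+* constants D E :=
  (frobenius S p).codRestrict (constants D E) fun r => pow_mem_constants D E p r

theorem coe_frobConstants (r : S) : (frobConstants D E p r : S) = r ^ p := rfl

theorem frobConstants_coe (r : constants D E) : frobConstants D E p r = r ^ p := rfl

instance isIntegral_constants : Algebra.IsIntegral (constants D E) S :=
  ⟨fun r => by
    refine IsIntegral.of_pow (n := p) (Fact.out : p.Prime).pos ?_
    exact isIntegral_algebraMap (R := constants D E) (x := ⟨r ^ p, pow_mem_constants D E p r⟩)⟩

end

/-- An integral quotient of two constants lies in `S`, because `S` is normal, and a quotient of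
constants in the domain `S` is again a constant. -/
theorem isIntegrallyClosed_constants {A S : Type*} [CommRing A] [CommRing S] [Algebra A S]
    (D E : Derivation A S S) [IsDomain S] [IsIntegrallyClosed S] :
    IsIntegrallyClosed (constants D E) := by
  let R := constants D E
  let K := FractionRing R
  let K' := FractionRing S
  have hinj : Function.Injective (algebraMap R S) := Subtype.val_injective
  have hinj' : Function.Injective (algebraMap S K') := IsFractionRing.injective S K'
  have hinjR : Function.Injective (algebraMap R K) := IsFractionRing.injective R K
  let ψ : K →+* K' := IsFractionRing.map (A := R) (B := S) (K := K) (L := K') hinj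
  have hψ : ∀ r : R, ψ (algebraMap R K r) = algebraMap S K' r := fun r =>
    IsLocalization.map_eq _ r
  rw [isIntegrallyClosed_iff K]
  intro w hw
  obtain ⟨a, b, hb, rfl⟩ := IsFractionRing.div_surjective (A := R) w
  have hb0 : b ≠ 0 := nonZeroDivisors.ne_zero hb
  have h1 : _root_.IsIntegral S (ψ (algebraMap R K a / algebraMap R K b)) := by
    obtain ⟨q, hq, hq'⟩ := hw
    refine ⟨q.map (algebraMap R S), hq.map _, ?_⟩
    rw [eval₂_map, ← map_zero ψ, ← hq', hom_eval₂]
    congr 1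
    ext r
    exact (hψ r).symm
  obtain ⟨c, hc⟩ := IsIntegrallyClosed.isIntegral_iff.mp h1
  have h2 : (b : S) * c = a := by
    apply hinj'
    rw [map_mul, hc, ← hψ, ← hψ, ← map_mul, mul_div_cancel₀]
    exact (map_ne_zero_iff _ hinjR).mpr hb0
  have hcR : c ∈ constants D E := by
    refine mem_constants_of_mul_mem D E b.2 ?_ (h2 ▸ a.2)
    exact fun h => hb0 (Subtype.ext h)
  refine ⟨⟨c, hcR⟩, ?_⟩
  rw [eq_div_iff ((map_ne_zero_iff _ hinjR).mpr hb0), ← map_mul]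
  congr 1
  apply Subtype.ext
  rw [← h2, mul_comm]
  rfl

/-- All `p`-th powers are constants, so `S` is finite over the constants and the Artin–Tate lemma
applies. -/
theorem finiteType_constants (k : Type*) {A S : Type*} [Field k] [CommRing A] [CommRing S]
    [Algebra A S] [Algebra k A] [Algebra k S] [IsScalarTower k A S] (D E : Derivation A S S)
    [Algebra.FiniteType k S] (p : ℕ) [Fact p.Prime] [CharP S p] :
    Algebra.FiniteType k (constants D E) := by
  have h1 : (algebraMap (constants D E) S).Finite :=
    finite_of_pow_mem (k := k) (p := p) (Fact.out : p.Prime).ne_zero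
      (IsScalarTower.toAlgHom k (constants D E) S) fun b => ⟨⟨_, pow_mem_constants D E p b⟩, rfl⟩
  have h2 : Module.Finite (constants D E) S := h1
  refine ⟨fg_of_fg_of_fg k (constants D E) S Algebra.FiniteType.out Module.Finite.fg_top ?_⟩
  exact Subtype.val_injective

section
variable {A C : Type u} [CommRing A] [CommRing C] [Algebra A C]

/-- The constants, in the polynomial ring `C[y]`, of the extensions of `δ` and `ε` such that
`δ y = - t y` and `ε y = 0`. -/
abbrev twistedConstants (δ ε : Derivation A C C) (t : C) : Subalgebra A C[X] :=
  constants (extDer δ (-t)) (extDer ε 0)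

theorem mem_twistedConstants (δ ε : Derivation A C C) (t : C) (r : C[X]) :
    r ∈ twistedConstants δ ε t ↔ ∀ n : ℕ, δ (r.coeff n) = n * t * r.coeff n ∧ ε (r.coeff n) = 0 := by
  rw [twistedConstants, mem_constants, Polynomial.ext_iff, Polynomial.ext_iff, forall_and]
  simp only [coeff_extDer, coeff_zero, mul_zero, zero_mul, add_zero]
  refine and_congr_left fun _ => forall_congr' fun n => ?_
  rw [mul_neg, neg_mul, ← sub_eq_add_neg, sub_eq_zero]

end

/-! ### Eigenvectors of a derivation -/

section
variable {A C : Type*} [CommRing A] [CommRing C] [Algebra A C] (δ : Derivation A C C) (n : ℕ)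

/-- The projection of `δ g` to the eigenspace for `τ` of a derivation `δ` with
`δ ^ (n + 1) = τ ^ n δ`, up to a factor. -/
def eigen (τ g : C) : C := ∑ i ∈ Finset.range n, τ ^ (n - 1 - i) * δ^[i + 1] g

variable {δ n}

/-- The sum telescopes under `δ - τ`, leaving `δ ^ (n + 1) g - τ ^ n δ g = 0`. -/
theorem der_eigen {τ g : C} (hτ : δ τ = 0) (hg : δ^[n + 1] g = τ ^ n * δ g) :
    δ (eigen δ n τ g) = τ * eigen δ n τ g := by
  have h1 : δ (eigen δ n τ g) = ∑ i ∈ Finset.range n, τ ^ (n - (i + 1)) * δ^[i + 1 + 1] g := by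
    rw [eigen, map_sum]
    refine Finset.sum_congr rfl fun i _ => ?_
    rw [Derivation.leibniz, Derivation.leibniz_pow, hτ, Function.iterate_succ_apply' δ (i + 1)]
    simp [Nat.sub_sub, add_comm]
  have h2 : τ * eigen δ n τ g = ∑ i ∈ Finset.range n, τ ^ (n - i) * δ^[i + 1] g := by
    rw [eigen, Finset.mul_sum]
    refine Finset.sum_congr rfl fun i hi => ?_
    rw [Finset.mem_range] at hi
    rw [← mul_assoc, ← pow_succ']
    congr 2
    omega
  have h3 := Finset.sum_range_succ (fun i => τ ^ (n - i) * δ^[i + 1] g) n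
  have h4 := Finset.sum_range_succ' (fun i => τ ^ (n - i) * δ^[i + 1] g) n
  rw [h1, h2]
  simp only [Nat.sub_self, pow_zero, one_mul, hg, Nat.sub_zero, zero_add, Function.iterate_one] at h3 h4
  exact add_right_cancel (h4.symm.trans h3)

theorem euler_iterate {ε : Derivation A C C} (hcomm : ∀ g, ε (δ g) = δ (ε g) + δ g) {g : C} {w : ℕ}
    (hg : ε g = w * g) (i : ℕ) : ε (δ^[i] g) = (w + i : ℕ) * δ^[i] g := by
  induction i with
  | zero => simpa using hg
  | succ i ih =>
    rw [Function.iterate_succ_apply', hcomm, ih, Derivation.leibniz, Derivation.map_natCast]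
    push_cast
    simp
    ring

theorem euler_eigen {ε : Derivation A C C} (hcomm : ∀ g, ε (δ g) = δ (ε g) + δ g) {τ g : C} {w : ℕ}
    (hg : ε g = w * g) (hτ : ε τ = τ) : ε (eigen δ n τ g) = (w + n : ℕ) * eigen δ n τ g := by
  rw [eigen, map_sum, Finset.mul_sum]
  refine Finset.sum_congr rfl fun i hi => ?_
  rw [Finset.mem_range] at hi
  rw [Derivation.leibniz, euler_iterate hcomm hg, Derivation.leibniz_pow, hτ]
  obtain ⟨j, hj⟩ := Nat.exists_eq_add_of_lt hi
  have e : n - 1 - i = j := by omega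
  rw [e, hj]
  cases j with
  | zero => simp
  | succ j =>
    simp only [nsmul_eq_mul, smul_eq_mul, Nat.add_sub_cancel]
    push_cast
    ring

theorem eigen_sub_mem (I : Ideal C) {τ g : C} (hτ : τ ∈ I) (hn : 0 < n) :
    eigen δ n τ g - δ^[n] g ∈ I := by
  obtain ⟨n, rfl⟩ := Nat.exists_eq_succ_of_ne_zero hn.ne'
  rw [eigen, Finset.sum_range_succ]
  have h : ∑ i ∈ Finset.range n, τ ^ (n + 1 - 1 - i) * δ^[i + 1] g ∈ I := by
    refine sum_mem fun i hi => I.mul_mem_right _ (Ideal.pow_mem_of_mem I hτ _ ?_)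
    rw [Finset.mem_range] at hi
    omega
  simpa using h

/-- An ideal which contains all the eigencomponents of `δ g` contains `δ g`. -/
theorem der_mem_of_forall_eigen_mem (hn : 0 < n) (I : Ideal C) [I.IsPrime] {t g : C} (ht : t ∉ I) {c : Fin n → C}
    (hc : ∀ i j, i ≠ j → c i - c j ∉ I) (h : ∀ j, eigen δ n (c j * t) g ∈ I) : δ g ∈ I := by
  let π := Ideal.Quotient.mk I
  have hπ : ∀ a, π a = 0 ↔ a ∈ I := fun a => Ideal.Quotient.eq_zero_iff_mem
  -- The eigencomponents are values of one polynomial of degree less than `n` at `n` distinct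
  -- points. Hence it vanishes, and its top coefficient is `δ g`.
  let q : (C ⧸ I)[X] := ∑ i ∈ Finset.range n, X ^ (n - 1 - i) * Polynomial.C (π (δ^[i + 1] g))
  have hq : q = 0 := by
    refine eq_zero_of_natDegree_lt_card_of_eval_eq_zero q (f := fun j => π (c j * t)) ?_ ?_ ?_
    · intro i j hij
      by_contra hne
      have h1 : (c i - c j) * t ∈ I := by
        rw [sub_mul, ← hπ, map_sub, sub_eq_zero]; exact hij
      exact (Ideal.IsPrime.mem_or_mem ‹_› h1).elim (hc i j hne) ht
    · intro j
      rw [← (hπ _).mpr (h j), eigen, map_sum, eval_finsetSum]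
      simp only [eval_mul, eval_pow, eval_X, eval_C, map_mul, map_pow]
    · rw [Fintype.card_fin]
      refine lt_of_le_of_lt (natDegree_sum_le_of_forall_le _ _ (n := n - 1) fun i _ => ?_) (by omega)
      refine (natDegree_mul_C_le _ _).trans ((natDegree_X_pow_le _).trans (by omega))
  have h1 := congrArg (fun r => coeff r (n - 1)) hq
  rw [← hπ]
  simp only [q, finsetSum_coeff, coeff_mul_C, coeff_X_pow, coeff_zero] at h1
  rw [Finset.sum_eq_single 0] at h1
  · simpa using h1
  · intro i hi hi0
    rw [Finset.mem_range] at hi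
    rw [if_neg (by omega), zero_mul]
  · intro h0
    simp at h0
    omega

end

/-- At the roots `0`, `z²`, `l z²` the derivative of the cubic is `z⁴` times the unit `l`, `1 - l`,
`-l (1 - l)`: away from `z = 0` the cubic has simple roots. -/
theorem mem_of_cubic_mem {C : Type*} [CommRing C] (I : Ideal C) [hI : I.IsPrime] {l x z : C} (hl : IsUnit l)
    (hl' : IsUnit (1 - l)) (h1 : x * (x - z ^ 2) * (x - l * z ^ 2) ∈ I)
    (h2 : (x - z ^ 2) * (x - l * z ^ 2) + x * (x - l * z ^ 2) + x * (x - z ^ 2) ∈ I) : z ∈ I := by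
  have key : ∀ e w v : C, e ∈ I → IsUnit v → v * z ^ 4 = ((x - z ^ 2) * (x - l * z ^ 2) +
      x * (x - l * z ^ 2) + x * (x - z ^ 2)) - e * w → z ∈ I := by
    intro e w v he hv h
    have h3 : v * z ^ 4 ∈ I := h ▸ sub_mem h2 (I.mul_mem_right w he)
    rw [I.unit_mul_mem_iff_mem hv] at h3
    exact hI.mem_of_pow_mem 4 h3
  rcases hI.mem_or_mem h1 with h3 | h3
  · rcases hI.mem_or_mem h3 with h4 | h4
    · exact key x (3 * x - 2 * (1 + l) * z ^ 2) l h4 hl (by ring)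
    · exact key _ (3 * x - (2 * l - 1) * z ^ 2) (1 - l) h4 hl' (by ring)
  · exact key _ (3 * x + (l - 2) * z ^ 2) (-(l * (1 - l))) h3 (hl.mul hl').neg (by ring)

theorem der_pow {A C : Type*} [CommRing A] [CommRing C] [Algebra A C] (δ : Derivation A C C) {a c : C}
    (h : δ a = c * a) (n : ℕ) : δ (a ^ n) = n * c * a ^ n := by
  cases n with
  | zero => simp
  | succ n => simp only [Derivation.leibniz_pow, h, nsmul_eq_mul, smul_eq_mul, Nat.add_sub_cancel]; ring

theorem der_mul {A C : Type*} [CommRing A] [CommRing C] [Algebra A C] (δ : Derivation A C C) {a b c d : C}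
    (h : δ a = c * a) (h' : δ b = d * b) : δ (a * b) = (c + d) * (a * b) := by
  simp only [Derivation.leibniz, h, h', smul_eq_mul]; ring

/-! ### Eigenvectors on the cone -/

namespace IsEllipticCone

variable {k A C : Type u} [Field k] [CommRing A] [CommRing C] [Algebra k C]
  [Algebra A C] {p m : ℕ} {l u : A} {x z Y : C} {δ ε : Derivation A C C}


/-- The field `δ` raises the weight by one, which is checked on `x`, `z`, `Y`. -/
theorem euler_comm (h : IsEllipticCone k m l u x z Y δ ε) (g : C) : ε (δ g) = δ (ε g) + δ g := by
  have h1 : ⁅ε, δ⁆ = δ := by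
    refine Derivation.ext_of_adjoin_eq_top _ h.adjoin_eq_top ?_
    have h2 : ∀ n : ℕ, δ (OfNat.ofNat (n + 2)) = 0 ∧ ε (OfNat.ofNat (n + 2)) = 0 := fun n =>
      ⟨δ.map_natCast (n + 2), ε.map_natCast (n + 2)⟩
    rintro g (rfl | rfl | rfl) <;> rw [Derivation.commutator_apply]
    · rw [h.der_x, h.euler_x]
      simp only [Derivation.leibniz, h.der_x, h.euler_Y, smul_eq_mul, (h2 0).1, (h2 0).2]
      ring
    · rw [h.der_z, h.euler_z, h.der_z]
      simp
    · rw [h.der_Y, h.euler_Y]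
      simp only [Derivation.leibniz, h.der_Y, smul_eq_mul, (h2 1).1, map_add, map_sub,
        Derivation.leibniz_pow, h.euler_x, h.euler_z, Derivation.map_algebraMap]
      simp
      ring
  have h2 := congrArg (fun d : Derivation A C C => d g) h1
  simp only [Derivation.commutator_apply] at h2
  linear_combination h2

theorem der_t (h : IsEllipticCone k m l u x z Y δ ε) : δ (algebraMap A C u * z) = 0 := by
  rw [Derivation.leibniz, h.der_z, Derivation.map_algebraMap]; simp

theorem euler_t (h : IsEllipticCone k m l u x z Y δ ε) : ε (algebraMap A C u * z) = algebraMap A C u * z := by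
  rw [Derivation.leibniz, h.euler_z, Derivation.map_algebraMap]; simp

/-- The eigenvector of the invariant vector field which gives the function `F = h y`. -/
def eigenvector (_h : IsEllipticCone k m l u x z Y δ ε) : C :=
  eigen δ (2 * m) (algebraMap A C u * z) (x ^ (m + 1))

theorem der_eigenvector (h : IsEllipticCone k m l u x z Y δ ε) : δ h.eigenvector = algebraMap A C u * z * h.eigenvector :=
  der_eigen h.der_t (h.iterate _)

theorem euler_iterate_x_pow (h : IsEllipticCone k m l u x z Y δ ε) (i : ℕ) :
    ε (δ^[i] (x ^ (m + 1))) = (2 * (m + 1) + i : ℕ) * δ^[i] (x ^ (m + 1)) := by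
  refine euler_iterate h.euler_comm ?_ i
  rw [der_pow ε h.euler_x]
  push_cast
  ring

theorem two_mul_add_one_eq_zero [CharP C p] (hpm : p = 2 * m + 1) : (2 * m + 1 : C) = 0 := by
  have := CharP.cast_eq_zero C p
  rw [hpm] at this
  exact_mod_cast this

theorem euler_eigenvector (h : IsEllipticCone k m l u x z Y δ ε) [CharP C p] (hpm : p = 2 * m + 1) : ε h.eigenvector = 0 := by
  have h0 := two_mul_add_one_eq_zero (C := C) hpm
  have h1 := h.euler_iterate_x_pow 0
  rw [Function.iterate_zero_apply] at h1
  rw [eigenvector, euler_eigen h.euler_comm h1 h.euler_t]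
  push_cast
  linear_combination 2 * eigen δ (2 * m) (algebraMap A C u * z) (x ^ (m + 1)) * h0

/-- The reduction of the eigenvector modulo `u`. -/
def conductor (_h : IsEllipticCone k m l u x z Y δ ε) : C :=
  δ^[2 * m] (x ^ (m + 1)) - (algebraMap A C u * z) ^ (2 * m) * x ^ (m + 1)

/-- This is `δ ^ p = t ^ (p - 1) δ` applied to `x ^ (m + 1)`. -/
theorem der_conductor (h : IsEllipticCone k m l u x z Y δ ε) : δ h.conductor = 0 := by
  rw [conductor, map_sub, ← Function.iterate_succ_apply' δ, h.iterate,
    Derivation.leibniz (a := (algebraMap A C u * z) ^ (2 * m)),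
    der_pow δ (h.der_t.trans (zero_mul _).symm)]
  simp

theorem euler_conductor (h : IsEllipticCone k m l u x z Y δ ε) [CharP C p] (hpm : p = 2 * m + 1) : ε h.conductor = 0 := by
  have h0 := two_mul_add_one_eq_zero (C := C) hpm
  have h1 := h.euler_iterate_x_pow (2 * m)
  rw [conductor, map_sub, h1, der_mul ε (der_pow ε (h.euler_t.trans (one_mul _).symm) (2 * m))
    (der_pow ε h.euler_x (m + 1))]
  push_cast
  linear_combination 2 * (δ^[2 * m] (x ^ (m + 1)) - (algebraMap A C u * z) ^ (2 * m) * x ^ (m + 1)) * h0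

/-- Modulo `t = u z` only the last term `δ ^ (2m) (x ^ (m + 1))` of the eigenvector is left. -/
theorem not_dvd_eigenvector (h : IsEllipticCone k m l u x z Y δ ε) (hm : m ≠ 0) {π : C} (hπ : π ∣ algebraMap A C u * z)
    (h1 : ¬ π ∣ δ^[2 * m] (x ^ (m + 1))) : ¬ π ∣ h.eigenvector := by
  intro h2
  have h3 := eigen_sub_mem (δ := δ) (n := 2 * m) (Ideal.span {π}) (g := x ^ (m + 1))
    (Ideal.mem_span_singleton.mpr hπ) (by omega)
  rw [Ideal.mem_span_singleton] at h3
  exact h1 ((dvd_sub_right h2).mp h3)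

theorem not_dvd_conductor (h : IsEllipticCone k m l u x z Y δ ε) (hm : m ≠ 0) : ¬ algebraMap A C u ∣ h.conductor := by
  intro h2
  refine h.not_dvd_u ((dvd_sub_left ?_).mp h2)
  exact Dvd.dvd.mul_right ((Dvd.intro _ rfl).trans (dvd_pow_self _ (by omega))) _

theorem dvd_eigenvector_sub_conductor (h : IsEllipticCone k m l u x z Y δ ε) (hm : m ≠ 0) :
    algebraMap A C u ∣ h.eigenvector - h.conductor := by
  have h3 := eigen_sub_mem (δ := δ) (n := 2 * m) (Ideal.span {algebraMap A C u}) (g := x ^ (m + 1))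
    (τ := algebraMap A C u * z) (Ideal.mem_span_singleton.mpr (Dvd.intro _ rfl)) (by omega)
  rw [Ideal.mem_span_singleton] at h3
  rw [conductor, ← sub_add]
  exact dvd_add h3 (Dvd.dvd.mul_right ((Dvd.intro _ rfl).trans (dvd_pow_self _ (by omega))) _)

/-- An eigenvector with nonzero eigenvalue can be normalized. -/
theorem exists_pow_mul_pow (h : IsEllipticCone k m l u x z Y δ ε) [Fact p.Prime] [CharP C p] {j w : ℕ} (hj : ¬ p ∣ j) {q : C}
    (hq : δ q = j * (algebraMap A C u * z) * q) (hq' : ε q = w * q) :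
    ∃ i n : ℕ, δ (q ^ i * z ^ n) = algebraMap A C u * z * (q ^ i * z ^ n) ∧
      ε (q ^ i * z ^ n) = 0 := by
  have hj' : (j : ZMod p) ≠ 0 := by rwa [Ne, ZMod.natCast_eq_zero_iff]
  have h1 : (((j : ZMod p)⁻¹.val * j : ℕ) : C) = 1 := by
    have h2 : (((j : ZMod p)⁻¹.val * j : ℕ) : ZMod p) = 1 := by
      rw [Nat.cast_mul, ZMod.natCast_zmod_val, inv_mul_cancel₀ hj']
    have h3 := congrArg (ZMod.castHom (dvd_refl p) C) h2
    rwa [map_natCast, map_one] at h3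
  set i := (j : ZMod p)⁻¹.val
  -- The exponent `i` inverts `j` modulo `p` and so corrects the eigenvalue. The power of `z`, which
  -- `δ` kills, brings the weight to `p i w`, which is zero.
  refine ⟨i, (p - 1) * (i * w), ?_, ?_⟩
  · rw [der_mul δ (der_pow δ hq i) (der_pow δ (h.der_z.trans (zero_mul z).symm) _)]
    push_cast at h1
    linear_combination (algebraMap A C u * z * (q ^ i * z ^ ((p - 1) * (i * w)))) * h1
  · rw [der_mul ε (der_pow ε hq' i) (der_pow ε (h.euler_z.trans (one_mul z).symm) _)]
    have h4 : (i * w + ((p - 1) * (i * w) : ℕ) * 1 : C) = 0 := by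
      have h5 : ((i * w + (p - 1) * (i * w) : ℕ) : C) = 0 := by
        rw [CharP.cast_eq_zero_iff C p]
        refine ⟨i * w, ?_⟩
        obtain ⟨n, hn⟩ := Nat.exists_eq_succ_of_ne_zero (Fact.out : p.Prime).ne_zero
        rw [hn, Nat.succ_sub_one, Nat.succ_eq_add_one]
        ring
      push_cast at h5 ⊢
      linear_combination h5
    rw [h4, zero_mul]

/-- Where `t` is invertible, the nonzero eigenvalues of `δ` are `j t` with `1 ≤ j ≤ 2m`. If all such
components of `x` and of `Y` lay in `I`, so would `δ x = 2 Y` and `δ Y`. -/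
theorem exists_eigenvector_of_notMem (h : IsEllipticCone k m l u x z Y δ ε) [Fact p.Prime] [CharP C p] (hpm : p = 2 * m + 1)
    (hunit : ∀ n : ℕ, ¬ p ∣ n → IsUnit (n : C))
    (I : Ideal C) [hI : I.IsPrime] (ht : algebraMap A C u * z ∉ I) (hY : Y ∉ I ∨ δ Y ∉ I) :
    ∃ q, q ∉ I ∧ δ q = algebraMap A C u * z * q ∧ ε q = 0 := by
  have hp : p.Prime := Fact.out
  have hm : m ≠ 0 := by rintro rfl; exact hp.ne_one (by omega)
  have hz : z ∉ I := fun hz => ht (I.mul_mem_left _ hz)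
  have hj : ∀ j : Fin (2 * m), ¬ p ∣ (j : ℕ) + 1 := fun j hj => by
    have := Nat.le_of_dvd (by omega) hj
    omega
  have key : ∀ (g : C) (w : ℕ), ε g = w * g → δ g ∉ I →
      ∃ q, q ∉ I ∧ δ q = algebraMap A C u * z * q ∧ ε q = 0 := by
    intro g w hw hg
    obtain ⟨j, hj1⟩ : ∃ j : Fin (2 * m),
        eigen δ (2 * m) (((j : ℕ) + 1 : ℕ) * (algebraMap A C u * z)) g ∉ I := by
      by_contra! hcon
      refine hg (der_mem_of_forall_eigen_mem (by omega) I ht (c := fun j => (((j : ℕ) + 1 : ℕ) : C))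
        ?_ hcon)
      have hlt : ∀ i j : Fin (2 * m), i < j → (((j : ℕ) + 1 : ℕ) : C) - (((i : ℕ) + 1 : ℕ) : C) ∉ I := by
        intro i j hij h1
        have h2 := Fin.lt_def.mp hij
        rw [← Nat.cast_sub (by omega)] at h1
        refine hI.ne_top (Ideal.eq_top_of_isUnit_mem _ h1 (hunit _ fun h3 => ?_))
        have := Nat.le_of_dvd (by omega) h3
        omega
      intro i j hij
      rcases lt_or_gt_of_ne hij with h1 | h1
      · rw [← neg_mem_iff, neg_sub]; exact hlt i j h1
      · exact hlt j i h1
    -- By Fermat, `j t` satisfies the same equation `δ ^ p = (j t) ^ (p - 1) δ` as `t`.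
    have hjp : (((j : ℕ) + 1 : ℕ) : C) ^ (2 * m) = 1 := by
      have h1 : ((((j : ℕ) + 1 : ℕ) : ZMod p)) ≠ 0 := by
        rw [Ne, ZMod.natCast_eq_zero_iff]; exact hj j
      have h2 := ZMod.pow_card_sub_one_eq_one h1
      have h3 := congrArg (ZMod.castHom (dvd_refl p) C) h2
      rwa [map_pow, map_natCast, map_one, show p - 1 = 2 * m by omega] at h3
    have hd : δ ((((j : ℕ) + 1 : ℕ) : C) * (algebraMap A C u * z)) = 0 := by
      rw [Derivation.leibniz, h.der_t, Derivation.map_natCast]; simp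
    have he : ε ((((j : ℕ) + 1 : ℕ) : C) * (algebraMap A C u * z)) =
        (((j : ℕ) + 1 : ℕ) : C) * (algebraMap A C u * z) := by
      rw [Derivation.leibniz, h.euler_t, Derivation.map_natCast]; simp
    obtain ⟨i, n, h1, h2⟩ := h.exists_pow_mul_pow (hj j)
      (der_eigen hd (by rw [h.iterate, mul_pow _ (algebraMap A C u * z), hjp, one_mul]))
      (euler_eigen h.euler_comm hw he)
    refine ⟨_, ?_, h1, h2⟩
    intro h3
    rcases hI.mem_or_mem h3 with h4 | h4
    · exact hj1 (hI.mem_of_pow_mem _ h4)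
    · exact hz (hI.mem_of_pow_mem _ h4)
  rcases hY with hY | hY
  · refine key x 2 (by rw [h.euler_x]; norm_num) ?_
    rw [h.der_x, I.unit_mul_mem_iff_mem]
    · exact hY
    · have := hunit 2 fun h2 => by have := Nat.le_of_dvd two_pos h2; omega
      exact_mod_cast this
  · exact key Y 3 (by rw [h.euler_Y]; norm_num) hY

end IsEllipticCone

theorem D_mem_of_mem_adjoin {k A R : Type*} [CommRing k] [CommRing A] [CommRing R] [Algebra k R]
    [Algebra A R] (N : Submodule R (Ω[R⁄k]))
    (hN : ∀ a : A, KaehlerDifferential.D k R (algebraMap A R a) ∈ N) {s : Set R}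
    (hs : ∀ r ∈ s, KaehlerDifferential.D k R r ∈ N) {r : R} (hr : r ∈ Algebra.adjoin A s) :
    KaehlerDifferential.D k R r ∈ N := by
  induction hr using Algebra.adjoin_induction with
  | mem x hx => exact hs x hx
  | algebraMap a => exact hN a
  | add x y _ _ hx hy => rw [map_add]; exact add_mem hx hy
  | mul x y _ _ hx hy => rw [Derivation.leibniz]; exact add_mem (N.smul_mem _ hy) (N.smul_mem _ hx)

/-! ### The coordinate ring of the fourfold -/

section
variable {A B : Type u} [CommRing A] [CommRing B] [Algebra A B]

/-- The coordinate ring of the fourfold. -/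
abbrev pinchRing (u : A) (z : B) (δ ε : Derivation A B B) : Subalgebra A B[X] :=
  twistedConstants δ ε (algebraMap A B u * z)

/-- The Frobenius map from the polynomial ring to the ring of constants. -/
abbrev pinchFrob (p : ℕ) [Fact p.Prime] [CharP B p] (u : A) (z : B) (δ ε : Derivation A B B) :
    B[X] →+* pinchRing u z δ ε :=
  frobConstants (extDer δ (-(algebraMap A B u * z))) (extDer ε 0) p

variable {u : A} {z : B} {δ ε : Derivation A B B}

theorem C_mem_pinchRing {a : B} (h1 : δ a = 0) (h2 : ε a = 0) : C a ∈ pinchRing u z δ ε := by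
  rw [mem_twistedConstants]
  intro n
  rw [coeff_C]
  split_ifs with h
  · subst h; simp [h1, h2]
  · simp

theorem C_mul_X_mem_pinchRing {q : B} (h1 : δ q = algebraMap A B u * z * q) (h2 : ε q = 0) :
    C q * X ∈ pinchRing u z δ ε := by
  rw [mem_twistedConstants]
  intro n
  rw [coeff_C_mul_X]
  split_ifs with h
  · subst h; simp [h1, h2]
  · simp

/-- The contraction of `(π)` to the constants is a nonzero prime contained in `P`, as `r = π s`
implies `r ^ p ∈ P`. Height one makes it equal to `P`. -/
theorem dvd_of_pinchFrob_mem [IsDomain B] {p : ℕ} [Fact p.Prime] [CharP B p]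
    (P : Ideal (pinchRing u z δ ε)) [hP : P.IsPrime] (hP1 : P.height = 1) {π : B} (hπ : Prime π)
    (hπP : pinchFrob p u z δ ε (C π) ∈ P) {a : B[X]} (ha : pinchFrob p u z δ ε a ∈ P) :
    C π ∣ a := by
  have hp : p ≠ 0 := (Fact.out : p.Prime).ne_zero
  have hπ' : Prime (C π) := prime_C_iff.mpr hπ
  have : (Ideal.span {C π}).IsPrime := (Ideal.span_singleton_prime hπ'.ne_zero).mpr hπ'
  let Q : Ideal (pinchRing u z δ ε) := (Ideal.span {C π}).comap (algebraMap (pinchRing u z δ ε) B[X])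
  have hQ : Q.IsPrime := Ideal.comap_isPrime _ _
  have hQP : Q ≤ P := by
    intro r hr
    obtain ⟨s, hs⟩ := Ideal.mem_span_singleton.mp (Ideal.mem_comap.mp hr)
    have h1 : pinchFrob p u z δ ε (r : B[X]) ∈ P := by
      rw [show (r : B[X]) = C π * s from hs, map_mul]
      exact P.mul_mem_right _ hπP
    rw [frobConstants_coe] at h1
    exact hP.mem_of_pow_mem _ h1
  have hQb : Q ≠ ⊥ := by
    intro hb
    have h1 : pinchFrob p u z δ ε (C π) ∈ Q := by
      refine Ideal.mem_comap.mpr (Ideal.mem_span_singleton.mpr ?_)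
      exact dvd_pow_self (C π) hp
    rw [hb, Ideal.mem_bot] at h1
    have h2 : (C π) ^ p = 0 := congrArg Subtype.val h1
    exact hπ'.ne_zero (pow_eq_zero_iff hp |>.mp h2)
  have hQeq : Q = P := by
    by_contra hne
    have : P.FiniteHeight := ⟨Or.inr (by rw [hP1]; exact ENat.one_ne_top)⟩
    have h1 := Ideal.height_strict_mono_of_isPrime_of_isPrime (lt_of_le_of_ne hQP hne)
    rw [hP1, Order.lt_one_iff, Ideal.height_eq_zero_iff_eq_bot] at h1
    exact hQb h1
  rw [← hQeq] at ha
  have h1 : C π ∣ a ^ p := Ideal.mem_span_singleton.mp (Ideal.mem_comap.mp ha)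
  exact hπ'.dvd_of_dvd_pow h1

end

namespace IsEllipticCone

variable {k A B : Type u} [Field k] [CommRing A] [CommRing B] [Algebra k A] [Algebra k B]
  [Algebra A B] [IsScalarTower k A B] {p m : ℕ} [Fact p.Prime] [CharP B p]
  {l u : A} {x z Y : B} {δ ε : Derivation A B B}

/-- Along `u = 0` and `z = 0` the standard eigenvector works, being divisible by neither. At other
primes of height one `t` is invertible, and the smoothness of the cubic away from `z = 0` shows that
`Y` or `δ Y` survives. -/
theorem exists_eigenvector (h : IsEllipticCone k m l u x z Y δ ε) (hpm : p = 2 * m + 1)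
    (hl : IsUnit l) (hl' : IsUnit (1 - l)) (P : Ideal (pinchRing u z δ ε)) [hP : P.IsPrime]
    (hP1 : P = ⊥ ∨ P.height = 1) : ∃ q, δ q = algebraMap A B u * z * q ∧ ε q = 0 ∧
      pinchFrob p u z δ ε (C q) ∉ P ∧
      (pinchFrob p u z δ ε (C Y) ∉ P ∨ pinchFrob p u z δ ε (C (δ Y)) ∉ P) := by
  have hp : p.Prime := Fact.out
  have hm : m ≠ 0 := by rintro rfl; exact hp.ne_one (by omega)
  have := h.isDomain
  let I : Ideal B := P.comap ((pinchFrob p u z δ ε).comp C)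
  have hI : I.IsPrime := Ideal.comap_isPrime _ _
  have hmem : ∀ a, pinchFrob p u z δ ε (C a) ∈ P ↔ a ∈ I := fun a => Iff.rfl
  have hunit : ∀ n : ℕ, ¬ p ∣ n → IsUnit (n : B) := by
    intro n hn
    have h1 := (ZMod.isUnit_iff_coprime n p).mpr ((hp.coprime_iff_not_dvd.mpr hn).symm)
    have h2 := h1.map (ZMod.castHom (dvd_refl p) B)
    rwa [map_natCast] at h2
  simp only [hmem]
  have hspecial : ∀ π, Prime π → π ∈ I → P.height = 1 → ∀ a, ¬ π ∣ a → a ∉ I := by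
    intro π hπ hπI hP1 a ha haI
    exact ha (C_dvd_iff_dvd_coeff _ _ |>.mp (dvd_of_pinchFrob_mem P hP1 hπ hπI haI) 0 |>.trans (by simp))
  rcases hP1 with rfl | hP1
  · have hbot : ∀ a, a ∈ I → a = 0 := by
      intro a ha
      have h1 : pinchFrob p u z δ ε (C a) = 0 := ha
      have h2 : (C a) ^ p = 0 := congrArg Subtype.val h1
      exact C_eq_zero.mp (pow_eq_zero_iff hp.ne_zero |>.mp h2)
    refine ⟨h.eigenvector, h.der_eigenvector, h.euler_eigenvector hpm, fun h1 => ?_,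
      Or.inl fun h1 => ?_⟩
    · refine h.not_dvd_eigenvector hm (Dvd.intro _ rfl) h.not_dvd_u ?_
      rw [hbot _ h1]; exact dvd_zero _
    · exact h.not_dvd_Y_u (by rw [hbot _ h1]; exact dvd_zero _)
  by_cases hu : algebraMap A B u ∈ I
  · exact ⟨h.eigenvector, h.der_eigenvector, h.euler_eigenvector hpm,
      hspecial _ h.prime_u hu hP1 _ (h.not_dvd_eigenvector hm (Dvd.intro _ rfl) h.not_dvd_u),
      Or.inl (hspecial _ h.prime_u hu hP1 _ h.not_dvd_Y_u)⟩
  by_cases hz : z ∈ I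
  · exact ⟨h.eigenvector, h.der_eigenvector, h.euler_eigenvector hpm,
      hspecial _ h.prime_z hz hP1 _ (h.not_dvd_eigenvector hm (Dvd.intro_left _ rfl) h.not_dvd_z),
      Or.inl (hspecial _ h.prime_z hz hP1 _ h.not_dvd_Y_z)⟩
  have hY : Y ∉ I ∨ δ Y ∉ I := by
    by_contra! hcon
    obtain ⟨h1, h2⟩ := hcon
    refine hz (mem_of_cubic_mem I (hl.map (algebraMap A B)) (l := algebraMap A B l) (x := x) ?_ ?_ ?_)
    · have := hl'.map (algebraMap A B)
      rwa [map_sub, map_one] at this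
    · rw [← h.sq_eq, pow_two]; exact I.mul_mem_left _ h1
    · rw [← h.der_Y]; exact h2
  obtain ⟨q, h1, h2, h3⟩ := h.exists_eigenvector_of_notMem hpm hunit I
    (fun h1 => (hI.mem_or_mem h1).elim hu hz) hY
  exact ⟨q, h2, h3, h1, hY⟩

variable (p) in
theorem mem_adjoin_pinchRing (h : IsEllipticCone k m l u x z Y δ ε) (hpm : p = 2 * m + 1) {e : B}
    (h1 : δ e = 0) (h2 : ε e = 0) : (⟨C e, C_mem_pinchRing h1 h2⟩ : pinchRing u z δ ε) ∈
      Algebra.adjoin A {pinchFrob p u z δ ε (C x), pinchFrob p u z δ ε (C z),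
        pinchFrob p u z δ ε (C Y)} := by
  have h3 := h.mem_adjoin e h1 h2
  have h4 : C e ∈ (Algebra.adjoin A {x ^ (2 * m + 1), z ^ (2 * m + 1), Y ^ (2 * m + 1)}).map
    (CAlgHom : B →ₐ[A] B[X]) := ⟨e, h3, rfl⟩
  rw [AlgHom.map_adjoin] at h4
  have h5 : (CAlgHom : B →ₐ[A] B[X]) '' {x ^ (2 * m + 1), z ^ (2 * m + 1), Y ^ (2 * m + 1)} =
      (pinchRing u z δ ε).val '' {pinchFrob p u z δ ε (C x), pinchFrob p u z δ ε (C z),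
        pinchFrob p u z δ ε (C Y)} := by
    rw [Set.image_insert_eq, Set.image_insert_eq, Set.image_singleton, Set.image_insert_eq,
      Set.image_insert_eq, Set.image_singleton, ← hpm]
    simp only [Subalgebra.coe_val, coe_frobConstants, CAlgHom_apply, C_pow]
  rw [h5, ← AlgHom.map_adjoin] at h4
  obtain ⟨r, hr, hr'⟩ := h4
  have h6 : r = ⟨C e, C_mem_pinchRing h1 h2⟩ := Subtype.ext hr'
  rwa [← h6]

/-- Up to powers of `q ^ p`, the function `q y` together with constants of the cone generates
everything: `q ^ (p n) rᵢ y ^ i = (q ^ (p n - i) rᵢ) (q y) ^ i`. -/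
theorem exists_pow_mul_mem_adjoin (h : IsEllipticCone k m l u x z Y δ ε) (hpm : p = 2 * m + 1) {q : B}
    (h1 : δ q = algebraMap A B u * z * q) (h2 : ε q = 0) (r : pinchRing u z δ ε) :
    ∃ n : ℕ, pinchFrob p u z δ ε (C q) ^ n * r ∈
      Algebra.adjoin A {pinchFrob p u z δ ε (C x), pinchFrob p u z δ ε (C z),
        pinchFrob p u z δ ε (C Y), ⟨C q * X, C_mul_X_mem_pinchRing h1 h2⟩} := by
  have hp : p.Prime := Fact.out
  have hpC : (p : B) = 0 := CharP.cast_eq_zero B p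
  set n := (r : B[X]).natDegree
  have hr := (mem_twistedConstants δ ε _ _).mp r.2
  set K := Algebra.adjoin A {pinchFrob p u z δ ε (C x), pinchFrob p u z δ ε (C z),
        pinchFrob p u z δ ε (C Y), ⟨C q * X, C_mul_X_mem_pinchRing h1 h2⟩}
  refine ⟨n, ?_⟩
  have hle : ∀ i ∈ Finset.range (n + 1), i ≤ p * n := fun i hi => by
    rw [Finset.mem_range] at hi
    have := Nat.le_mul_of_pos_left n hp.pos
    omega
  -- The power of `q` has eigenvalue `(p n - i) t = -i t`, opposite to that of the `i`-th
  -- coefficient.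
  have he : ∀ i ∈ Finset.range (n + 1), δ (q ^ (p * n - i) * (r : B[X]).coeff i) = 0 ∧
      ε (q ^ (p * n - i) * (r : B[X]).coeff i) = 0 := by
    intro i hi
    have h3 : (((p * n - i : ℕ) : B) + i) = 0 := by
      rw [Nat.cast_sub (hle i hi), Nat.cast_mul, hpC]; ring
    constructor
    · rw [der_mul δ (der_pow δ h1 _) (hr i).1]
      linear_combination (algebraMap A B u * z * (q ^ (p * n - i) * (r : B[X]).coeff i)) * h3
    · rw [der_mul ε (der_pow ε (h2.trans (zero_mul _).symm) _) ((hr i).2.trans (zero_mul _).symm)]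
      simp
  have hsum : pinchFrob p u z δ ε (C q) ^ n * r = ∑ i ∈ (Finset.range (n + 1)).attach,
      (⟨C (q ^ (p * n - i) * (r : B[X]).coeff i), C_mem_pinchRing (he i i.2).1 (he i i.2).2⟩ *
        ⟨C q * X, C_mul_X_mem_pinchRing h1 h2⟩ ^ (i : ℕ) : pinchRing u z δ ε) := by
    apply Subtype.ext
    rw [MulMemClass.coe_mul, SubmonoidClass.coe_pow, coe_frobConstants]
    conv_lhs => rw [(r : B[X]).as_sum_range_C_mul_X_pow]
    rw [AddSubmonoidClass.coe_finsetSum, Finset.mul_sum, ← Finset.sum_attach]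
    refine Finset.sum_congr rfl fun i _ => ?_
    rw [MulMemClass.coe_mul, SubmonoidClass.coe_pow]
    change _ = C (q ^ (p * n - i) * (r : B[X]).coeff i) * (C q * X) ^ (i : ℕ)
    rw [← pow_mul, C_mul, C_pow, mul_pow]
    have h4 : C q ^ (p * n) = C q ^ (p * n - i) * C q ^ (i : ℕ) := by
      rw [← pow_add, Nat.sub_add_cancel (hle i i.2)]
    rw [h4]
    ring
  rw [hsum]
  refine sum_mem fun i _ => mul_mem ?_ (pow_mem (Algebra.subset_adjoin (by simp)) _)
  refine Algebra.adjoin_mono ?_ (h.mem_adjoin_pinchRing p hpm (he i i.2).1 (he i i.2).2)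
  intro a ha
  simp only [Set.mem_insert_iff, Set.mem_singleton_iff] at ha ⊢
  tauto

end IsEllipticCone

/-! ### Coordinates on the fourfold in codimension one -/

theorem smul_wedge_eq_of_smul_D_eq {k L : Type*} [Field k] [Field L] [Algebra k L]
    {U F F' X W Z Q e γ c c' : L} (hQ : Q ≠ 0) (hγ : γ ≠ 0)
    (hF : Q • KaehlerDifferential.D k L F - e • KaehlerDifferential.D k L F' ∈ Submodule.span L
      {KaehlerDifferential.D k L U, KaehlerDifferential.D k L X, KaehlerDifferential.D k L Z})
    (hX : γ • KaehlerDifferential.D k L X = c • KaehlerDifferential.D k L W +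
      c' • KaehlerDifferential.D k L Z) :
    (Q * γ) • wedge k ![U, F, X, Z] = (e * c) • wedge k ![U, F', W, Z] := by
  obtain ⟨α, β, ζ, h⟩ := Submodule.mem_span_triple.mp hF
  have hX' : KaehlerDifferential.D k L X = (γ⁻¹ * c) • KaehlerDifferential.D k L W +
      (γ⁻¹ * c') • KaehlerDifferential.D k L Z := by
    rw [mul_smul, mul_smul, ← smul_add, ← hX, smul_smul, inv_mul_cancel₀ hγ, one_smul]
  have hF' : KaehlerDifferential.D k L F = (Q⁻¹ * α) • KaehlerDifferential.D k L U +
      (Q⁻¹ * e) • KaehlerDifferential.D k L F' +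
      (Q⁻¹ * β * (γ⁻¹ * c)) • KaehlerDifferential.D k L W +
      (Q⁻¹ * (β * (γ⁻¹ * c') + ζ)) • KaehlerDifferential.D k L Z := by
    have h1 : KaehlerDifferential.D k L F = Q⁻¹ • (Q • KaehlerDifferential.D k L F) := by
      rw [smul_smul, inv_mul_cancel₀ hQ, one_smul]
    rw [h1, ← sub_add_cancel (Q • KaehlerDifferential.D k L F) (e • KaehlerDifferential.D k L F'), ← h,
      hX']
    module
  rw [wedge, wedge, ιMulti_eq_det_smul (fun i => KaehlerDifferential.D k L (![U, F', W, Z] i))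
    (fun i => KaehlerDifferential.D k L (![U, F, X, Z] i))
    !![1, 0, 0, 0; Q⁻¹ * α, Q⁻¹ * e, Q⁻¹ * β * (γ⁻¹ * c), Q⁻¹ * (β * (γ⁻¹ * c') + ζ);
      0, 0, γ⁻¹ * c, γ⁻¹ * c'; 0, 0, 0, 1], smul_smul]
  · congr 1
    simp [Matrix.det_succ_row_zero, Fin.sum_univ_succ, Fin.succAbove]
    field_simp
  · intro i
    fin_cases i
    · simp [Fin.sum_univ_four]
    · simp [Fin.sum_univ_four, hF']
    · simp [Fin.sum_univ_four, hX']
    · simp [Fin.sum_univ_four]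


theorem D_pow_char {k R : Type*} [CommRing k] [CommRing R] [Algebra k R] {p : ℕ}
    (hp : (p : R) = 0) (r : R) : KaehlerDifferential.D k R (r ^ p) = 0 := by
  rw [Derivation.leibniz_pow, ← Nat.cast_smul_eq_nsmul R, hp, zero_smul]

theorem exists_smul_D_eq {k R : Type*} [CommRing k] [CommRing R] [Algebra k R] {X Y Z L : R}
    (hL : KaehlerDifferential.D k R L = 0) (hY : Y ^ 2 = X * (X - Z ^ 2) * (X - L * Z ^ 2)) :
    ∃ c : R, (2 * Y) • KaehlerDifferential.D k R Y =
      ((X - Z ^ 2) * (X - L * Z ^ 2) + X * (X - L * Z ^ 2) + X * (X - Z ^ 2)) •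
        KaehlerDifferential.D k R X + c • KaehlerDifferential.D k R Z := by
  have h := congrArg (KaehlerDifferential.D k R) hY
  simp only [Derivation.leibniz, Derivation.leibniz_pow, map_sub, hL, smul_zero, add_zero,
    ← Nat.cast_smul_eq_nsmul R] at h
  push_cast at h
  refine ⟨-(2 * Z * X * (X - L * Z ^ 2)) - 2 * L * Z * X * (X - Z ^ 2), ?_⟩
  linear_combination (norm := module) h

section
variable {k A : Type*} [Field k] [CommRing A] [Algebra k A]

theorem D_algebraMap_mem_span {R : Type*} [CommRing R] [Algebra k R] [Algebra A R]
    [IsScalarTower k A R] {u : A}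
    (hu : ∀ a : A, KaehlerDifferential.D k A a ∈ Submodule.span A {KaehlerDifferential.D k A u})
    (a : A) : KaehlerDifferential.D k R (algebraMap A R a) ∈
      Submodule.span R {KaehlerDifferential.D k R (algebraMap A R u)} := by
  obtain ⟨c, hc⟩ := Submodule.mem_span_singleton.mp (hu a)
  have h := congrArg (KaehlerDifferential.map k k A R) hc
  rw [map_smul, KaehlerDifferential.map_D, KaehlerDifferential.map_D] at h
  rw [← h, ← algebraMap_smul R c]
  exact Submodule.smul_mem _ _ (Submodule.mem_span_singleton_self _)

/-- If `Qⁿ r` is a polynomial in functions whose differentials lie in `N` after multiplication by `κ`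
then so does `r`. -/
theorem smul_D_mem_of_pow_mul_mem_adjoin {R : Type*} [CommRing R] [Algebra k R] [Algebra A R]
    (N : Submodule R (Ω[R⁄k])) (κ : R)
    (hN : ∀ a : A, KaehlerDifferential.D k R (algebraMap A R a) ∈ N) {s : Set R}
    (hs : ∀ r ∈ s, κ • KaehlerDifferential.D k R r ∈ N) {Q r : R} {n : ℕ}
    (hQ : Q ∈ Algebra.adjoin A s) (hr : Q ^ n * r ∈ Algebra.adjoin A s) :
    (κ * Q ^ n) • KaehlerDifferential.D k R r ∈ N := by
  let N' : Submodule R (Ω[R⁄k]) := N.comap (LinearMap.lsmul R (Ω[R⁄k]) κ)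
  have hN' : ∀ a : A, KaehlerDifferential.D k R (algebraMap A R a) ∈ N' := fun a =>
    N.smul_mem κ (hN a)
  have h1 := D_mem_of_mem_adjoin N' hN' hs hr
  have h2 := D_mem_of_mem_adjoin N' hN' hs (pow_mem hQ n)
  rw [Derivation.leibniz] at h1
  have h3 : Q ^ n • KaehlerDifferential.D k R r ∈ N' := by
    have := sub_mem h1 (N'.smul_mem r h2)
    rwa [add_sub_cancel_right] at this
  rw [mul_smul]
  exact h3

end

namespace IsEllipticCone

variable {k A B : Type u} [Field k] [CommRing A] [CommRing B] [Algebra k A] [Algebra k B]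
  [Algebra A B] [IsScalarTower k A B] {p m : ℕ} [Fact p.Prime] [CharP B p]
  {l u : A} {x z Y : B} {δ ε : Derivation A B B}

variable (p) in
/-- The equation of the Frobenius twist of the cone. -/
theorem pinchFrob_sq_eq (h : IsEllipticCone k m l u x z Y δ ε) :
    pinchFrob p u z δ ε (C Y) ^ 2 = pinchFrob p u z δ ε (C x) *
      (pinchFrob p u z δ ε (C x) - pinchFrob p u z δ ε (C z) ^ 2) *
      (pinchFrob p u z δ ε (C x) - algebraMap A (pinchRing u z δ ε) l ^ p *
        pinchFrob p u z δ ε (C z) ^ 2) := by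
  have h1 : algebraMap A (pinchRing u z δ ε) l ^ p =
    pinchFrob p u z δ ε (C (algebraMap A B l)) := Subtype.ext rfl
  simp only [h1, ← map_pow, ← map_mul, ← map_sub]
  rw [h.sq_eq]

variable (p) in
theorem pinchFrob_der_Y (h : IsEllipticCone k m l u x z Y δ ε) :
    pinchFrob p u z δ ε (C (δ Y)) =
      (pinchFrob p u z δ ε (C x) - pinchFrob p u z δ ε (C z) ^ 2) * (pinchFrob p u z δ ε (C x) -
        algebraMap A (pinchRing u z δ ε) l ^ p * pinchFrob p u z δ ε (C z) ^ 2) +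
      pinchFrob p u z δ ε (C x) * (pinchFrob p u z δ ε (C x) -
        algebraMap A (pinchRing u z δ ε) l ^ p * pinchFrob p u z δ ε (C z) ^ 2) +
      pinchFrob p u z δ ε (C x) * (pinchFrob p u z δ ε (C x) - pinchFrob p u z δ ε (C z) ^ 2) := by
  have h1 : algebraMap A (pinchRing u z δ ε) l ^ p =
    pinchFrob p u z δ ε (C (algebraMap A B l)) := Subtype.ext rfl
  simp only [h1, ← map_pow, ← map_mul, ← map_sub, ← map_add]
  rw [h.der_Y]

end IsEllipticCone

end

section
variable {k A R : Type u} [Field k] [CommRing A] [CommRing R] [Algebra k A] [Algebra k R]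
  [Algebra A R] [IsScalarTower k A R] {u : A}
  {X Y Z l G Q f : R}

theorem exists_smul_D_mem_span_left
  (hu : ∀ a : A, KaehlerDifferential.D k A a ∈ Submodule.span A {KaehlerDifferential.D k A u})
  (hl : KaehlerDifferential.D k R l = 0)
  (hY : Y ^ 2 = X * (X - Z ^ 2) * (X - l * Z ^ 2))
  (hQ : Q ∈ Algebra.adjoin A {X, Z, Y})
  (hR : ∀ r : R, ∃ n : ℕ, Q ^ n * r ∈ Algebra.adjoin A {X, Z, Y, f}) (r : R) :
    ∃ n : ℕ, (2 * Y * Q ^ n) • KaehlerDifferential.D k R r ∈ Submodule.span R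
      (Set.range fun i => KaehlerDifferential.D k R
        ((![algebraMap A R u, f, X, Z] : Fin 4 → R) i)) := by
  set N := Submodule.span R (Set.range fun i => KaehlerDifferential.D k R
        ((![algebraMap A R u, f, X, Z] : Fin 4 → R) i))
  have hN : ∀ i, KaehlerDifferential.D k R ((![algebraMap A R u, f, X, Z] : Fin 4 → R) i) ∈ N :=
    fun i => Submodule.subset_span ⟨i, rfl⟩
  obtain ⟨c, hc⟩ := exists_smul_D_eq hl hY
  obtain ⟨n, hn⟩ := hR r
  refine ⟨n, smul_D_mem_of_pow_mul_mem_adjoin N _ (fun a => ?_) ?_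
    (Algebra.adjoin_mono (by grind) hQ) hn⟩
  · exact Submodule.span_mono (by rintro _ rfl; exact ⟨0, rfl⟩) (D_algebraMap_mem_span hu a)
  · rintro r (rfl | rfl | rfl | rfl)
    · exact N.smul_mem _ (hN 2)
    · exact N.smul_mem _ (hN 3)
    · rw [hc]; exact add_mem (N.smul_mem _ (hN 2)) (N.smul_mem _ (hN 3))
    · exact N.smul_mem _ (hN 1)

theorem exists_smul_D_mem_span_right
  (hu : ∀ a : A, KaehlerDifferential.D k A a ∈ Submodule.span A {KaehlerDifferential.D k A u})
  (hl : KaehlerDifferential.D k R l = 0)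
  (hY : Y ^ 2 = X * (X - Z ^ 2) * (X - l * Z ^ 2))
  (hG : G = (X - Z ^ 2) * (X - l * Z ^ 2) + X * (X - l * Z ^ 2) + X * (X - Z ^ 2))
  (hQ : Q ∈ Algebra.adjoin A {X, Z, Y})
  (hR : ∀ r : R, ∃ n : ℕ, Q ^ n * r ∈ Algebra.adjoin A {X, Z, Y, f}) (r : R) :
    ∃ n : ℕ, (G * Q ^ n) • KaehlerDifferential.D k R r ∈ Submodule.span R
      (Set.range fun i => KaehlerDifferential.D k R
        ((![algebraMap A R u, f, Y, Z] : Fin 4 → R) i)) := by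
  set N := Submodule.span R (Set.range fun i => KaehlerDifferential.D k R
        ((![algebraMap A R u, f, Y, Z] : Fin 4 → R) i))
  have hN : ∀ i, KaehlerDifferential.D k R ((![algebraMap A R u, f, Y, Z] : Fin 4 → R) i) ∈ N :=
    fun i => Submodule.subset_span ⟨i, rfl⟩
  obtain ⟨c, hc⟩ := exists_smul_D_eq hl hY
  rw [← hG] at hc
  obtain ⟨n, hn⟩ := hR r
  refine ⟨n, smul_D_mem_of_pow_mul_mem_adjoin N _ (fun a => ?_) ?_
    (Algebra.adjoin_mono (by grind) hQ) hn⟩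
  · exact Submodule.span_mono (by rintro _ rfl; exact ⟨0, rfl⟩) (D_algebraMap_mem_span hu a)
  · rintro r (rfl | rfl | rfl | rfl)
    · rw [← sub_eq_iff_eq_add] at hc
      rw [← hc]
      exact sub_mem (N.smul_mem _ (hN 2)) (N.smul_mem _ (hN 3))
    · exact N.smul_mem _ (hN 3)
    · exact N.smul_mem _ (hN 2)
    · exact N.smul_mem _ (hN 1)

theorem D_mem_span_of_mem_adjoin {L : Type*} [Field L] [Algebra k L] [Algebra R L]
    [IsScalarTower k R L]
  (hu : ∀ a : A, KaehlerDifferential.D k A a ∈ Submodule.span A {KaehlerDifferential.D k A u})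
  (hl : KaehlerDifferential.D k R l = 0)
  (hY : Y ^ 2 = X * (X - Z ^ 2) * (X - l * Z ^ 2)) (hY0 : algebraMap R L (2 * Y) ≠ 0) {r : R}
  (hr : r ∈ Algebra.adjoin A {X, Z, Y}) :
    KaehlerDifferential.D k L (algebraMap R L r) ∈ Submodule.span L
      {KaehlerDifferential.D k L (algebraMap R L (algebraMap A R u)),
        KaehlerDifferential.D k L (algebraMap R L X),
        KaehlerDifferential.D k L (algebraMap R L Z)} := by
  set N := Submodule.span L {KaehlerDifferential.D k L (algebraMap R L (algebraMap A R u)),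
        KaehlerDifferential.D k L (algebraMap R L X),
        KaehlerDifferential.D k L (algebraMap R L Z)}
  have h1 : KaehlerDifferential.D k L (algebraMap R L (algebraMap A R u)) ∈ N :=
    Submodule.subset_span (by simp)
  have h2 : KaehlerDifferential.D k L (algebraMap R L X) ∈ N := Submodule.subset_span (by simp)
  have h3 : KaehlerDifferential.D k L (algebraMap R L Z) ∈ N := Submodule.subset_span (by simp)
  let N' : Submodule R (Ω[R⁄k]) := (N.restrictScalars R).comap (KaehlerDifferential.map k k R L)
  have hN' : ∀ r, KaehlerDifferential.D k R r ∈ N' ↔ KaehlerDifferential.D k L (algebraMap R L r) ∈ N :=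
    fun r => by
      rw [Submodule.mem_comap, KaehlerDifferential.map_D]
      rfl
  rw [← hN']
  refine D_mem_of_mem_adjoin N' (fun a => ?_) ?_ hr
  · refine (Submodule.span_le.mpr ?_ : Submodule.span R _ ≤ N') (D_algebraMap_mem_span hu a)
    rintro _ rfl
    exact (hN' _).mpr h1
  · rintro r (rfl | rfl | rfl)
    · exact (hN' _).mpr h2
    · exact (hN' _).mpr h3
    · rw [hN']
      obtain ⟨c, hc⟩ := exists_smul_D_eq hl hY
      have h4 := congrArg (KaehlerDifferential.map k k R L) hc
      simp only [map_smul, map_add, KaehlerDifferential.map_D] at h4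
      rw [← algebraMap_smul L (2 * r), ← algebraMap_smul L ((X - Z ^ 2) * (X - l * Z ^ 2) +
        X * (X - l * Z ^ 2) + X * (X - Z ^ 2)), ← algebraMap_smul L c] at h4
      have h5 := N.smul_mem (algebraMap R L (2 * r))⁻¹ (add_mem (N.smul_mem (algebraMap R L
        ((X - Z ^ 2) * (X - l * Z ^ 2) + X * (X - l * Z ^ 2) + X * (X - Z ^ 2))) h2)
          (N.smul_mem (algebraMap R L c) h3))
      rwa [← h4, smul_smul, inv_mul_cancel₀ hY0, one_smul] at h5

/-- From `F Q = e f`, with `dQ` and `de` in the span of `du`, `dX`, `dZ`, one may replace `dF` by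
`(e / Q) df` in the form. The remaining coordinate on the cone is `X` where `Y` is a unit and `Y`
where `G`, the derivative of the cubic, is; the two are related by `2 Y dY = G dX + c dZ`. -/
theorem hasCoordinatesAt_of_mem_adjoin [IsDomain R] {p : ℕ} {F e η : R} (h2 : IsUnit (2 : R))
    (hu : ∀ a : A, KaehlerDifferential.D k A a ∈ Submodule.span A {KaehlerDifferential.D k A u})
    (hl : KaehlerDifferential.D k R l = 0)
    (hY : Y ^ 2 = X * (X - Z ^ 2) * (X - l * Z ^ 2))
    (hG : G = (X - Z ^ 2) * (X - l * Z ^ 2) + X * (X - l * Z ^ 2) + X * (X - Z ^ 2))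
    (hQ : Q ∈ Algebra.adjoin A {X, Z, Y}) (he : e ∈ Algebra.adjoin A {X, Z, Y})
    (hR : ∀ r : R, ∃ n : ℕ, Q ^ n * r ∈ Algebra.adjoin A {X, Z, Y, f})
    (hFe : F * Q = e * f) (hf : f ^ p = Q * η) (hY0 : Y ≠ 0) (he0 : e ≠ 0) (P : Ideal R)
    [hP : P.IsPrime] (hQP : Q ∉ P) (hYG : Y ∉ P ∨ G ∉ P) :
    HasCoordinatesAt k ![algebraMap A R u, F, X, Z] (algebraMap A R u * F * Y)
      (algebraMap A R u) η p P := by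
  have hn0 : ∀ {a}, a ∉ P → a ≠ 0 := by rintro _ ha rfl; exact ha P.zero_mem
  have hpow : ∀ {a} (n : ℕ), a ∉ P → a ^ n ∉ P := fun n h h1 => h (hP.mem_of_pow_mem n h1)
  have hmul : ∀ {a b}, a ∉ P → b ∉ P → a * b ∉ P := fun h h' h1 => (hP.mem_or_mem h1).elim h h'
  have h2P : (2 : R) ∉ P := fun h => hP.ne_top (P.eq_top_of_isUnit_mem h h2)
  have hvec : ∀ (L : Type u) [Field L] [Algebra R L] (a b c d : R),
      (fun i => algebraMap R L ((![a, b, c, d] : Fin 4 → R) i)) =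
        ![algebraMap R L a, algebraMap R L b, algebraMap R L c, algebraMap R L d] := by
    intro L _ _ a b c d
    ext i
    fin_cases i <;> rfl
  have hF : ∀ (L : Type u) [Field L] [Algebra k L] [Algebra R L] [IsScalarTower k R L]
      [IsFractionRing R L], algebraMap R L Q • KaehlerDifferential.D k L (algebraMap R L F) -
        algebraMap R L e • KaehlerDifferential.D k L (algebraMap R L f) ∈ Submodule.span L
        {KaehlerDifferential.D k L (algebraMap R L (algebraMap A R u)),
        KaehlerDifferential.D k L (algebraMap R L X),
        KaehlerDifferential.D k L (algebraMap R L Z)} := by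
    intro L _ _ _ _ _
    have hY1 : algebraMap R L (2 * Y) ≠ 0 := by
      rw [map_ne_zero_iff _ (IsFractionRing.injective R L)]
      exact mul_ne_zero h2.ne_zero hY0
    have h1 := D_mem_span_of_mem_adjoin hu hl hY hY1 hQ
    have h3 := D_mem_span_of_mem_adjoin hu hl hY hY1 he
    have h4 := congrArg (fun r => KaehlerDifferential.D k L (algebraMap R L r)) hFe
    simp only [map_mul, Derivation.leibniz] at h4
    have h5 : algebraMap R L Q • KaehlerDifferential.D k L (algebraMap R L F) -
        algebraMap R L e • KaehlerDifferential.D k L (algebraMap R L f) =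
        algebraMap R L f • KaehlerDifferential.D k L (algebraMap R L e) -
        algebraMap R L F • KaehlerDifferential.D k L (algebraMap R L Q) := by
      linear_combination (norm := module) h4
    rw [h5]
    exact sub_mem (Submodule.smul_mem _ _ h3) (Submodule.smul_mem _ _ h1)
  by_cases hYP : Y ∉ P
  · refine ⟨![algebraMap A R u, f, X, Z], e, Q, he0, hn0 hQP, fun r => ?_, ?_, 1, hP.one_notMem,
      Y ^ p * Q, hmul (hpow p hYP) hQP, ?_⟩
    · obtain ⟨n, hn⟩ := exists_smul_D_mem_span_left hu hl hY hQ hR r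
      exact ⟨_, hmul (hmul h2P hYP) (hpow n hQP), hn⟩
    · intro L _ _ _ _ _
      have hQL : algebraMap R L Q ≠ 0 := by
        rw [map_ne_zero_iff _ (IsFractionRing.injective R L)]
        exact hn0 hQP
      have h1 := smul_wedge_eq_of_smul_D_eq (W := algebraMap R L X) (c := 1) (c' := 0) hQL
        one_ne_zero (hF L) (by simp)
      rw [mul_one, mul_one] at h1
      rw [hvec, hvec]
      exact h1
    · linear_combination (algebraMap A R u * Y) ^ p * (congrArg (· ^ p) hFe) +
        (algebraMap A R u * Y * e) ^ p * hf
  · have hGP : G ∉ P := hYG.resolve_left hYP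
    refine ⟨![algebraMap A R u, f, Y, Z], e * (2 * Y), Q * G, mul_ne_zero he0
      (mul_ne_zero h2.ne_zero hY0), hn0 (hmul hQP hGP), fun r => ?_, ?_, 2 ^ p, hpow p h2P,
      Q * G ^ p, hmul hQP (hpow p hGP), ?_⟩
    · obtain ⟨n, hn⟩ := exists_smul_D_mem_span_right hu hl hY hG hQ hR r
      exact ⟨_, hmul hGP (hpow n hQP), hn⟩
    · intro L _ _ _ _ _
      have hQL : algebraMap R L Q ≠ 0 := by
        rw [map_ne_zero_iff _ (IsFractionRing.injective R L)]
        exact hn0 hQP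
      have hGL : algebraMap R L G ≠ 0 := by
        rw [map_ne_zero_iff _ (IsFractionRing.injective R L)]
        exact hn0 hGP
      obtain ⟨c, hc⟩ := exists_smul_D_eq hl hY
      rw [← hG] at hc
      have h4 := congrArg (KaehlerDifferential.map k k R L) hc
      simp only [map_smul, map_add, KaehlerDifferential.map_D] at h4
      rw [← algebraMap_smul L (2 * Y), ← algebraMap_smul L G, ← algebraMap_smul L c] at h4
      have h1 := smul_wedge_eq_of_smul_D_eq (W := algebraMap R L Y) (c := algebraMap R L (2 * Y))
        (c' := - algebraMap R L c) hQL hGL (hF L) (by rw [h4]; module)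
      rw [hvec, hvec, map_mul, map_mul]
      exact h1
    · linear_combination (2 * algebraMap A R u * Y * G) ^ p * (congrArg (· ^ p) hFe) +
        (2 * algebraMap A R u * Y * G * e) ^ p * hf
end

/-! ### The form and the invariants of the fourfold -/

section
open Polynomial

namespace IsEllipticCone

variable {k A B : Type u} [Field k] [CommRing A] [CommRing B] [Algebra k A] [Algebra k B]
  [Algebra A B] [IsScalarTower k A B] {p m : ℕ} [Fact p.Prime] [CharP B p]
  {l u : A} {x z Y : B} {δ ε : Derivation A B B}

/-- The function `f y` on the fourfold, where `f` is the standard eigenvector. -/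
def linearSection (h : IsEllipticCone k m l u x z Y δ ε) (hpm : p = 2 * m + 1) :
    pinchRing u z δ ε :=
  ⟨C h.eigenvector * X, C_mul_X_mem_pinchRing h.der_eigenvector (h.euler_eigenvector hpm)⟩

theorem isUnit_two {R : Type*} [CommRing R] (hp : (p : R) = 0) (hpm : p = 2 * m + 1) :
    IsUnit (2 : R) := by
  refine IsUnit.of_mul_eq_one (-(m : R)) ?_
  subst hpm
  push_cast at hp
  linear_combination -hp

theorem cast_pinchRing : (p : pinchRing u z δ ε) = 0 := Subtype.ext (by simp)

theorem pinchFrob_injective [IsDomain B] : Function.Injective (pinchFrob p u z δ ε) := by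
  refine (injective_iff_map_eq_zero _).mpr fun a ha => ?_
  exact (pow_eq_zero_iff (Fact.out : p.Prime).ne_zero).mp (congrArg Subtype.val ha)

theorem der_pow_char (δ : Derivation A B B)
    (q : B) : δ (q ^ p) = 0 := by
  rw [Derivation.leibniz_pow, ← Nat.cast_smul_eq_nsmul B, CharP.cast_eq_zero, zero_smul]

variable (p) in
theorem pinchFrob_C_mem_adjoin (h : IsEllipticCone k m l u x z Y δ ε) (hpm : p = 2 * m + 1) (q : B) :
    pinchFrob p u z δ ε (C q) ∈ Algebra.adjoin A {pinchFrob p u z δ ε (C x),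
      pinchFrob p u z δ ε (C z), pinchFrob p u z δ ε (C Y)} := by
  have h1 := h.mem_adjoin_pinchRing p hpm (der_pow_char (p := p) δ q) (der_pow_char (p := p) ε q)
  have h2 : pinchFrob p u z δ ε (C q) =
      ⟨C (q ^ p), C_mem_pinchRing (der_pow_char (p := p) δ q) (der_pow_char (p := p) ε q)⟩ :=
    Subtype.ext (C_pow (n := p)).symm
  rwa [h2]

/-- The coordinate functions whose differentials define the form on the fourfold. -/
def coords (h : IsEllipticCone k m l u x z Y δ ε) (hpm : p = 2 * m + 1) :
    Fin 4 → pinchRing u z δ ε :=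
  ![algebraMap A (pinchRing u z δ ε) u, h.linearSection hpm, pinchFrob p u z δ ε (C x),
    pinchFrob p u z δ ε (C z)]

/-- The function whose logarithmic poles compensate the coordinate form. -/
def logPole (h : IsEllipticCone k m l u x z Y δ ε) (hpm : p = 2 * m + 1) :
    pinchRing u z δ ε :=
  algebraMap A (pinchRing u z δ ε) u * h.linearSection hpm * pinchFrob p u z δ ε (C Y)

theorem eigenvector_ne_zero (h : IsEllipticCone k m l u x z Y δ ε) (hpm : p = 2 * m + 1) :
    h.eigenvector ≠ 0 := by
  have hm : m ≠ 0 := by rintro rfl; exact (Fact.out : p.Prime).ne_one (by omega)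
  intro h1
  refine h.not_dvd_eigenvector hm (Dvd.intro _ rfl) h.not_dvd_u ?_
  rw [h1]; exact dvd_zero _

theorem Y_ne_zero (h : IsEllipticCone k m l u x z Y δ ε) : Y ≠ 0 := by
  rintro rfl; exact h.not_dvd_Y_u (dvd_zero _)

theorem hasCoordinatesAt (h : IsEllipticCone k m l u x z Y δ ε) (hpm : p = 2 * m + 1)
    (hA : IsHasseBase k m l u) (P : Ideal (pinchRing u z δ ε)) [hP : P.IsPrime]
    (hP1 : P.height = 1) : HasCoordinatesAt k (h.coords hpm) (h.logPole hpm)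
      (algebraMap A (pinchRing u z δ ε) u) (pinchFrob p u z δ ε X) p P := by
  have := h.isDomain
  have hp1 : p = p - 1 + 1 := by have := (Fact.out : p.Prime).pos; omega
  obtain ⟨q, hq1, hq2, hqP, hYP⟩ := h.exists_eigenvector hpm hA.isUnit_left hA.isUnit_right P
    (Or.inr hP1)
  -- The eigenvalues add up to `t + (p - 1) t = 0`, so the ratio of `F = h y` and `f = q y` is `e /
  -- q ^ p` with `e` a constant of the cone.
  have he : δ (h.eigenvector * q ^ (p - 1)) = 0 ∧ ε (h.eigenvector * q ^ (p - 1)) = 0 := by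
    have h1 : ((p - 1 : ℕ) : B) + 1 = 0 := by
      have := CharP.cast_eq_zero B p
      rw [hp1] at this
      exact_mod_cast this
    constructor
    · rw [der_mul δ h.der_eigenvector (der_pow δ hq1 _)]
      linear_combination (algebraMap A B u * z * (h.eigenvector * q ^ (p - 1))) * h1
    · rw [der_mul ε ((h.euler_eigenvector hpm).trans (zero_mul _).symm)
        (der_pow ε (hq2.trans (zero_mul _).symm) _)]
      simp
  have hq0 : q ≠ 0 := by rintro rfl; simp at hqP
  refine hasCoordinatesAt_of_mem_adjoin (u := u) (f := ⟨C q * X, C_mul_X_mem_pinchRing hq1 hq2⟩)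
    (e := ⟨C _, C_mem_pinchRing he.1 he.2⟩)
    (isUnit_two cast_pinchRing hpm) hA.D_mem_span
    (D_pow_char cast_pinchRing (algebraMap A (pinchRing u z δ ε) l)) (h.pinchFrob_sq_eq p)
    (h.pinchFrob_der_Y p) (h.pinchFrob_C_mem_adjoin p hpm q)
    (h.mem_adjoin_pinchRing p hpm he.1 he.2) (h.exists_pow_mul_mem_adjoin hpm hq1 hq2) ?_ ?_ ?_ ?_ P
    hqP hYP
  · apply Subtype.ext
    change C h.eigenvector * X * (C q) ^ p = C (h.eigenvector * q ^ (p - 1)) * (C q * X)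
    rw [C_mul, C_pow]
    conv_lhs => rw [hp1]
    ring
  · apply Subtype.ext
    change (C q * X) ^ p = (C q) ^ p * X ^ p
    rw [mul_pow]
  · rw [map_ne_zero_iff _ pinchFrob_injective, C_ne_zero]
    exact h.Y_ne_zero
  · intro h1
    have h2 : C (h.eigenvector * q ^ (p - 1)) = 0 := congrArg Subtype.val h1
    exact mul_ne_zero (h.eigenvector_ne_zero hpm) (pow_ne_zero _ hq0) (C_eq_zero.mp h2)

theorem finiteType (h : IsEllipticCone k m l u x z Y δ ε) [Algebra.FiniteType k A] :
    Algebra.FiniteType k B := by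
  have : Algebra.FiniteType A B := by
    classical
    exact ⟨⟨{x, z, Y}, by simpa using h.adjoin_eq_top⟩⟩
  exact Algebra.FiniteType.trans (S := A) inferInstance inferInstance

theorem finiteType_pinchRing (h : IsEllipticCone k m l u x z Y δ ε) (p : ℕ) [Fact p.Prime] [CharP B p] [Algebra.FiniteType k A] :
    Algebra.FiniteType k (pinchRing u z δ ε) := by
  have := h.finiteType
  exact finiteType_constants k _ _ p

theorem isIntegral_pinchRing (p : ℕ) [Fact p.Prime] [CharP B p] : Algebra.IsIntegral (pinchRing u z δ ε) B[X] :=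
  isIntegral_constants _ _ p

theorem ringKrullDim_pinchRing (h : IsEllipticCone k m l u x z Y δ ε) (p : ℕ) [Fact p.Prime] [CharP B p] [Algebra.FiniteType k A] :
    ringKrullDim (pinchRing u z δ ε) = (4 : ℕ) := by
  have := h.finiteType
  have := h.isDomain
  have : IsNoetherianRing B := Algebra.FiniteType.isNoetherianRing k B
  have : Algebra.IsIntegral (pinchRing u z δ ε) B[X] := isIntegral_pinchRing p
  rw [← ringKrullDim_eq_of_isIntegral (pinchRing u z δ ε) B[X],
    Polynomial.ringKrullDim_of_isNoetherianRing, h.ringKrullDim_eq]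
  rfl

theorem four_le_trdeg_pinchRing (h : IsEllipticCone k m l u x z Y δ ε) (p : ℕ) [Fact p.Prime] [CharP B p] :
    ((4 : ℕ) : Cardinal) ≤ Algebra.trdeg k (pinchRing u z δ ε) := by
  have := h.isDomain
  have : Algebra.IsIntegral (pinchRing u z δ ε) B[X] := isIntegral_pinchRing p
  rw [← trdeg_eq_of_isIntegral k (pinchRing u z δ ε) B[X], trdeg_polynomial]
  calc ((4 : ℕ) : Cardinal) = 3 + 1 := by norm_num
    _ ≤ _ := by gcongr; exact h.three_le_trdeg

theorem isNonzeroForm_coords (h : IsEllipticCone k m l u x z Y δ ε) (hpm : p = 2 * m + 1)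
    (hA : IsHasseBase k m l u) : IsNonzeroForm k (pinchRing u z δ ε) (h.coords hpm) := by
  have := h.isDomain
  have := hA.finiteType
  have := h.finiteType_pinchRing p
  refine isNonzeroForm_of_span (h.four_le_trdeg_pinchRing p) _ fun r => ?_
  obtain ⟨n, hn⟩ := exists_smul_D_mem_span_left (u := u) (f := h.linearSection hpm) hA.D_mem_span
    (D_pow_char cast_pinchRing (algebraMap A (pinchRing u z δ ε) l)) (h.pinchFrob_sq_eq p)
    (h.pinchFrob_C_mem_adjoin p hpm h.eigenvector)
    (h.exists_pow_mul_mem_adjoin hpm h.der_eigenvector (h.euler_eigenvector hpm)) r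
  refine ⟨_, ?_, hn⟩
  refine mul_ne_zero (mul_ne_zero (isUnit_two cast_pinchRing hpm).ne_zero ?_) (pow_ne_zero _ ?_) <;>
    rw [map_ne_zero_iff _ pinchFrob_injective, C_ne_zero]
  exacts [h.Y_ne_zero, h.eigenvector_ne_zero hpm]

end IsEllipticCone

/-! ### The divisor `u = 0` is not weakly normal -/

theorem exists_pow_mul_of_mem_adjoin {R T : Type*} [CommRing R] [CommRing T] [Algebra R T]
    {c : R} {y b : T} (hy : ∃ r, algebraMap R T r = algebraMap R T c * y)
    (hb : b ∈ Algebra.adjoin R {y}) :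
    ∃ n : ℕ, ∃ r, algebraMap R T r = algebraMap R T c ^ n * b := by
  induction hb using Algebra.adjoin_induction with
  | mem b hb =>
    obtain rfl := hb
    obtain ⟨r, hr⟩ := hy
    exact ⟨1, r, by rw [pow_one, hr]⟩
  | algebraMap r => exact ⟨0, r, by rw [pow_zero, one_mul]⟩
  | add b b' _ _ hb hb' =>
    obtain ⟨n, r, hr⟩ := hb
    obtain ⟨n', r', hr'⟩ := hb'
    refine ⟨n + n', c ^ n' * r + c ^ n * r', ?_⟩
    rw [map_add, map_mul, map_mul, map_pow, map_pow, hr, hr']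
    ring
  | mul b b' _ _ hb hb' =>
    obtain ⟨n, r, hr⟩ := hb
    obtain ⟨n', r', hr'⟩ := hb'
    refine ⟨n + n', r * r', ?_⟩
    rw [map_mul, hr, hr']
    ring

namespace IsEllipticCone

variable {k A B : Type u} [Field k] [CommRing A] [CommRing B] [Algebra k A] [Algebra k B]
  [Algebra A B] [IsScalarTower k A B] {p m : ℕ} [Fact p.Prime] [CharP B p]
  {l u : A} {x z Y : B} {δ ε : Derivation A B B}

/-- The ring of the preimage of the divisor `u = 0` under the Frobenius map. -/
abbrev FrobDivisor (B : Type u) [CommRing B] [Algebra A B] (u : A) : Type u :=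
  B[X] ⧸ Ideal.span {C (algebraMap A B u)}

theorem isDomain_frobDivisor [IsDomain B] (hu : Prime (algebraMap A B u)) : IsDomain (FrobDivisor B u) := by
  have hu' : Prime (C (algebraMap A B u)) := prime_C_iff.mpr hu
  rw [Ideal.Quotient.isDomain_iff_prime]
  exact (Ideal.span_singleton_prime hu'.ne_zero).mpr hu'

/-- If a constant equals `u s` in `B[y]`, then `s` is itself a constant. -/
theorem ker_algebraMap_frobDivisor [IsDomain B] (hu : algebraMap A B u ≠ 0) :
    RingHom.ker (algebraMap (pinchRing u z δ ε) (FrobDivisor B u)) =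
      Ideal.span {algebraMap A (pinchRing u z δ ε) u} := by
  refine le_antisymm (fun r hr => ?_) ?_
  · have h1 : Ideal.Quotient.mk (Ideal.span {C (algebraMap A B u)}) (r : B[X]) = 0 := hr
    rw [Ideal.Quotient.eq_zero_iff_mem, Ideal.mem_span_singleton] at h1
    obtain ⟨s, hs⟩ := h1
    have h2 : s ∈ pinchRing u z δ ε := by
      refine mem_constants_of_mul_mem _ _ (a := C (algebraMap A B u)) ?_ ?_ (hs ▸ r.2)
      · exact (algebraMap A (pinchRing u z δ ε) u).2
      · exact C_ne_zero.mpr hu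
    exact Ideal.mem_span_singleton.mpr ⟨⟨s, h2⟩, Subtype.ext hs⟩
  · rw [Ideal.span_singleton_le_iff_mem, RingHom.mem_ker]
    exact Ideal.Quotient.eq_zero_iff_mem.mpr (Ideal.mem_span_singleton_self _)

theorem isReduced_quotient [IsDomain B] (hu : Prime (algebraMap A B u)) :
    IsReduced (pinchRing u z δ ε ⧸ Ideal.span {algebraMap A (pinchRing u z δ ε) u}) := by
  have := isDomain_frobDivisor hu
  exact isReduced_quotient_of_ker _ _ (ker_algebraMap_frobDivisor hu.ne_zero)

/-- Adjoin the class of `y` to `R / u` inside `B[y] / u`. Its `p`-th power comes from `R`, and `h y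
≡ c y` with `c` the conductor puts it in the fraction field. A lift of `y` to `R` would have a
coefficient `1 - u b` that is an eigenvector, contrary to `der_ne`. -/
theorem not_isWeaklyNormal (h : IsEllipticCone k m l u x z Y δ ε) (hpm : p = 2 * m + 1)
    [Algebra.FiniteType k A] {S : Scheme.{u}} (e : S ≅ Spec (CommRingCat.of
      (pinchRing u z δ ε ⧸ Ideal.span {algebraMap A (pinchRing u z δ ε) u}))) :
    ¬ IsWeaklyNormal S := by
  have hm : m ≠ 0 := by rintro rfl; exact (Fact.out : p.Prime).ne_one (by omega)
  have := h.isDomain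
  have := isDomain_frobDivisor h.prime_u
  have := h.finiteType_pinchRing p
  let y : FrobDivisor B u := Ideal.Quotient.mk _ X
  let T := Algebra.adjoin (pinchRing u z δ ε) {y}
  have : Algebra.FiniteType (pinchRing u z δ ε) T :=
    T.fg_iff_finiteType.mp ⟨{y}, by rw [Finset.coe_singleton]⟩
  have : Algebra.FiniteType k T := Algebra.FiniteType.trans (S := pinchRing u z δ ε)
    inferInstance inferInstance
  let τ : pinchRing u z δ ε →ₐ[k] T := IsScalarTower.toAlgHom k _ T
  have hτ : ∀ r, (τ r : FrobDivisor B u) = Ideal.Quotient.mk _ (r : B[X]) := fun r => rfl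
  have hzero : ∀ f : B[X], Ideal.Quotient.mk (Ideal.span {C (algebraMap A B u)}) f = 0 ↔
      ∀ n, algebraMap A B u ∣ f.coeff n := fun f => by
    rw [Ideal.Quotient.eq_zero_iff_mem, Ideal.mem_span_singleton, C_dvd_iff_dvd_coeff]
  let c : pinchRing u z δ ε := ⟨C h.conductor, C_mem_pinchRing h.der_conductor (h.euler_conductor hpm)⟩
  have hcy : (τ (h.linearSection hpm) : FrobDivisor B u) = τ c * y := by
    rw [hτ, hτ, ← map_mul, ← sub_eq_zero, ← map_sub, hzero]
    intro n
    change _ ∣ (C h.eigenvector * X - C h.conductor * X).coeff n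
    rw [← sub_mul, ← C_sub, coeff_C_mul]
    exact (h.dvd_eigenvector_sub_conductor hm).mul_right _
  refine not_isWeaklyNormal_quotient (k := k) (R := pinchRing u z δ ε) (B := T) p ?_ τ (algebraMap A (pinchRing u z δ ε) u) ?_ ?_ ?_ c ?_ ?_ e
  · apply Subtype.ext
    have h1 : (p : FrobDivisor B u) = 0 := by
      rw [← map_natCast (Ideal.Quotient.mk (Ideal.span {C (algebraMap A B u)})),
        CharP.cast_eq_zero, map_zero]
    simpa using h1
  · rw [← ker_algebraMap_frobDivisor (z := z) (δ := δ) (ε := ε) h.prime_u.ne_zero]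
    ext r
    exact Subtype.ext_iff
  · intro hs
    obtain ⟨r, hr⟩ := hs ⟨y, Algebra.subset_adjoin rfl⟩
    have h1 : (τ r : FrobDivisor B u) = y := congrArg Subtype.val hr
    rw [hτ, eq_comm, ← sub_eq_zero, ← map_sub, hzero] at h1
    obtain ⟨b, hb⟩ := h1 1
    rw [coeff_sub, coeff_X_one] at hb
    have h2 : (r : B[X]).coeff 1 = 1 - algebraMap A B u * b := by rw [← hb]; ring
    have h3 := ((mem_twistedConstants δ ε _ _).mp r.2 1).1
    rw [h2] at h3
    exact h.der_ne b (h3.trans (by push_cast; ring))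
  · rintro ⟨b, hb⟩
    obtain ⟨f, rfl⟩ := Ideal.Quotient.mk_surjective b
    exact ⟨pinchFrob p u z δ ε f, Subtype.ext rfl⟩
  · intro h1
    have h2 := congrArg Subtype.val h1
    change Ideal.Quotient.mk _ (C h.conductor) = 0 at h2
    rw [hzero] at h2
    exact h.not_dvd_conductor hm (by simpa using h2 0)
  · rintro ⟨b, hb⟩
    obtain ⟨n, r, hr⟩ := exists_pow_mul_of_mem_adjoin (c := c) ⟨_, hcy⟩ hb
    exact ⟨n, r, Subtype.ext hr⟩

end IsEllipticCone

end

/-! ### Logarithmic poles from the invariant differential -/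

/-- The invariant differential of a Legendre curve over a field of fractions is regular at every
discrete valuation. -/
theorem exists_inv_smul_D_eq {k O L : Type*} [Field k] [CommRing O] [IsDomain O]
    [IsDiscreteValuationRing O] [Field L] [Algebra O L] [IsFractionRing O L] [Algebra k O]
    [Algebra k L] [IsScalarTower k O L] {l : O} (hl : IsUnit l)
    (hl' : IsUnit (1 - l)) (hDl : KaehlerDifferential.D k L (algebraMap O L l) = 0) {x y : L}
    (hy0 : y ≠ 0) (hy : y ^ 2 = x * (x - 1) * (x - algebraMap O L l)) :
    ∃ c b : O, y⁻¹ • KaehlerDifferential.D k L x =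
      algebraMap O L c • KaehlerDifferential.D k L (algebraMap O L b) := by
  have hinj := IsFractionRing.injective O L
  have hint : ∀ w : L, ∀ a : O, w ^ 2 = algebraMap O L a → ∃ b : O, algebraMap O L b = w := by
    intro w a h
    refine IsIntegrallyClosed.isIntegral_iff.mp (IsIntegral.of_pow two_pos (x := w) (R := O) ?_)
    rw [h]; exact isIntegral_algebraMap
  have hcase : (∃ a : O, algebraMap O L a = x) ∨
      ∃ a : O, algebraMap O L a * x = 1 ∧ a ∈ IsLocalRing.maximalIdeal O := by
    rcases ValuationRing.isInteger_or_isInteger O x with ⟨a, ha⟩ | ⟨a, ha⟩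
    · exact Or.inl ⟨a, ha⟩
    · have hx0 : x ≠ 0 := by rintro rfl; apply hy0; simpa using hy
      have h1 : algebraMap O L a * x = 1 := by
        rw [ha, inv_mul_cancel₀ hx0]
      by_cases hu : IsUnit a
      · obtain ⟨b, hb⟩ := hu.exists_right_inv
        refine Or.inl ⟨b, ?_⟩
        have h3 := congrArg (algebraMap O L) hb
        rw [map_mul, map_one] at h3
        linear_combination (algebraMap O L b) * (-h1) + x * h3
      · exact Or.inr ⟨a, h1, hu⟩
  rcases hcase with ⟨a, rfl⟩ | ⟨ξ, hξ, hξm⟩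
  · obtain ⟨b, rfl⟩ := hint y (a * (a - 1) * (a - l)) (by rw [hy]; simp)
    by_cases hb : IsUnit b
    · obtain ⟨c, hc⟩ := hb.exists_right_inv
      refine ⟨c, a, ?_⟩
      congr 1
      exact inv_eq_of_mul_eq_one_right (by rw [← map_mul, hc, map_one])
    -- If `y` is not a unit, the derivative `f'(x)` of the cubic is one, and `dx / y = 2 dy /
    -- f'(x)`.
    · have hyO : b ^ 2 = a * (a - 1 ^ 2) * (a - l * 1 ^ 2) := hinj (by simp [hy])
      have hf : IsUnit ((a - 1 ^ 2) * (a - l * 1 ^ 2) + a * (a - l * 1 ^ 2) + a * (a - 1 ^ 2)) := by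
        by_contra h
        have h1 := mem_of_cubic_mem (IsLocalRing.maximalIdeal O) hl hl' (x := a) (z := 1)
          (by rw [← hyO, pow_two]; exact Ideal.mul_mem_left _ _ hb) h
        exact h1 isUnit_one
      obtain ⟨c, hc⟩ := hf.exists_right_inv
      have hcL := congrArg (algebraMap O L) hc
      simp only [map_mul, map_add, map_sub, map_one, one_pow, mul_one] at hcL
      have h3 := congrArg (KaehlerDifferential.D k L) hy
      simp only [Derivation.leibniz, Derivation.leibniz_pow, map_sub, hDl,
        ← Nat.cast_smul_eq_nsmul L, Derivation.map_one_eq_zero, sub_zero, smul_smul, ← add_smul] at h3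
      refine ⟨2 * c, b, ?_⟩
      rw [inv_smul_eq_iff₀ hy0, smul_smul]
      have h4 := congrArg (algebraMap O L c • ·) h3
      simp only [smul_smul] at h4
      have h5 : (1 : L) • KaehlerDifferential.D k L (algebraMap O L a) =
        (algebraMap O L b * algebraMap O L (2 * c)) • KaehlerDifferential.D k L (algebraMap O L b) := by
        rw [← hcL]
        simp only [map_mul, map_ofNat]
        push_cast at h4
        linear_combination (norm := module) -h4
      rwa [one_smul] at h5
  · have hx0 : x ≠ 0 := right_ne_zero_of_mul_eq_one hξ
    have hξ0 : algebraMap O L ξ ≠ 0 := left_ne_zero_of_mul_eq_one hξ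
    have hunit : ∀ a ∈ IsLocalRing.maximalIdeal O, IsUnit (1 - a) := by
      intro a ha
      by_contra h
      have h1 : (1 : O) ∈ IsLocalRing.maximalIdeal O := by
        have := add_mem h ha
        rwa [sub_add_cancel] at this
      exact h1 isUnit_one
    have hv := (hunit ξ hξm).mul (hunit (l * ξ) (Ideal.mul_mem_left _ _ hξm))
    obtain ⟨v', hv'⟩ := hv.exists_right_inv
    have hvL := congrArg (algebraMap O L) hv'
    simp only [map_mul, map_sub, map_one] at hvL
    -- Near the origin of the curve the parameter is `ζ = x / y`. With `ξ = 1 / x` the equation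
    -- reads `ξ = ζ² (1 - ξ)(1 - l ξ)`, so `dξ`, and with it `dx / y`, is a regular multiple of
    -- `dζ`.
    have hζ : (x / y) ^ 2 = algebraMap O L (ξ * v') := by
      rw [div_pow, div_eq_iff (pow_ne_zero 2 hy0), hy, map_mul]
      have h3 : x * (x - 1) * (x - algebraMap O L l) = x ^ 3 * ((1 - algebraMap O L ξ) *
          (1 - algebraMap O L l * algebraMap O L ξ)) := by
        linear_combination (exp := 1) (-(x ^ 2) - x ^ 2 * algebraMap O L l + algebraMap O L l * x * (algebraMap O L ξ * x + 1)) * (-hξ)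
      rw [h3]
      linear_combination (- x ^ 3 * algebraMap O L ξ) * hvL - x ^ 2 * hξ
    obtain ⟨ζ, hζ'⟩ := hint _ _ hζ
    have hζ2 : ζ ^ 2 = ξ * v' := hinj (by rw [map_pow, hζ', hζ])
    have hζm : ζ ^ 2 ∈ IsLocalRing.maximalIdeal O := hζ2 ▸ Ideal.mul_mem_right _ _ hξm
    have hw : IsUnit (1 - ζ ^ 2 * (-(1 - l * ξ) - l * (1 - ξ))) :=
      hunit _ (Ideal.mul_mem_right _ _ hζm)
    obtain ⟨w', hw'⟩ := hw.exists_right_inv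
    have hwL := congrArg (algebraMap O L) hw'
    simp only [map_mul, map_sub, map_one, map_neg, map_pow] at hwL
    have hrel : algebraMap O L ξ = algebraMap O L ζ ^ 2 * ((1 - algebraMap O L ξ) *
          (1 - algebraMap O L l * algebraMap O L ξ)) := by
      have h3 : ξ = ζ ^ 2 * ((1 - ξ) * (1 - l * ξ)) := by
        rw [hζ2]; linear_combination -ξ * hv'
      have := congrArg (algebraMap O L) h3
      simpa only [map_mul, map_sub, map_one, map_pow] using this
    have hyζ : y * algebraMap O L ζ * algebraMap O L ξ = 1 := by
      rw [hζ', mul_div_cancel₀ _ hy0, mul_comm, hξ]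
    have hxξ : x = (algebraMap O L ξ)⁻¹ := eq_inv_of_mul_eq_one_right hξ
    set X := algebraMap O L ξ
    set Z := algebraMap O L ζ
    set W := algebraMap O L w'
    set l' := algebraMap O L l
    have h3 := congrArg (KaehlerDifferential.D k L) hrel
    simp only [Derivation.leibniz, Derivation.leibniz_pow, map_sub, hDl, smul_zero, add_zero,
        ← Nat.cast_smul_eq_nsmul L, Derivation.map_one_eq_zero, zero_sub, smul_smul] at h3
    push_cast at h3
    have h4 : KaehlerDifferential.D k L X =
        (W * (2 * Z * ((1 - X) * (1 - l' * X)))) • KaehlerDifferential.D k L Z := by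
      have h5 : ((1 - Z ^ 2 * (-(1 - l' * X) - l' * (1 - X))) * W) • KaehlerDifferential.D k L X =
        (W * (2 * Z * ((1 - X) * (1 - l' * X)))) • KaehlerDifferential.D k L Z := by
        linear_combination (norm := module) W • h3
      rwa [hwL, one_smul] at h5
    refine ⟨-2 * w', ζ, ?_⟩
    rw [inv_smul_eq_iff₀ hy0, smul_smul, hxξ]
    have h5 : KaehlerDifferential.D k L X⁻¹ = (-(X⁻¹ ^ 2)) • KaehlerDifferential.D k L X := by
      rw [Derivation.leibniz_inv]
    rw [h5, h4, smul_smul]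
    congr 1
    have hyX : y = (Z * X)⁻¹ := by
      exact eq_inv_of_mul_eq_one_left (by rw [← hyζ]; ring)
    have hZ0 : Z ≠ 0 := right_ne_zero_of_mul (left_ne_zero_of_mul_eq_one hyζ)
    rw [hyX]
    simp only [map_mul, map_neg, map_ofNat]
    field_simp
    linear_combination 2 * W * hrel

/-- Dividing by powers of `Z` gives a point `(X / Z², Y / Z³)` of a Legendre curve. The form is then
`U F Y` times the wedge of `dlog U`, `dlog F`, the invariant differential and `dlog Z`. -/
theorem hasLogPoles_of_sq_eq {k R : Type u} [Field k] [CommRing R] [IsDomain R] [Algebra k R]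
    {U F X Y Z l : R} (hU : U ≠ 0) (hF : F ≠ 0) (hY0 : Y ≠ 0) (hZ : Z ≠ 0)
    (hl : IsUnit l) (hl' : IsUnit (1 - l)) (hDl : KaehlerDifferential.D k R l = 0)
    (hY : Y ^ 2 = X * (X - Z ^ 2) * (X - l * Z ^ 2)) :
    HasLogPoles k R ![U, F, X, Z] (U * F * Y) := by
  intro O L _ _ _ _ _ _ _ _ _ _ _ _ _ _ _ b hb ϖ hϖ
  have hinj := IsFractionRing.injective R L
  set g := algebraMap R L
  have hg0 : ∀ {r}, r ≠ 0 → g r ≠ 0 := (map_ne_zero_iff g hinj).mpr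
  have hgO : ∀ r, g r = algebraMap O L (algebraMap R O r) := fun r =>
    IsScalarTower.algebraMap_apply _ O L r
  have hZ0 := hg0 hZ
  have hYL := congrArg g hY
  simp only [map_mul, map_sub, map_pow] at hYL
  have hy0 : g Y / g Z ^ 3 ≠ 0 := div_ne_zero (hg0 hY0) (pow_ne_zero _ hZ0)
  obtain ⟨c, e, hce⟩ := exists_inv_smul_D_eq (k := k) (hl.map (algebraMap R O))
    (by have := hl'.map (algebraMap R O); rwa [map_sub, map_one] at this)
    (by
      rw [← hgO]
      have := congrArg (KaehlerDifferential.map k k R L) hDl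
      rwa [KaehlerDifferential.map_D, map_zero] at this)
    (x := g X / g Z ^ 2) hy0 (by
      rw [← hgO]
      field_simp
      linear_combination hYL)
  -- Hence `dX = Z² d(X / Z²) + 2 X dlog Z`, the third row of the matrix below.
  have hX : g X = g X / g Z ^ 2 * g Z ^ 2 := by field_simp
  refine exists_smul_wedge_eq_of_det b hb hϖ.ne_zero
    ![dlog k (g U), dlog k (g F), (g Y / g Z ^ 3)⁻¹ • KaehlerDifferential.D k L (g X / g Z ^ 2),
      dlog k (g Z)] ?_ _
    !![g U, 0, 0, 0; 0, g F, 0, 0; 0, 0, g Z ^ 2 * (g Y / g Z ^ 3), 2 * g X; 0, 0, 0, g Z] ?_ _ 1 ?_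
  · intro i
    fin_cases i
    · exact dlog_mem_logForms k hϖ (hg0 hU)
    · exact dlog_mem_logForms k hϖ (hg0 hF)
    · change _ • _ ∈ _
      rw [hce, algebraMap_smul]
      exact Submodule.smul_mem _ _ (D_mem_logForms k ϖ e)
    · exact dlog_mem_logForms k hϖ hZ0
  · intro i
    fin_cases i
    · simp [Fin.sum_univ_four, smul_dlog k (hg0 hU)]
    · simp [Fin.sum_univ_four, smul_dlog k (hg0 hF)]
    · have h1 := congrArg (KaehlerDifferential.D k L) hX
      rw [Derivation.leibniz, Derivation.leibniz_pow, ← smul_dlog k hZ0,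
        ← Nat.cast_smul_eq_nsmul L] at h1
      have h2 : (g Z ^ 2 * (g Y / g Z ^ 3)) • (g Y / g Z ^ 3)⁻¹ •
          KaehlerDifferential.D k L (g X / g Z ^ 2) =
          g Z ^ 2 • KaehlerDifferential.D k L (g X / g Z ^ 2) := by
        rw [smul_smul, mul_assoc, mul_inv_cancel₀ hy0, mul_one]
      have h3 : KaehlerDifferential.D k L (g X) = (g Z ^ 2 * (g Y / g Z ^ 3)) •
        (g Y / g Z ^ 3)⁻¹ • KaehlerDifferential.D k L (g X / g Z ^ 2) +
          (2 * g X) • dlog k (g Z) := by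
        rw [h1, h2, add_comm, smul_smul, smul_smul, smul_smul]
        congr 2
        push_cast
        field_simp
      simpa [Fin.sum_univ_four] using h3
    · simp [Fin.sum_univ_four, smul_dlog k hZ0]
  · simp [Matrix.det_succ_row_zero, Fin.sum_univ_succ, Fin.succAbove]
    field_simp

/-! ### The pair in odd characteristic -/

section
open Polynomial

/-- The pair given by a fourfold with a purely inseparable cover by a family of cones over elliptic
curves, whose Hasse invariant vanishes along a divisor. -/
theorem IsEllipticCone.exists_pair {k A B : Type u} [Field k] [CommRing A] [CommRing B]
    [Algebra k A] [Algebra k B] [Algebra A B] [IsScalarTower k A B] {p m : ℕ} [Fact p.Prime]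
    [CharP B p] {l u : A} {x z Y : B} {δ ε : Derivation A B B}
    (h : IsEllipticCone k m l u x z Y δ ε) (hpm : p = 2 * m + 1) (hA : IsHasseBase k m l u) :
    ∃ (X : Scheme.{u}) (σ : X ⟶ Spec (CommRingCat.of k))
      (_ : IsIntegral X) (_ : IsLocallyNoetherian X),
      IsNormalVariety X σ ∧ topologicalKrullDim X = (4 : ℕ) ∧
      ∃ (S : X.IdealSheafData) (D Δ : QDivisor X),
        IsEffectiveCartier S ∧ IsWeilDivisorOf S D ∧ 0 ≤ Δ ∧ IsLogCanonical σ 4 (D + Δ) ∧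
        IsReduced S.subscheme ∧ ¬ IsWeaklyNormal S.subscheme := by
  have := h.isDomain
  have := h.isIntegrallyClosed
  have := hA.finiteType
  have hp : p.Prime := Fact.out
  have := h.finiteType_pinchRing p
  have : IsIntegrallyClosed (pinchRing u z δ ε) := isIntegrallyClosed_constants _ _
  have hu : algebraMap A (pinchRing u z δ ε) u ≠ 0 := fun h1 =>
    h.prime_u.ne_zero (C_eq_zero.mp (congrArg Subtype.val h1))
  have hF : h.linearSection hpm ≠ 0 := fun h1 =>
    mul_ne_zero (C_ne_zero.mpr (h.eigenvector_ne_zero hpm)) X_ne_zero (congrArg Subtype.val h1)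
  have hΦ : ∀ {f}, f ≠ 0 → pinchFrob p u z δ ε f ≠ 0 :=
    (map_ne_zero_iff _ pinchFrob_injective).mpr
  have hY := hΦ (C_ne_zero.mpr h.Y_ne_zero)
  have hl' : IsUnit (1 - algebraMap A (pinchRing u z δ ε) l ^ p) := by
    have h1 : 1 - algebraMap A (pinchRing u z δ ε) l ^ p =
        (pinchFrob p u z δ ε).comp (C.comp (algebraMap A B)) (1 - l) := by
      rw [map_sub, map_one]
      rfl
    rw [h1]
    exact hA.isUnit_right.map _
  -- The equation of `S` is `u`, and `Δ` is `(1/p) div (y ^ p)`, the denominator being fixed by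
  -- `hp.pos`.
  refine exists_logCanonical_pair (k := k) (h.ringKrullDim_pinchRing p) (h.coords hpm) (h.logPole hpm)
    (algebraMap A _ u) (pinchFrob p u z δ ε X) (mul_ne_zero (mul_ne_zero hu hF) hY) hu (hΦ X_ne_zero)
    hp.pos (h.isNonzeroForm_coords hpm hA) ?_ (fun P hP hP1 => h.hasCoordinatesAt hpm hA P hP1)
    (isReduced_quotient h.prime_u) (fun S e => h.not_isWeaklyNormal hpm e)
  exact hasLogPoles_of_sq_eq hu hF hY (hΦ (C_ne_zero.mpr h.prime_z.ne_zero))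
    ((hA.isUnit_left.map (algebraMap A _)).pow p) hl' (D_pow_char cast_pinchRing _)
    (h.pinchFrob_sq_eq p)

end

end

end LCPairs

theorem corollary3 (p : ℕ) (hp : p.Prime) (k : Type u) [Field k] [IsAlgClosed k] [CharP k p] :
    ∃ (X : Scheme.{u}) (s : X ⟶ Spec (CommRingCat.of k))
      (_ : IsIntegral X) (_ : IsLocallyNoetherian X),
      LCPairs.IsNormalVariety X s ∧ topologicalKrullDim X = 4 ∧
      ∃ (S : X.IdealSheafData) (D Δ : LCPairs.QDivisor X),
        LCPairs.IsEffectiveCartier S ∧ LCPairs.IsWeilDivisorOf S D ∧ 0 ≤ Δ ∧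
        LCPairs.IsLogCanonical s 4 (D + Δ) ∧
        IsReduced S.subscheme ∧ ¬ LCPairs.IsWeaklyNormal S.subscheme := by
  rcases hp.eq_two_or_odd' with rfl | ⟨m, hm⟩
  · exact LCPairs.Pinch.exists_pair k
  · have : Fact p.Prime := ⟨hp⟩
    obtain ⟨A, _, _, l, u, hA⟩ := LCPairs.exists_isHasseBase k hm
    have h := LCPairs.isEllipticCone hm hA
    have := h.isDomain
    have : CharP (LCPairs.LegendreRing l) p := charP_of_injective_algebraMap
      (algebraMap k (LCPairs.LegendreRing l)).injective p
    exact h.exists_pair hm hA
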